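/- **Setting.** Let $\mathbb N_*=\{1,2,\dots\}$, $\overline{\mathbb N}_*=\mathbb N_*\cup\{\infty\}$, and let $0<\alpha_1<\alpha_2<\dots<1$ with $\alpha_k\to1$. On a probability space consider the following independent objects: for each $k\ge1$ and each $v\in\mathbb N_*^{k-1}$, the ordered points $\gamma_k(v1)>\gamma_k(v2)>\dots>0$ of a Poisson point process on $(0,\infty)$ with intensity $c_k t^{-1-\alpha_k}\,dt$, where $c_k=\alpha_k/\Gamma(1-\alpha_k/\alpha_{k+1})$; for each $k,x\in\mathbb N_*$, a rate $1$ Poisson process $N^{k,x}$ with marks $0<\sigma^{k,x}_1<\sigma^{k,x}_2<\dots$; and for each $k,x,i\in\mathbb N_*$, a mean $1$ exponential random variable $T^{k,x}_i$. Put $X_0\equiv\emptyset$ and, recursively for $k\ge1$ and $t\ge0$, $$\Xi_k(t)=\sum_{x\in\mathbb N_*}\sum_{i=1}^{N^{k,x}(t)}\gamma_k\bigl(X_{k-1}(\sigma^{k,x}_i)\,x\bigr)\,T^{k,x}_i,\qquad \Xi_k^{-1}(t)=\inf\{r\ge0:\Xi_k(r)>t\},$$ and $X_k(t)=\bigl(X_{k-1}(\Xi_k^{-1}(t)),x\bigr)$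 if $t\in\bigcup_i[\Xi_k(\sigma^{k,x}_i-),\Xi_k(\sigma^{k,x}_i))$, while $X_k(t)=\bigl(X_{k-1}(\Xi_k^{-1}(t)),\infty\bigr)$ if there is no such $x\in\mathbb N_*$. (Almost surely $X_{k-1}(\sigma^{k,x}_i)\in\mathbb N_*^{k-1}$ for all $i,x$; by convention the terms with an infinite coordinate are $0$.) For $y=(y_1,\dots,y_n)\in\mathbb N_*^n$ let $\overline\gamma_n(y)=\prod_{j=1}^n\gamma_j(y_1\cdots y_j)$, and for $k\ge0$ and $x\in\mathbb N_*^k$ let $$W(x)=\lim_{n\to\infty}\ \sum_{y\in\mathbb N_*^n:\ (y_1,\dots,y_k)=x}\left(\frac{\overline\gamma_n(y)}{\overline\gamma_k(x)}\right)^{\alpha_{n+1}}.$$ Let $$\widetilde\Xi_n(t)=\sum_{x\in\mathbb N_*}\sum_{i=1}^{N^{n,x}(t)}W\bigl(X_{n-1}(\sigma^{n,x}_i)\,x\bigr)\,\gamma_n\bigl(X_{n-1}(\sigma^{n,x}_i)\,x\bigr)\,T^{n,x}_i,\qquad \widetilde\theta_k^n=\widetilde\Xi_n\circ\Xi_{n-1}\circ\dots\circ\Xi_k\quad(n\ge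 k).$$ A *limiting clock* $\theta_k^\infty$ is a $[0,\infty)$-valued process $(\theta_k^\infty(t))_{t\ge0}$ with almost surely nondecreasing right-continuous paths for which there is a countable, deterministic and dense set $D_k\subset[0,\infty)$ such that, for every $t\in D_k$, $\lim_{n\to\infty}\widetilde\theta_k^n(t)=\theta_k^\infty(t)$ almost surely. **Theorem (Non-triviality).** Suppose that $$\sum_{k=1}^\infty\frac{1-\alpha_{k+1}}{1-\alpha_k}<\infty.$$ Then, almost surely, the limit $W(x)$ exists and is finite for every $x\in\bigcup_{k\ge0}\mathbb N_*^k$; and for every $k\in\mathbb N_*$ a limiting clock $\theta_k^\infty$ exists, and every such $\theta_k^\infty$ is almost surely a strictly increasing function with $\lim_{t\to\infty}\theta_k^\infty(t)=\infty$. -/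

import Mathlib

open Filter Topology MeasureTheory ProbabilityTheory
open scoped NNReal ENNReal

noncomputable section

/-! Conventions.  The labels `1, 2, 3, …` of the children of a node, of the marks of a point process
and of the levels are all shifted by one, so that they run through `ℕ`; in particular `α k` is the
parameter of level `k + 1`.  A node `(x_1, …, x_k)` of the tree at depth `k` is the list
`[x_k, …, x_1]` (last coordinate first), so that `y :: x` is the child of `x` with label `y`.
States, whose coordinates may also be infinite, are lists with entries in `ℕ∞`. -/

/-- The number of points of the sequence `p i ω` that lie in `A`. -/
def pointCount {Ω : Type*} (p : ℕ → Ω → ℝ) (A : Set ℝ) (ω : Ω) : ℝ≥0∞ :=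
  ∑' i, A.indicator (fun _ => (1 : ℝ≥0∞)) (p i ω)

/-- The random variables `p 0, p 1, …` enumerate the points of a Poisson point process with
intensity measure `μ`: the number of points in a measurable set `A` has the Poisson distribution of
mean `μ A` (it is almost surely infinite if `μ A = ∞`), and the numbers of points in disjoint sets
are independent. -/
structure IsPoissonPointProcess {Ω : Type*} [MeasurableSpace Ω] (P : Measure Ω) (μ : Measure ℝ)
    (p : ℕ → Ω → ℝ) : Prop where
  measurable : ∀ i, Measurable (p i)
  law : ∀ A : Set ℝ, MeasurableSet A → μ A ≠ ∞ →
    P.map (pointCount p A) =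
      (poissonMeasure (μ A).toNNReal).map (fun n : ℕ => (n : ℝ≥0∞))
  law_top : ∀ A : Set ℝ, MeasurableSet A → μ A = ∞ → ∀ᵐ ω ∂P, pointCount p A ω = ∞
  indep : ∀ (m : ℕ) (A : Fin m → Set ℝ), (∀ i, MeasurableSet (A i)) →
    Pairwise (fun i j => Disjoint (A i) (A j)) → iIndepFun (fun i => pointCount p (A i)) P

/-- The measure `c t ^ (-1 - a) dt` on `(0, ∞)` with `c = a / Γ(1 - a / b)`; for level `k` one takes
`a = α_k` and `b = α_{k+1}`. -/
def levelIntensity (a b : ℝ) : Measure ℝ :=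
  (volume.restrict (Set.Ioi 0)).withDensity
    (fun t => ENNReal.ofReal (a / Real.Gamma (1 - a / b) / t ^ (1 + a)))

/-- The random variables of which the K processes on trees are built:
* `γ v y` is the parameter of the child `y :: v` of the node `v`;
* `σ k x i` is the `i`-th mark of the Poisson process with label `x` that is used at level `k + 1`;
* `T k x i` is the `i`-th exponential variable with label `x` that is used at level `k + 1`. -/
structure KTreeData (Ω : Type*) where
  γ : List ℕ → ℕ → Ω → ℝ
  σ : ℕ → ℕ → ℕ → Ω → ℝ
  T : ℕ → ℕ → ℕ → Ω → ℝ

namespace KTreeData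

variable {Ω : Type*}

/-- The σ-algebras generated by the individual sources of randomness: one Poisson point process of
parameters for each node, the Poisson processes and the exponential variables. -/
@[reducible] def source (D : KTreeData Ω) : List ℕ ⊕ (ℕ × ℕ) ⊕ (ℕ × ℕ × ℕ) → MeasurableSpace Ω
  | .inl v => MeasurableSpace.comap (fun ω y => D.γ v y ω) MeasurableSpace.pi
  | .inr (.inl (k, x)) => MeasurableSpace.comap (fun ω i => D.σ k x i ω) MeasurableSpace.pi
  | .inr (.inr (k, x, i)) => MeasurableSpace.comap (D.T k x i) inferInstance

/-- The joint law of the random variables. -/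
structure IsModel [MeasurableSpace Ω] (D : KTreeData Ω) (α : ℕ → ℝ) (P : Measure Ω) : Prop where
  γ_process : ∀ v : List ℕ,
    IsPoissonPointProcess P (levelIntensity (α v.length) (α (v.length + 1))) (D.γ v)
  γ_order : ∀ v : List ℕ, ∀ᵐ ω ∂P, StrictAnti (fun y => D.γ v y ω) ∧ ∀ y, 0 < D.γ v y ω
  σ_process : ∀ k x, IsPoissonPointProcess P (volume.restrict (Set.Ioi 0)) (D.σ k x)
  σ_order : ∀ k x, ∀ᵐ ω ∂P, StrictMono (fun i => D.σ k x i ω) ∧ ∀ i, 0 < D.σ k x i ω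
  T_measurable : ∀ k x i, Measurable (D.T k x i)
  T_law : ∀ k x i, P.map (D.T k x i) = expMeasure 1
  indep : iIndep D.source P

/-- The product of the parameters along the path from the root to a node. -/
def γbar (D : KTreeData Ω) : List ℕ → Ω → ℝ
  | [], _ => 1
  | y :: v, ω => γbar D v ω * D.γ v y ω

/-- The sum, over the descendants `y` of `x` at depth `n`, of
`(γbar y / γbar x) ^ α_{n+1}`. -/
def cylinderSum (D : KTreeData Ω) (α : ℕ → ℝ) (x : List ℕ) (n : ℕ) (ω : Ω) : ℝ≥0∞ :=
  ∑' y : {y : List ℕ // y.length = n ∧ x <:+ y},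
    ENNReal.ofReal (D.γbar y.1 ω / D.γbar x ω) ^ α n

/-- The random variable `W x`, the limit of `cylinderSum D α x n` as `n → ∞` (written as an upper
limit, in order to be defined everywhere). -/
def W (D : KTreeData Ω) (α : ℕ → ℝ) (x : List ℕ) (ω : Ω) : ℝ≥0∞ :=
  limsup (fun n => D.cylinderSum α x n ω) atTop

/-- Extension of a function `f` of a parent node and a child label to all states, by `0` if the
state has an infinite coordinate. -/
def extendZero (f : List ℕ → ℕ → ℝ≥0∞) (s : List ℕ∞) (x : ℕ) : ℝ≥0∞ :=
  open Classical in if ⊤ ∈ s then 0 else f (s.map ENat.toNat) x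

/-- The clock at time `t` in the realization `ω` that is driven by the marks and exponential
variables of level `k + 1`, by the parameters `f` and by the path `X` of a process on the states of
depth `k`: the sum over all labels `x` and all marks `s = σ k x i` in `[0, t]` of
`f (X s) x * T k x i`. -/
def clockAlong (D : KTreeData Ω) (k : ℕ) (f : List ℕ → ℕ → ℝ≥0∞) (X : ℝ≥0∞ → List ℕ∞) (ω : Ω)
    (t : ℝ≥0∞) : ℝ≥0∞ :=
  open Classical in
  ∑' x : ℕ, ∑' i : ℕ,
    if ENNReal.ofReal (D.σ k x i ω) ≤ t then
      extendZero f (X (ENNReal.ofReal (D.σ k x i ω))) x * ENNReal.ofReal (D.T k x i ω)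
    else 0

/-- The generalized inverse of a clock. -/
def clockInv (Ξ : ℝ≥0∞ → ℝ≥0∞) (t : ℝ≥0∞) : ℝ≥0∞ := sInf {r | t < Ξ r}

/-- The K process `X_k` on the tree with depth `k`.  The last coordinate of `X_{k+1}` at time `t` is
the label `x` for which `t` lies in one of the intervals `[Ξ(σ k x i -), Ξ(σ k x i))`, where `Ξ` is
the clock of level `k + 1`; it is `∞` if there is no such label. -/
def X (D : KTreeData Ω) : ℕ → Ω → ℝ≥0∞ → List ℕ∞
  | 0, _, _ => []
  | k + 1, ω, t =>
    let Ξ := D.clockAlong k (fun v y => ENNReal.ofReal (D.γ v y ω)) (X D k ω) ω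
    (⨅ (x : ℕ) (_ : ∃ i, Function.leftLim Ξ (ENNReal.ofReal (D.σ k x i ω)) ≤ t ∧
        t < Ξ (ENNReal.ofReal (D.σ k x i ω))), (x : ℕ∞)) ::
      X D k ω (clockInv Ξ t)

/-- The clock process of level `k + 1`. -/
def clock (D : KTreeData Ω) (k : ℕ) (ω : Ω) : ℝ≥0∞ → ℝ≥0∞ :=
  D.clockAlong k (fun v y => ENNReal.ofReal (D.γ v y ω)) (D.X k ω) ω

/-- The adjusted clock process of level `k + 1`. -/
def adjustedClock (D : KTreeData Ω) (α : ℕ → ℝ) (k : ℕ) (ω : Ω) : ℝ≥0∞ → ℝ≥0∞ :=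
  D.clockAlong k (fun v y => D.W α (y :: v) ω * ENNReal.ofReal (D.γ v y ω)) (D.X k ω) ω

/-- The composition of `m` consecutive clocks, the first one to be applied being that of level
`k + 1`. -/
def clockComp (D : KTreeData Ω) (k : ℕ) : ℕ → Ω → ℝ≥0∞ → ℝ≥0∞
  | 0, _ => id
  | m + 1, ω => D.clock (k + m) ω ∘ clockComp D k m ω

/-- The adjusted composition of the clocks of the levels `k + 1, …, k + 1 + m`, in which only the
last one is adjusted. -/
def adjustedClockComp (D : KTreeData Ω) (α : ℕ → ℝ) (k m : ℕ) (ω : Ω) : ℝ≥0∞ → ℝ≥0∞ :=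
  D.adjustedClock α (k + m) ω ∘ D.clockComp k m ω

/-- `θ` is the limiting clock that starts at level `k + 1`: a process with almost surely
nondecreasing right-continuous paths, to which the adjusted compositions converge almost surely at
each time of a countable, deterministic and dense set. -/
structure IsLimitClock [MeasurableSpace Ω] (D : KTreeData Ω) (α : ℕ → ℝ) (P : Measure Ω) (k : ℕ)
    (θ : ℝ≥0 → Ω → ℝ≥0) : Prop where
  measurable : ∀ t, Measurable (θ t)
  paths : ∀ᵐ ω ∂P, Monotone (fun t => θ t ω) ∧
    ∀ t, ContinuousWithinAt (fun s => θ s ω) (Set.Ici t) t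
  limit : ∃ S : Set ℝ≥0, S.Countable ∧ Dense S ∧ ∀ t ∈ S, ∀ᵐ ω ∂P,
    Tendsto (fun m => D.adjustedClockComp α k m ω (t : ℝ≥0∞)) atTop (𝓝 (θ t ω : ℝ≥0∞))

end KTreeData

end

/-! Everything is done with Laplace transforms of `[0, ∞]`-valued variables, so convergence,
finiteness and positivity are all read off from integrals of `expNeg`.

The limits W. The constants in the intensities are chosen so that the sum of `(c γ) ^ α (n + 1)`
over the children of a node of depth `n` has Laplace transform `exp (-c ^ α n)`
(`lintegral_one_sub_expNeg_mul_rpow`). Hence the exponentials of the negative sums over descendants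
are bounded martingales along the generations. The sums converge, and the limit at `v` satisfies `E
exp (-c W) = exp (-c ^ α v.length)` (`lintegral_expNeg_limW`), which forces finiteness.

Duality for the clocks. A clock is a pure jump function, and during the interval skipped by a jump
the next process sits in the corresponding child. Sums of weighted jumps are therefore occupation
integrals of the next process. Given all parameters and the earlier levels, the marks are Poisson
and the holding times exponential. So the occupation integral of `U` over the image of a window has
the same conditional Laplace transform as the occupation integral of `killRate U`, which at `v` is
`∑ (1 - (1 + γ U)⁻¹)` over the children, over the window itself (`lintegral_mul_expNeg_occ_succ`).

Existence. The adjusted compositions are occupation integrals of W (`ae_adjustedClockComp_eq`).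
Because `killRate W ≤ ∑ γ W ≤ W`, their negative exponentials form a bounded submartingale and the
increments converge in `[0, ∞]`. The Laplace transform of a limiting increment dominates that of the
occupation integral of W at the starting level, which is finite and small over short windows. This
yields finiteness and right continuity at fixed times, and a right-continuous regularization is a
limiting clock.

Non-triviality. Bounds in the other direction must not depend on the number of levels. By Jensen's
inequality it suffices to treat a process that stays in one node (`lintegral_expNeg_occ_le`). Bounds
of the form `exp (-C * min y (y ^ α))` reproduce themselves under one killing step
(`lintegral_expNeg_killRate_le`). The new constant is at least the smaller of two powers of `C`, up
to a factor `1 - O((1 - α (k + 1)) / (1 - α k)) - O(1 - α k)`; here the summability hypothesis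
enters. If W is multiplied by `exp n`, the logarithms of the constants, divided by `α k`, stay above
`p * n - R` with `p > 0`, for every number of levels (`growth_lower`). Letting `n → ∞` shows that
increments are positive, and letting the window grow shows that the clock diverges. -/

/-! ### The exponential function `x ↦ exp (-x)` on `[0, ∞]` -/

/-- The function `exp (-x)` on `[0, ∞]`. -/
noncomputable def expNeg (x : ℝ≥0∞) : ℝ≥0∞ := EReal.exp (-(x : EReal))

/-- The inverse of `expNeg`. -/
noncomputable def negLog (x : ℝ≥0∞) : ℝ≥0∞ := (-ENNReal.log x).toENNReal

@[simp] lemma expNeg_zero : expNeg 0 = 1 := by simp [expNeg]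

@[simp] lemma expNeg_top : expNeg ∞ = 0 := by simp [expNeg]

lemma expNeg_add (x y : ℝ≥0∞) : expNeg (x + y) = expNeg x * expNeg y := by
  unfold expNeg
  rw [EReal.coe_ennreal_add, EReal.neg_add (.inl (EReal.coe_ennreal_ne_bot _))
    (.inr (EReal.coe_ennreal_ne_bot _)), sub_eq_add_neg, EReal.exp_add]

lemma expNeg_strictAnti : StrictAnti expNeg := fun x y h => by
  unfold expNeg
  rw [EReal.exp_lt_exp_iff, EReal.neg_lt_neg_iff]
  exact_mod_cast h

lemma expNeg_antitone : Antitone expNeg := expNeg_strictAnti.antitone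

lemma continuous_expNeg : Continuous expNeg :=
  ENNReal.continuous_exp.comp (continuous_neg.comp continuous_coe_ennreal_ereal)

lemma measurable_expNeg : Measurable expNeg := continuous_expNeg.measurable

lemma expNeg_le_one (x : ℝ≥0∞) : expNeg x ≤ 1 := expNeg_zero ▸ expNeg_antitone zero_le

lemma expNeg_ne_top (x : ℝ≥0∞) : expNeg x ≠ ∞ :=
  ((expNeg_le_one x).trans_lt ENNReal.one_lt_top).ne

lemma expNeg_ofReal {x : ℝ} (hx : 0 ≤ x) :
    expNeg (ENNReal.ofReal x) = ENNReal.ofReal (Real.exp (-x)) := by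
  rw [expNeg, EReal.coe_ennreal_ofReal, max_eq_left hx, ← EReal.coe_neg, EReal.exp_coe]

lemma expNeg_of_ne_top {x : ℝ≥0∞} (hx : x ≠ ∞) :
    expNeg x = ENNReal.ofReal (Real.exp (-x.toReal)) := by
  rw [← expNeg_ofReal ENNReal.toReal_nonneg, ENNReal.ofReal_toReal hx]

lemma expNeg_eq_zero {x : ℝ≥0∞} : expNeg x = 0 ↔ x = ∞ := by
  rw [← expNeg_top, expNeg_strictAnti.injective.eq_iff]

lemma expNeg_negLog {x : ℝ≥0∞} (hx : x ≤ 1) : expNeg (negLog x) = x := by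
  unfold expNeg negLog
  rw [EReal.coe_toENNReal, neg_neg, ENNReal.exp_log]
  rw [EReal.le_neg, neg_zero]
  simpa using hx

lemma measurable_negLog : Measurable negLog :=
  measurable_ereal_toENNReal.comp (continuous_neg.measurable.comp ENNReal.measurable_log)

lemma expNeg_sum {ι : Type*} (F : Finset ι) (f : ι → ℝ≥0∞) :
    expNeg (∑ i ∈ F, f i) = ∏ i ∈ F, expNeg (f i) := by
  classical
  induction F using Finset.induction_on with
  | empty => simp
  | insert i F hi ih => rw [Finset.sum_insert hi, Finset.prod_insert hi, expNeg_add, ih]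

lemma tendsto_prod_expNeg {ι : Type*} (f : ι → ℝ≥0∞) :
    Tendsto (fun F : Finset ι => ∏ i ∈ F, expNeg (f i)) atTop (𝓝 (expNeg (∑' i, f i))) := by
  simp_rw [← expNeg_sum]
  exact (continuous_expNeg.tendsto _).comp ENNReal.summable.hasSum

lemma one_sub_expNeg_mono : Monotone fun x => 1 - expNeg x :=
  fun _ _ h => tsub_le_tsub_left (expNeg_antitone h) _

/-- The tangent to `exp (-x)` at `x = a` lies below the graph. -/
lemma expNeg_tangent {a x : ℝ≥0∞} (ha : a ≠ ∞) :
    expNeg a * (1 + a) ≤ expNeg x + expNeg a * x := by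
  by_cases hx : x = ∞
  · have : expNeg a ≠ 0 := fun h => ha (expNeg_eq_zero.1 h)
    rw [hx, ENNReal.mul_top this]; simp
  lift a to ℝ≥0 using ha
  lift x to ℝ≥0 using hx
  rw [expNeg_of_ne_top ENNReal.coe_ne_top, expNeg_of_ne_top ENNReal.coe_ne_top]
  rw [← ENNReal.ofReal_coe_nnreal (p := a), ← ENNReal.ofReal_coe_nnreal (p := x),
    ← ENNReal.ofReal_one, ← ENNReal.ofReal_add zero_le_one a.coe_nonneg, ← ENNReal.ofReal_mul (by positivity),
    ← ENNReal.ofReal_mul (by positivity), ← ENNReal.ofReal_add (by positivity) (by positivity)]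
  refine ENNReal.ofReal_le_ofReal ?_
  rw [ENNReal.toReal_ofReal a.coe_nonneg, ENNReal.toReal_ofReal x.coe_nonneg]
  have h1 : Real.exp (-(x : ℝ)) = Real.exp (-(a : ℝ)) * Real.exp (a - x) := by
    rw [← Real.exp_add]; ring_nf
  have h2 := Real.add_one_le_exp ((a : ℝ) - x)
  have h3 := Real.exp_pos (-(a : ℝ))
  rw [h1]; nlinarith

/-- `expNeg` is continuous and strictly decreasing, so it sends the upper and lower limits to the
lower and upper limits of the convergent images; injectivity identifies the two. The value `c = 0`
is allowed and corresponds to the limit `∞`. -/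
lemma tendsto_of_tendsto_expNeg {ι : Type*} {l : Filter ι} [l.NeBot] {u : ι → ℝ≥0∞} {c : ℝ≥0∞}
    (h : Tendsto (fun i => expNeg (u i)) l (𝓝 c)) :
    Tendsto u l (𝓝 (limsup u l)) := by
  have h1 : expNeg (limsup u l) = c := by
    rw [expNeg_antitone.map_limsup_of_continuousAt u continuous_expNeg.continuousAt]
    exact h.liminf_eq
  have h2 : expNeg (liminf u l) = c := by
    rw [expNeg_antitone.map_liminf_of_continuousAt u continuous_expNeg.continuousAt]
    exact h.limsup_eq
  exact tendsto_of_liminf_eq_limsup (expNeg_strictAnti.injective (h2.trans h1.symm)) rfl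

/-! ### Convergence and finiteness through Laplace transforms. -/

section Convergence

variable {Ω : Type*} [m0 : MeasurableSpace Ω] {P : Measure Ω}

lemma tendsto_lintegral_expNeg [IsFiniteMeasure P] {ι : Type*} {l : Filter ι}
    [l.IsCountablyGenerated] {Y : ι → Ω → ℝ≥0∞} {L : Ω → ℝ≥0∞} (hY : ∀ n, Measurable (Y n))
    (h : ∀ᵐ ω ∂P, Tendsto (fun n => Y n ω) l (𝓝 (L ω))) :
    Tendsto (fun n => ∫⁻ ω, expNeg (Y n ω) ∂P) l (𝓝 (∫⁻ ω, expNeg (L ω) ∂P)) := by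
  refine tendsto_lintegral_filter_of_dominated_convergence (fun _ => 1)
    (.of_forall fun n => measurable_expNeg.comp (hY n))
    (.of_forall fun n => .of_forall fun ω => expNeg_le_one _) (by simp) ?_
  filter_upwards [h] with ω hω
  exact (continuous_expNeg.tendsto _).comp hω

/-- If `exp (-Y n)` is a submartingale, then `Y n` converges in `[0, ∞]`. -/
lemma ae_tendsto_of_expNeg_submartingale [IsFiniteMeasure P] (ℱ : Filtration ℕ m0)
    (Y : ℕ → Ω → ℝ≥0∞) (hY : ∀ n, Measurable[ℱ n] (Y n))
    (h : ∀ n s, MeasurableSet[ℱ n] s →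
      ∫⁻ ω in s, expNeg (Y n ω) ∂P ≤ ∫⁻ ω in s, expNeg (Y (n + 1) ω) ∂P) :
    ∀ᵐ ω ∂P, Tendsto (fun n => Y n ω) atTop (𝓝 (limsup (fun n => Y n ω) atTop)) := by
  let f : ℕ → Ω → ℝ := fun n ω => (expNeg (Y n ω)).toReal
  have hm : ∀ n, Measurable[ℱ n] (f n) := fun n =>
    ENNReal.measurable_toReal.comp (measurable_expNeg.comp (hY n))
  have hb : ∀ n ω, ‖f n ω‖ ≤ 1 := fun n ω => by
    rw [Real.norm_of_nonneg ENNReal.toReal_nonneg]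
    exact ENNReal.toReal_mono ENNReal.one_ne_top (expNeg_le_one _)
  have hint : ∀ n, Integrable (f n) P := fun n =>
    Integrable.of_bound ((hm n).mono (ℱ.le n) le_rfl).aestronglyMeasurable 1 (.of_forall (hb n))
  have hset : ∀ n s, ∫ ω in s, f n ω ∂P = (∫⁻ ω in s, expNeg (Y n ω) ∂P).toReal := fun n s =>
    integral_toReal ((measurable_expNeg.comp ((hY n).mono (ℱ.le n) le_rfl)).aemeasurable)
      (.of_forall fun ω => (expNeg_ne_top _).lt_top)
  have hsub : Submartingale f ℱ P := by
    refine submartingale_of_setIntegral_le_succ (fun n => (hm n).stronglyMeasurable) hint ?_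
    intro n s hs
    rw [hset, hset]
    refine ENNReal.toReal_mono ?_ (h n s hs)
    refine ((lintegral_mono (fun ω => expNeg_le_one _)).trans_lt ?_).ne
    simp
  have hR : ∀ n, eLpNorm (f n) 1 P ≤ ((P Set.univ).toNNReal : ℝ≥0∞) := by
    intro n
    refine (eLpNorm_le_of_ae_bound (.of_forall (hb n))).trans ?_
    simp
  filter_upwards [hsub.ae_tendsto_limitProcess hR] with ω hω
  exact tendsto_of_tendsto_expNeg ((ENNReal.tendsto_ofReal hω).congr fun n =>
    ENNReal.ofReal_toReal (expNeg_ne_top _))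

lemma tendsto_inv_natCast_mul {x : ℝ≥0∞} (hx : x ≠ ∞) :
    Tendsto (fun n : ℕ => ((n : ℝ≥0∞) + 1)⁻¹ * x) atTop (𝓝 0) := by
  have h : Tendsto (fun n : ℕ => ((n : ℝ≥0∞) + 1)⁻¹) atTop (𝓝 0) := by
    have := (tendsto_add_atTop_iff_nat 1).2 ENNReal.tendsto_inv_nat_nhds_zero
    simpa using this
  simpa using ENNReal.Tendsto.mul_const h (.inr hx)

/-- A random variable whose Laplace transform is continuous at `0` is finite. -/
lemma ae_lt_top_of_tendsto_lintegral_expNeg [IsProbabilityMeasure P] {L : Ω → ℝ≥0∞}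
    (hL : Measurable L) {c : ℕ → ℝ≥0∞} (hc : ∀ n, c n ≠ 0)
    (h : Tendsto (fun n => ∫⁻ ω, expNeg (c n * L ω) ∂P) atTop (𝓝 1)) :
    ∀ᵐ ω ∂P, L ω < ∞ := by
  -- Since `c n ≠ 0`, the integrand vanishes where `L = ∞`.
  have hle : ∀ n : ℕ, ∫⁻ ω, expNeg (c n * L ω) ∂P ≤ P {ω | L ω < ∞} := by
    intro n
    rw [← lintegral_indicator_one (measurableSet_lt hL measurable_const)]
    refine lintegral_mono fun ω => ?_
    by_cases hω : L ω < ∞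
    · simpa [Set.indicator, hω] using expNeg_le_one _
    · simp only [not_lt, top_le_iff] at hω
      simp [hω, ENNReal.mul_top (hc n)]
  exact (mem_ae_iff_prob_eq_one (measurableSet_lt hL measurable_const)).2
    (le_antisymm prob_le_one (le_of_tendsto' h hle))

lemma inv_natCast_add_one_ne_zero (n : ℕ) : ((n : ℝ≥0∞) + 1)⁻¹ ≠ 0 := by
  simp [ENNReal.inv_eq_zero]

lemma inv_natCast_add_one_ne_top (n : ℕ) : ((n : ℝ≥0∞) + 1)⁻¹ ≠ ∞ := by simp

/-- A random variable whose Laplace transform dominates that of a finite one is finite. -/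
lemma ae_lt_top_of_lintegral_expNeg_le [IsProbabilityMeasure P] {L M : Ω → ℝ≥0∞}
    (hL : Measurable L) (hM : Measurable M) (hfin : ∀ᵐ ω ∂P, M ω < ∞)
    (h : ∀ c : ℝ≥0∞, c ≠ 0 → c ≠ ∞ →
      ∫⁻ ω, expNeg (c * M ω) ∂P ≤ ∫⁻ ω, expNeg (c * L ω) ∂P) :
    ∀ᵐ ω ∂P, L ω < ∞ := by
  refine ae_lt_top_of_tendsto_lintegral_expNeg hL inv_natCast_add_one_ne_zero ?_
  have hT : Tendsto (fun n : ℕ => ∫⁻ ω, expNeg (((n : ℝ≥0∞) + 1)⁻¹ * M ω) ∂P) atTop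
      (𝓝 (∫⁻ _, expNeg 0 ∂P)) := by
    refine tendsto_lintegral_expNeg (fun n => hM.const_mul _) ?_
    filter_upwards [hfin] with ω hω using tendsto_inv_natCast_mul hω.ne
  rw [expNeg_zero, lintegral_one, measure_univ] at hT
  refine tendsto_of_tendsto_of_tendsto_of_le_of_le hT tendsto_const_nhds
    (fun n => h _ (inv_natCast_add_one_ne_zero n) (inv_natCast_add_one_ne_top n)) fun n => ?_
  refine (lintegral_mono fun ω => expNeg_le_one _).trans ?_
  simp

end Convergence

/-! ### Integration over independent σ-algebras. -/

section Independence

variable {Ω ι : Type*} [m0 : MeasurableSpace Ω] {P : Measure Ω} {m : ι → MeasurableSpace Ω}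

lemma lintegral_of_indepFun [IsProbabilityMeasure P] {A B : Type*} [MeasurableSpace A]
    [MeasurableSpace B] {f : Ω → A} {g : Ω → B} (hf : Measurable f) (hg : Measurable g)
    (hind : IndepFun f g P) {F : A × B → ℝ≥0∞} (hF : Measurable F) :
    ∫⁻ ω, F (f ω, g ω) ∂P = ∫⁻ ω, ∫⁻ ω', F (f ω, g ω') ∂P ∂P := by
  have e := lintegral_map (μ := P) hF (hf.prodMk hg)
  rw [(indepFun_iff_map_prod_eq_prod_map_map hf.aemeasurable hg.aemeasurable).1 hind] at e
  have := Measure.isProbabilityMeasure_map (μ := P) hf.aemeasurable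
  have := Measure.isProbabilityMeasure_map (μ := P) hg.aemeasurable
  rw [← e, lintegral_prod _ hF.aemeasurable, lintegral_map hF.lintegral_prod_right' hf]
  refine lintegral_congr fun ω => ?_
  exact lintegral_map (f := fun y => F (f ω, y)) (hF.comp measurable_prodMk_left) hg

/-- Integration of a function of two independent arguments. -/
lemma lintegral_diag_of_indep [IsProbabilityMeasure P] {m₁ m₂ : MeasurableSpace Ω} (h₁ : m₁ ≤ m0)
    (h₂ : m₂ ≤ m0) (hind : Indep m₁ m₂ P) {F : Ω × Ω → ℝ≥0∞}
    (hF : Measurable[@Prod.instMeasurableSpace Ω Ω m₁ m₂] F) :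
    ∫⁻ ω, F (ω, ω) ∂P = ∫⁻ ω, ∫⁻ ω', F (ω, ω') ∂P ∂P := by
  -- The two arguments are the identity map of `Ω`, regarded as random elements of `(Ω, m₁)` and of
  -- `(Ω, m₂)`; their independence is that of the σ-algebras.
  refine @lintegral_of_indepFun Ω m0 P _ Ω Ω m₁ m₂ id id (measurable_id'' h₁) (measurable_id'' h₂)
    ((@IndepFun_iff_Indep Ω Ω Ω m0 m₁ m₂ id id P).2 ?_) F hF
  simpa [MeasurableSpace.comap_id] using hind

lemma lintegral_prod_of_iIndep [IsProbabilityMeasure P] (hle : ∀ i, m i ≤ m0) (hind : iIndep m P)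
    {J : Type*} (S : J → Set ι) (hS : Pairwise fun j j' => Disjoint (S j) (S j'))
    (Y : J → Ω → ℝ≥0∞) (hY : ∀ j, Measurable[⨆ i ∈ S j, m i] (Y j)) (F : Finset J) :
    ∫⁻ ω, ∏ j ∈ F, Y j ω ∂P = ∏ j ∈ F, ∫⁻ ω, Y j ω ∂P := by
  classical
  induction F using Finset.induction_on with
  | empty => simp
  | insert j F hj ih =>
    simp_rw [Finset.prod_insert hj]
    rw [← ih]
    have hd : Disjoint (S j) (⋃ j' ∈ F, S j') := by
      simp only [Set.disjoint_iUnion_right]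
      exact fun j' hj' => hS (fun h => hj (h ▸ hj'))
    refine lintegral_mul_eq_lintegral_mul_lintegral_of_independent_measurableSpace
      (iSup₂_le fun i _ => hle i) (iSup₂_le fun i _ => hle i)
      (indep_iSup_of_disjoint hle hind hd) (hY j) ?_
    refine Finset.measurable_fun_prod F fun j' hj' => (hY j').mono ?_ le_rfl
    exact biSup_mono fun i hi => Set.mem_biUnion (t := S) hj' hi

/-- The Laplace transform of a sum of independent random variables. -/
lemma lintegral_expNeg_tsum [IsProbabilityMeasure P] (hle : ∀ i, m i ≤ m0) (hind : iIndep m P)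
    {J : Type*} [Countable J] (S : J → Set ι) (hS : Pairwise fun j j' => Disjoint (S j) (S j'))
    (Y : J → Ω → ℝ≥0∞) (hY : ∀ j, Measurable[⨆ i ∈ S j, m i] (Y j)) (c : J → ℝ≥0∞)
    (hc : ∀ j, ∫⁻ ω, expNeg (Y j ω) ∂P = expNeg (c j)) :
    ∫⁻ ω, expNeg (∑' j, Y j ω) ∂P = expNeg (∑' j, c j) := by
  have hm : ∀ j, Measurable (Y j) := fun j => (hY j).mono (iSup₂_le fun i _ => hle i) le_rfl
  -- The product formula holds for finite subsums and passes to the limit along finite sets.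
  -- Countability of `J` makes this filter countably generated, as dominated convergence requires.
  have h1 : Tendsto (fun F : Finset J => ∫⁻ ω, expNeg (∑ j ∈ F, Y j ω) ∂P) atTop
      (𝓝 (∫⁻ ω, expNeg (∑' j, Y j ω) ∂P)) :=
    tendsto_lintegral_expNeg (fun F => Finset.measurable_fun_sum F fun j _ => hm j)
      (.of_forall fun ω => ENNReal.summable.hasSum)
  refine tendsto_nhds_unique h1 ?_
  simp_rw [expNeg_sum]
  have h2 : ∀ F : Finset J, ∫⁻ ω, ∏ j ∈ F, expNeg (Y j ω) ∂P = ∏ j ∈ F, expNeg (c j) := fun F => by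
    rw [lintegral_prod_of_iIndep hle hind S hS (fun j ω => expNeg (Y j ω))
      (fun j => measurable_expNeg.comp (hY j)) F]
    exact Finset.prod_congr rfl fun j _ => hc j
  simp_rw [h2]
  exact tendsto_prod_expNeg c

end Independence

/-! ### Laplace functionals -/

lemma tendsto_tsum_of_monotone {ι : Type*} [Countable ι] {f : ℕ → ι → ℝ≥0∞} {g : ι → ℝ≥0∞}
    (hmono : ∀ i, Monotone fun n => f n i) (h : ∀ i, Tendsto (fun n => f n i) atTop (𝓝 (g i))) :
    Tendsto (fun n => ∑' i, f n i) atTop (𝓝 (∑' i, g i)) := by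
  let _ : MeasurableSpace ι := ⊤
  simp_rw [← lintegral_count]
  exact lintegral_tendsto_of_tendsto_of_monotone (fun n => (measurable_from_top).aemeasurable)
    (.of_forall hmono) (.of_forall h)

lemma lintegral_expNeg_poisson (r : ℝ≥0) {c : ℝ≥0∞} (hc : c ≠ ∞) :
    ∫⁻ n : ℕ, expNeg (c * n) ∂(poissonMeasure r) = expNeg ((1 - expNeg c) * r) := by
  lift c to ℝ≥0 using hc
  rw [lintegral_countable']
  have h1 : expNeg (c : ℝ≥0∞) = ENNReal.ofReal (Real.exp (-c)) := by
    rw [expNeg_of_ne_top ENNReal.coe_ne_top, ENNReal.coe_toReal]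
  have h2 : (1 - expNeg (c : ℝ≥0∞)) * r = ENNReal.ofReal ((1 - Real.exp (-c)) * r) := by
    rw [h1, ← ENNReal.ofReal_one, ← ENNReal.ofReal_sub _ (Real.exp_pos _).le,
      ENNReal.ofReal_mul (by simp), ENNReal.ofReal_coe_nnreal]
  have h3 : ∀ n : ℕ, expNeg (c * n) * poissonMeasure r {n} =
      ENNReal.ofReal (Real.exp (-r) * ((Real.exp (-c) * r) ^ n / n.factorial)) := by
    intro n
    have : (c : ℝ≥0∞) * n = ENNReal.ofReal (c * n) := by
      rw [ENNReal.ofReal_mul c.coe_nonneg, ENNReal.ofReal_coe_nnreal, ENNReal.ofReal_natCast]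
    rw [this, expNeg_ofReal (by positivity), poissonMeasure_singleton,
      ← ENNReal.ofReal_mul (Real.exp_pos _).le, mul_pow, ← Real.exp_nat_mul]
    congr 1
    rw [show -((c : ℝ) * n) = n * (-c) by ring]
    ring
  simp_rw [h3]
  have hs := (NormedSpace.expSeries_div_hasSum_exp (Real.exp (-c) * r)).mul_left (Real.exp (-r))
  rw [← Real.exp_eq_exp_ℝ] at hs
  rw [h2, expNeg_ofReal (mul_nonneg (by simp) r.coe_nonneg),
    ← ENNReal.ofReal_tsum_of_nonneg (fun n => by positivity) hs.summable, hs.tsum_eq,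
    ← Real.exp_add]
  congr 2; ring

namespace IsPoissonPointProcess

variable {Ω : Type*} [MeasurableSpace Ω] {P : Measure Ω} {μ : Measure ℝ}
  {p : ℕ → Ω → ℝ}

lemma measurable_pointCount (h : IsPoissonPointProcess P μ p) {A : Set ℝ} (hA : MeasurableSet A) :
    Measurable (pointCount p A) :=
  Measurable.tsum fun i => (measurable_const.indicator hA).comp (h.measurable i)

lemma lintegral_expNeg_pointCount [IsProbabilityMeasure P] (h : IsPoissonPointProcess P μ p) {A : Set ℝ}
    (hA : MeasurableSet A) {c : ℝ≥0∞} (hc : c ≠ ∞) :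
    ∫⁻ ω, expNeg (c * pointCount p A ω) ∂P = expNeg ((1 - expNeg c) * μ A) := by
  by_cases hμ : μ A = ∞
  -- For `c = 0` the convention `0 * ∞ = 0` makes both sides `1`; for `c ≠ 0` infinitely many points
  -- make both sides `0`.
  · rcases eq_or_ne c 0 with rfl | h0
    · simp
    · have h1 : 1 - expNeg c ≠ 0 := by
        rw [Ne, tsub_eq_zero_iff_le, ← expNeg_zero, expNeg_strictAnti.le_iff_ge]
        simpa using h0
      rw [hμ, ENNReal.mul_top h1, expNeg_top]
      refine (lintegral_eq_zero_iff
        (measurable_expNeg.comp ((h.measurable_pointCount hA).const_mul c))).2 ?_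
      filter_upwards [h.law_top A hA hμ] with ω hω
      simp [hω, ENNReal.mul_top h0]
  · have e := lintegral_map (μ := P) (f := fun x => expNeg (c * x))
      (measurable_expNeg.comp (measurable_const.mul measurable_id)) (h.measurable_pointCount hA)
    rw [← e, h.law A hA hμ, lintegral_map (f := fun x => expNeg (c * x))
      (measurable_expNeg.comp (measurable_const.mul measurable_id)) (measurable_from_top),
      lintegral_expNeg_poisson _ hc, ENNReal.coe_toNNReal hμ]

/-- The Laplace functional of a Poisson point process at a simple function. -/
lemma lintegral_expNeg_simpleFunc [IsProbabilityMeasure P] (h : IsPoissonPointProcess P μ p) (f : SimpleFunc ℝ ℝ≥0∞)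
    (hf : ∀ x, f x ≠ ∞) :
    ∫⁻ ω, expNeg (∑' i, f (p i ω)) ∂P = expNeg (∫⁻ s, (1 - expNeg (f s)) ∂μ) := by
  classical
  have h1 : ∀ ω, ∑' i, f (p i ω) = ∑ c ∈ f.range, c * pointCount p (f ⁻¹' {c}) ω := by
    intro ω
    simp only [pointCount, ← ENNReal.tsum_mul_left]
    rw [← Summable.tsum_finsetSum (fun _ _ => ENNReal.summable)]
    refine tsum_congr fun i => ?_
    rw [Finset.sum_eq_single (f (p i ω))]
    · simp
    · intro b _ hb
      simp [Set.indicator, hb.symm]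
    · simp
  have h2 : ∫⁻ s, (1 - expNeg (f s)) ∂μ = ∑ c ∈ f.range, (1 - expNeg c) * μ (f ⁻¹' {c}) := by
    rw [← SimpleFunc.map_lintegral (fun c => 1 - expNeg c) f, ← SimpleFunc.lintegral_eq_lintegral]
    rfl
  simp_rw [h1, h2, expNeg_sum]
  let e := f.range.equivFin
  have hd : Pairwise fun i j => Disjoint (f ⁻¹' {((e.symm i : f.range) : ℝ≥0∞)})
      (f ⁻¹' {((e.symm j : f.range) : ℝ≥0∞)}) := by
    intro i j hij
    refine Disjoint.preimage _ (Set.disjoint_singleton.2 fun hh => hij ?_)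
    exact e.symm.injective (Subtype.ext hh)
  have hi := h.indep _ (fun i => f ⁻¹' {((e.symm i : f.range) : ℝ≥0∞)})
    (fun i => f.measurableSet_fiber _) hd
  have hprod : ∀ g : ℝ≥0∞ → ℝ≥0∞, ∏ c ∈ f.range, g c = ∏ i, g (e.symm i) := fun g => by
    rw [← Finset.prod_coe_sort, ← e.symm.prod_comp]
  have hi2 := hi.comp (fun i x => expNeg ((e.symm i : ℝ≥0∞) * x))
    (fun i => measurable_expNeg.comp (measurable_const.mul measurable_id))
  simp_rw [hprod]
  refine (lintegral_prod_eq_prod_lintegral_of_indepFun Finset.univ _ hi2 ?_).trans ?_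
  · exact fun i => measurable_expNeg.comp
      ((h.measurable_pointCount (f.measurableSet_fiber _)).const_mul _)
  · refine Finset.prod_congr rfl fun i _ => ?_
    refine h.lintegral_expNeg_pointCount (f.measurableSet_fiber _) ?_
    obtain ⟨x, hx⟩ := f.mem_range.1 (e.symm i).2
    rw [← hx]; exact hf x

/-- The Laplace functional of a Poisson point process. -/
lemma lintegral_expNeg [IsProbabilityMeasure P] (h : IsPoissonPointProcess P μ p) {g : ℝ → ℝ≥0∞} (hg : Measurable g) :
    ∫⁻ ω, expNeg (∑' i, g (p i ω)) ∂P = expNeg (∫⁻ s, (1 - expNeg (g s)) ∂μ) := by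
  -- These approximations increase to `g` and have finite values, as the formula for simple
  -- functions requires.
  let f := SimpleFunc.eapprox g
  have hmono : ∀ x, Monotone fun n => f n x := fun x n m hnm => SimpleFunc.monotone_eapprox g hnm x
  have hlim : ∀ x, Tendsto (fun n => f n x) atTop (𝓝 (g x)) := fun x =>
    SimpleFunc.tendsto_eapprox hg x
  have h1 : Tendsto (fun n => ∫⁻ ω, expNeg (∑' i, f n (p i ω)) ∂P) atTop
      (𝓝 (∫⁻ ω, expNeg (∑' i, g (p i ω)) ∂P)) := by
    refine tendsto_lintegral_expNeg
      (fun n => Measurable.tsum fun i => (f n).measurable.comp (h.measurable i))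
      (.of_forall fun ω => tendsto_tsum_of_monotone (fun i => hmono _) (fun i => hlim _))
  refine tendsto_nhds_unique h1 ?_
  simp_rw [fun n => h.lintegral_expNeg_simpleFunc (f n)
    (fun x => (SimpleFunc.eapprox_lt_top g n x).ne)]
  refine (continuous_expNeg.tendsto _).comp ?_
  refine lintegral_tendsto_of_tendsto_of_monotone
    (fun n => (measurable_const.sub (measurable_expNeg.comp (f n).measurable)).aemeasurable)
    (.of_forall fun x n m hnm => one_sub_expNeg_mono (hmono x hnm)) (.of_forall fun x => ?_)
  exact ENNReal.Tendsto.sub tendsto_const_nhds ((continuous_expNeg.tendsto _).comp (hlim x))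
    (.inl ENNReal.one_ne_top)

/-- The Laplace functional is applied to the function that is `∞` at `u` and `0` elsewhere. Its
exponent is `μ {u} = 0`, so the integral is `1`, while the integrand vanishes as soon as a point
hits `u`. -/
lemma ae_ne_of_null [IsProbabilityMeasure P] (h : IsPoissonPointProcess P μ p) {u : ℝ} (hu : μ {u} = 0) (i : ℕ) :
    ∀ᵐ ω ∂P, p i ω ≠ u := by
  have h1 := h.lintegral_expNeg (g := fun s => ({u} : Set ℝ).indicator (fun _ => ∞) s)
    (measurable_const.indicator (measurableSet_singleton u))
  have h2 : ∫⁻ s, (1 - expNeg (({u} : Set ℝ).indicator (fun _ => ∞) s)) ∂μ = 0 := by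
    have : (fun s => 1 - expNeg (({u} : Set ℝ).indicator (fun _ => ∞) s)) =
        ({u} : Set ℝ).indicator fun _ => 1 := by
      ext s; by_cases hs : s = u <;> simp [Set.indicator, hs]
    rw [this, lintegral_indicator (measurableSet_singleton u)]
    simp [hu]
  rw [h2, expNeg_zero] at h1
  have hm : MeasurableSet {ω | p i ω ≠ u} := (h.measurable i) (measurableSet_singleton u).compl
  refine (mem_ae_iff_prob_eq_one hm).2 (le_antisymm prob_le_one ?_)
  rw [← h1, ← lintegral_indicator_one hm]
  refine lintegral_mono fun ω => ?_
  by_cases hω : p i ω = u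
  · have : ∑' j, ({u} : Set ℝ).indicator (fun _ => (∞ : ℝ≥0∞)) (p j ω) = ∞ :=
      ENNReal.tsum_eq_top_of_eq_top ⟨i, by simp [hω]⟩
    rw [this, expNeg_top]
    exact zero_le
  · simpa [Set.indicator, hω] using expNeg_le_one _

end IsPoissonPointProcess

/-- The Laplace transform of a mean one exponential random variable. -/
lemma lintegral_expNeg_of_map_eq_expMeasure {Ω : Type*} [MeasurableSpace Ω] {P : Measure Ω}
    {T : Ω → ℝ} (hT : Measurable T) (hlaw : P.map T = expMeasure 1) (c : ℝ≥0∞) :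
    ∫⁻ ω, expNeg (c * ENNReal.ofReal (T ω)) ∂P = (1 + c)⁻¹ := by
  have hm : Measurable fun t : ℝ => expNeg (c * ENNReal.ofReal t) :=
    measurable_expNeg.comp (measurable_const.mul ENNReal.measurable_ofReal)
  have e := lintegral_map (μ := P) hm hT
  rw [← e, hlaw]
  have h1 : expMeasure 1 = volume.withDensity (exponentialPDF 1) := rfl
  have hpm : Measurable (exponentialPDF 1) := measurable_exponentialPDFReal 1 |>.ennreal_ofReal
  rw [h1, lintegral_withDensity_eq_lintegral_mul _ hpm hm]
  have h2 : ∫⁻ t, (exponentialPDF 1 * fun t => expNeg (c * ENNReal.ofReal t)) t =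
      ∫⁻ t in Set.Ioi 0, (ENNReal.ofReal (Real.exp (-t)) * expNeg (c * ENNReal.ofReal t)) := by
    rw [← lintegral_indicator measurableSet_Ioi]
    refine lintegral_congr_ae ?_
    filter_upwards [(measure_eq_zero_iff_ae_notMem.1 (Real.volume_singleton (a := 0)))] with t ht
    rcases lt_or_ge 0 t with h | h
    · simp [exponentialPDF_eq, Set.indicator, h, h.le]
    · have : t < 0 := lt_of_le_of_ne h ht
      simp [exponentialPDF_eq, Set.indicator, h.not_gt, this.not_ge]
  rw [h2]
  by_cases hc : c = ∞
  · subst hc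
    rw [setLIntegral_congr_fun (g := fun _ => 0) measurableSet_Ioi]
    · simp
    · intro t ht
      have : ENNReal.ofReal t ≠ 0 := by simpa using ht
      simp only [ENNReal.top_mul this, expNeg_top, mul_zero]
  lift c to ℝ≥0 using hc
  have h3 : ∫⁻ t in Set.Ioi (0 : ℝ), (ENNReal.ofReal (Real.exp (-t)) *
      expNeg (c * ENNReal.ofReal t)) =
      ∫⁻ t in Set.Ioi (0 : ℝ), ENNReal.ofReal (Real.exp (-(1 + c) * t)) := by
    refine setLIntegral_congr_fun measurableSet_Ioi fun t ht => ?_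
    have ht' : 0 ≤ t := le_of_lt ht
    rw [← ENNReal.ofReal_coe_nnreal, ← ENNReal.ofReal_mul c.coe_nonneg,
      expNeg_ofReal (by positivity), ← ENNReal.ofReal_mul (Real.exp_pos _).le, ← Real.exp_add]
    congr 2; ring
  have hc1 : (0 : ℝ) < 1 + c := by positivity
  rw [h3, ← ofReal_integral_eq_lintegral_ofReal (integrableOn_exp_mul_Ioi (by linarith) 0)
    (.of_forall fun t => (Real.exp_pos _).le), integral_exp_mul_Ioi (by linarith)]
  rw [show (-Real.exp (-(1 + (c : ℝ)) * 0) / -(1 + c)) = (1 + (c : ℝ))⁻¹ by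
    rw [mul_zero, Real.exp_zero, neg_div_neg_eq, one_div], ENNReal.ofReal_inv_of_pos hc1, ENNReal.ofReal_add zero_le_one c.coe_nonneg]
  simp

/-! ### Lebesgue measure on `[0, ∞]` -/

/-- Lebesgue measure on `[0, ∞]`. -/
noncomputable def leb : Measure ℝ≥0∞ := (volume.restrict (Set.Ioi 0)).map ENNReal.ofReal

lemma lintegral_leb {f : ℝ≥0∞ → ℝ≥0∞} (hf : Measurable f) :
    ∫⁻ u, f u ∂leb = ∫⁻ u in Set.Ioi (0 : ℝ), f (ENNReal.ofReal u) :=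
  lintegral_map hf ENNReal.measurable_ofReal

lemma leb_Ico {a b : ℝ≥0∞} (hb : b ≠ ∞) : leb (Set.Ico a b) = b - a := by
  rw [leb, Measure.map_apply ENNReal.measurable_ofReal measurableSet_Ico,
    Measure.restrict_apply (ENNReal.measurable_ofReal measurableSet_Ico)]
  rcases le_or_gt b a with h | h
  · simp [h, tsub_eq_zero_of_le h]
  lift b to ℝ≥0 using hb
  lift a to ℝ≥0 using h.ne_top
  have h1 : (Set.Ioo (a : ℝ) b) ⊆ ENNReal.ofReal ⁻¹' Set.Ico (a : ℝ≥0∞) b ∩ Set.Ioi 0 := by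
    intro x hx
    have hx0 : 0 < x := a.coe_nonneg.trans_lt hx.1
    refine ⟨⟨?_, ?_⟩, hx0⟩
    · rw [← ENNReal.ofReal_coe_nnreal]; exact ENNReal.ofReal_le_ofReal hx.1.le
    · rw [← ENNReal.ofReal_coe_nnreal]
      exact (ENNReal.ofReal_lt_ofReal_iff (hx0.trans hx.2)).2 hx.2
  have h2 : ENNReal.ofReal ⁻¹' Set.Ico (a : ℝ≥0∞) b ∩ Set.Ioi 0 ⊆ Set.Ico (a : ℝ) b := by
    rintro x ⟨⟨hx1, hx2⟩, hx0⟩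
    have hx0' : 0 < x := hx0
    rw [← ENNReal.ofReal_coe_nnreal] at hx1 hx2
    exact ⟨(ENNReal.ofReal_le_ofReal_iff hx0'.le).1 hx1, (ENNReal.ofReal_lt_ofReal_iff_of_nonneg hx0'.le).1 hx2⟩
  have e : (b : ℝ≥0∞) - a = ENNReal.ofReal (b - a) := by
    rw [ENNReal.ofReal_sub _ a.coe_nonneg, ENNReal.ofReal_coe_nnreal, ENNReal.ofReal_coe_nnreal]
  refine le_antisymm ((measure_mono h2).trans ?_) (le_trans ?_ (measure_mono h1))
  · rw [Real.volume_Ico, e]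
  · rw [Real.volume_Ioo, e]

instance : SFinite leb := by unfold leb; infer_instance

instance : NullSingletonClass leb where
  measure_singleton x := by
    rw [leb, Measure.map_apply ENNReal.measurable_ofReal (measurableSet_singleton _),
      Measure.restrict_apply (ENNReal.measurable_ofReal (measurableSet_singleton _))]
    refine measure_mono_null (t := {x.toReal}) ?_ Real.volume_singleton
    rintro y ⟨hy, hy0⟩
    have hy' : ENNReal.ofReal y = x := hy
    rw [Set.mem_singleton_iff, ← hy', ENNReal.toReal_ofReal (le_of_lt hy0)]

/-! ### Integrals with respect to the intensity measures -/

lemma one_sub_expNeg_ofReal {x : ℝ} (hx : 0 ≤ x) :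
    1 - expNeg (ENNReal.ofReal x) = ENNReal.ofReal (1 - Real.exp (-x)) := by
  rw [expNeg_ofReal hx, ENNReal.ofReal_sub _ (Real.exp_pos _).le, ENNReal.ofReal_one]

lemma lintegral_rpow_Ioc {r : ℝ} (hr : -1 < r) :
    ∫⁻ s in Set.Ioc (0 : ℝ) 1, ENNReal.ofReal (s ^ r) = ENNReal.ofReal (1 / (r + 1)) := by
  have hi : IntegrableOn (fun s : ℝ => s ^ r) (Set.Ioc 0 1) := by
    have := intervalIntegral.intervalIntegrable_rpow' (a := 0) (b := 1) hr
    rwa [intervalIntegrable_iff_integrableOn_Ioc_of_le zero_le_one] at this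
  rw [← ofReal_integral_eq_lintegral_ofReal hi
    ((ae_restrict_iff' measurableSet_Ioc).2 (.of_forall fun s hs => Real.rpow_nonneg hs.1.le _)),
    ← intervalIntegral.integral_of_le zero_le_one, integral_rpow (.inl hr)]
  rw [Real.one_rpow, Real.zero_rpow (by linarith), sub_zero]

lemma lintegral_rpow_Ioi {r t : ℝ} (hr : r < -1) (ht : 0 < t) :
    ∫⁻ s in Set.Ioi t, ENNReal.ofReal (s ^ r) = ENNReal.ofReal (-t ^ (r + 1) / (r + 1)) := by
  rw [← ofReal_integral_eq_lintegral_ofReal (integrableOn_Ioi_rpow_of_lt hr ht)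
    ((ae_restrict_iff' measurableSet_Ioi).2
      (.of_forall fun s hs => Real.rpow_nonneg (ht.trans hs).le _)), integral_Ioi_rpow_of_lt hr ht]

/-- The normalizing constant of the intensity measure. -/
noncomputable def levelConst (a b : ℝ) : ℝ := a / Real.Gamma (1 - a / b)

lemma levelConst_pos {a b : ℝ} (ha : 0 < a) (hab : a < b) : 0 < levelConst a b := by
  have : a / b < 1 := (div_lt_one (ha.trans hab)).2 hab
  exact div_pos ha (Real.Gamma_pos_of_pos (by linarith))

lemma lintegral_levelIntensity {a b : ℝ} (ha : 0 < a) (hab : a < b) (f : ℝ → ℝ≥0∞) :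
    ∫⁻ s, f s ∂(levelIntensity a b) =
      ENNReal.ofReal (levelConst a b) *
        ∫⁻ s in Set.Ioi (0 : ℝ), ENNReal.ofReal (s ^ (-1 - a)) * f s := by
  have hm : Measurable fun t : ℝ => ENNReal.ofReal (a / Real.Gamma (1 - a / b) / t ^ (1 + a)) := by
    fun_prop
  rw [levelIntensity, lintegral_withDensity_eq_lintegral_mul_non_measurable _ hm
    (.of_forall fun t => ENNReal.ofReal_lt_top), ← lintegral_const_mul' _ _ ENNReal.ofReal_ne_top]
  refine setLIntegral_congr_fun measurableSet_Ioi fun t ht => ?_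
  have ht' : (0 : ℝ) < t := ht
  simp only [Pi.mul_apply]
  rw [← mul_assoc, ← ENNReal.ofReal_mul (levelConst_pos ha hab).le, ← levelConst,
    show (-1 - a : ℝ) = -(1 + a) by ring, Real.rpow_neg ht'.le, div_eq_mul_inv]

lemma lintegral_levelIntensity_mono {a b : ℝ} {f g : ℝ → ℝ≥0∞}
    (h : ∀ s, 0 < s → f s ≤ g s) :
    ∫⁻ s, f s ∂(levelIntensity a b) ≤ ∫⁻ s, g s ∂(levelIntensity a b) := by
  refine lintegral_mono_ae ?_
  refine (withDensity_absolutelyContinuous _ _).ae_le ?_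
  exact (ae_restrict_iff' measurableSet_Ioi).2 (.of_forall fun s hs => h s hs)

/-- Under `u = κ s` the density contributes `κ ^ (1 + a)` and Lebesgue measure `κ⁻¹`. This scaling
is what turns the exponents below into powers. -/
lemma lintegral_levelIntensity_mul {a b κ : ℝ} (ha : 0 < a) (hab : a < b) (hκ : 0 < κ)
    {f : ℝ → ℝ≥0∞} (hf : Measurable f) :
    ∫⁻ s, f (κ * s) ∂(levelIntensity a b) =
      ENNReal.ofReal (κ ^ a) * ∫⁻ s, f s ∂(levelIntensity a b) := by
  rw [lintegral_levelIntensity ha hab, lintegral_levelIntensity ha hab]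
  let g : ℝ → ℝ≥0∞ := (Set.Ioi (0 : ℝ)).indicator fun u => ENNReal.ofReal (u ^ (-1 - a)) * f u
  have hg : Measurable g := Measurable.indicator (by fun_prop) measurableSet_Ioi
  have e := lintegral_map (μ := volume) hg (measurable_const_mul κ)
  rw [Real.map_volume_mul_left hκ.ne', lintegral_smul_measure, abs_of_pos (inv_pos.2 hκ)] at e
  have h1 : ∫⁻ s in Set.Ioi (0 : ℝ), ENNReal.ofReal (s ^ (-1 - a)) * f (κ * s) =
      ENNReal.ofReal (κ ^ (1 + a)) * ∫⁻ s, g (κ * s) := by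
    rw [← lintegral_const_mul' _ _ ENNReal.ofReal_ne_top, ← lintegral_indicator measurableSet_Ioi]
    refine lintegral_congr fun s => ?_
    by_cases hs : 0 < s
    · have : 0 < κ * s := mul_pos hκ hs
      simp only [g, Set.indicator, Set.mem_Ioi, hs, this, if_true]
      rw [← mul_assoc, ← ENNReal.ofReal_mul (by positivity)]
      congr 2
      rw [Real.mul_rpow hκ.le hs.le, ← mul_assoc, ← Real.rpow_add hκ]
      ring_nf; simp
    · have : ¬ 0 < κ * s := fun h => hs (pos_of_mul_pos_right h hκ.le)
      simp [g, Set.indicator, hs, this]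
  rw [h1, ← e, ← lintegral_indicator measurableSet_Ioi]
  simp only [smul_eq_mul]
  rw [← mul_assoc (ENNReal.ofReal (κ ^ (1 + a))), ← ENNReal.ofReal_mul (by positivity)]
  have : κ ^ (1 + a) * κ⁻¹ = κ ^ a := by
    rw [Real.rpow_add hκ, Real.rpow_one]; field_simp
  rw [this]; ring

lemma levelIntensity_Ioi {a b t : ℝ} (ha : 0 < a) (hab : a < b) (ht : 0 < t) :
    levelIntensity a b (Set.Ioi t) = ENNReal.ofReal (levelConst a b / a * t ^ (-a)) := by
  rw [← lintegral_indicator_one measurableSet_Ioi, lintegral_levelIntensity ha hab]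
  have : ∫⁻ s in Set.Ioi (0 : ℝ), ENNReal.ofReal (s ^ (-1 - a)) * (Set.Ioi t).indicator 1 s =
      ∫⁻ s in Set.Ioi t, ENNReal.ofReal (s ^ (-1 - a)) := by
    rw [← lintegral_indicator measurableSet_Ioi, ← lintegral_indicator measurableSet_Ioi]
    refine lintegral_congr fun s => ?_
    by_cases hs : t < s
    · simp [Set.indicator, hs, ht.trans hs]
    · simp [Set.indicator, hs]
  rw [this, lintegral_rpow_Ioi (by linarith) ht, ← ENNReal.ofReal_mul (levelConst_pos ha hab).le]
  congr 1
  rw [show (-1 - a + 1 : ℝ) = -a by ring]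
  field_simp

lemma one_sub_expNeg_eq_lintegral {x : ℝ} (hx : 0 ≤ x) :
    1 - expNeg (ENNReal.ofReal x) =
      ∫⁻ r in Set.Ioi (0 : ℝ), (Set.Iio x).indicator (fun r => ENNReal.ofReal (Real.exp (-r))) r := by
  rw [one_sub_expNeg_ofReal hx, setLIntegral_indicator measurableSet_Iio, Set.inter_comm,
    Set.Ioi_inter_Iio, setLIntegral_congr Ioo_ae_eq_Ioc]
  rw [← ofReal_integral_eq_lintegral_ofReal _ (.of_forall fun r => (Real.exp_pos _).le),
    ← intervalIntegral.integral_of_le hx]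
  · congr 1
    have := intervalIntegral.integral_comp_neg (a := 0) (b := x) (fun r => Real.exp r)
    rw [this, integral_exp]; simp
  · exact (Continuous.integrableOn_Icc (by fun_prop)).mono_set Set.Ioc_subset_Icc_self

/-- The intensity is normalized so that `∑ γ ^ b` is a standard stable random variable. -/
lemma lintegral_one_sub_expNeg_rpow {a b : ℝ} (ha : 0 < a) (hab : a < b) :
    ∫⁻ s, (1 - expNeg (ENNReal.ofReal s ^ b)) ∂(levelIntensity a b) = 1 := by
  have hb : 0 < b := ha.trans hab
  have hsf : SFinite (levelIntensity a b) := by unfold levelIntensity; infer_instance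
  -- Layer-cake formula: `1 - exp (-x)` is the integral of `exp (-r)` over `0 < r < x`. After
  -- Tonelli, the tail of the intensity beyond `r ^ (1 / b)` produces the integrand of `Γ(1 - a /
  -- b)`, which the normalization cancels.
  let k : ℝ → ℝ → ℝ≥0∞ := fun s r => (Set.Iio (s ^ b)).indicator
    (fun r => ENNReal.ofReal (Real.exp (-r))) r
  have hk : Measurable (Function.uncurry k) := by
    have : Function.uncurry k = {q : ℝ × ℝ | q.2 < q.1 ^ b}.indicator
        fun q => ENNReal.ofReal (Real.exp (-q.2)) := by
      ext q; simp [k, Set.indicator, Function.uncurry]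
    rw [this]
    exact Measurable.indicator (by fun_prop) (measurableSet_lt (by fun_prop) (by fun_prop))
  have hpos : ∀ᵐ s ∂(levelIntensity a b), 0 < s := by
    refine (withDensity_absolutelyContinuous _ _).ae_le ?_
    exact (ae_restrict_iff' measurableSet_Ioi).2 (.of_forall fun s hs => hs)
  have h1 : ∫⁻ s, (1 - expNeg (ENNReal.ofReal s ^ b)) ∂(levelIntensity a b) =
      ∫⁻ s, (∫⁻ r in Set.Ioi (0 : ℝ), k s r) ∂(levelIntensity a b) := by
    refine lintegral_congr_ae ?_
    filter_upwards [hpos] with s hs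
    rw [ENNReal.ofReal_rpow_of_pos hs, one_sub_expNeg_eq_lintegral (by positivity)]
  rw [h1, lintegral_lintegral_swap hk.aemeasurable]
  have h2 : ∀ r ∈ Set.Ioi (0 : ℝ), ∫⁻ s, k s r ∂(levelIntensity a b) =
      ENNReal.ofReal (levelConst a b / a * (Real.exp (-r) * r ^ ((1 - a / b) - 1))) := by
    intro r hr
    have hr : 0 < r := hr
    have : ∀ᵐ s ∂(levelIntensity a b), k s r =
        (Set.Ioi (r ^ (1 / b))).indicator (fun _ => ENNReal.ofReal (Real.exp (-r))) s := by
      filter_upwards [hpos] with s hs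
      have : r < s ^ b ↔ r ^ (1 / b) < s := by
        rw [one_div, Real.rpow_inv_lt_iff_of_pos hr.le hs.le hb]
      simp [k, Set.indicator, this]
    rw [lintegral_congr_ae this, lintegral_indicator_const measurableSet_Ioi,
      levelIntensity_Ioi ha hab (by positivity), ← ENNReal.ofReal_mul (Real.exp_pos _).le,
      ← Real.rpow_mul hr.le]
    congr 1
    rw [show 1 / b * -a = 1 - a / b - 1 by field_simp; ring]
    ring
  rw [setLIntegral_congr_fun measurableSet_Ioi h2]
  have hab' : a / b < 1 := (div_lt_one hb).2 hab
  have hc := levelConst_pos ha hab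
  rw [← ofReal_integral_eq_lintegral_ofReal
    ((Real.GammaIntegral_convergent (by linarith)).const_mul _)
    ((ae_restrict_iff' measurableSet_Ioi).2 (.of_forall fun r hr => by
      have : (0 : ℝ) < r := hr
      positivity)), integral_const_mul, ← Real.Gamma_eq_integral (by linarith)]
  have hG := Real.Gamma_pos_of_pos (show 0 < 1 - a / b by linarith)
  rw [levelConst]
  generalize Real.Gamma (1 - a / b) = G at hG
  rw [show a / G / a * G = 1 by field_simp, ENNReal.ofReal_one]

/-- Used with `b = α (n + 1)` for sums over children, and with `b = 1` to write `c ^ a` as a mixture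
of the functions `1 - exp (-c s)`. -/
lemma lintegral_one_sub_expNeg_mul_rpow {a b : ℝ} (ha : 0 < a) (hab : a < b) {c : ℝ≥0∞}
    (hc : c ≠ ∞) :
    ∫⁻ s, (1 - expNeg ((c * ENNReal.ofReal s) ^ b)) ∂(levelIntensity a b) = c ^ a := by
  rcases eq_or_ne c 0 with rfl | h0
  · simp [ENNReal.zero_rpow_of_pos ha, ENNReal.zero_rpow_of_pos (ha.trans hab)]
  have hk : 0 < c.toReal := ENNReal.toReal_pos h0 hc
  have h1 : ∀ s : ℝ, c * ENNReal.ofReal s = ENNReal.ofReal (c.toReal * s) := fun s => by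
    rw [ENNReal.ofReal_mul hk.le, ENNReal.ofReal_toReal hc]
  simp_rw [h1]
  rw [lintegral_levelIntensity_mul ha hab hk (f := fun s => 1 - expNeg (ENNReal.ofReal s ^ b)),
    lintegral_one_sub_expNeg_rpow ha hab, mul_one, ← ENNReal.ofReal_rpow_of_pos hk,
    ENNReal.ofReal_toReal hc]
  exact measurable_const.sub (measurable_expNeg.comp (by fun_prop))

/-- On `(0, 1]` one has `1 - exp (-s ^ b) ≥ s ^ b / 2`, so the normalization integral, whose value
is `1`, is at least `levelConst a b / (2 * (b - a))`. The factor `b - a` cancels a pole in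
`branchExponent_one_ge`. -/
lemma levelConst_le {a b : ℝ} (ha : 0 < a) (hab : a < b) : levelConst a b ≤ 2 * (b - a) := by
  have hc := levelConst_pos ha hab
  have h1 := lintegral_one_sub_expNeg_rpow ha hab
  rw [lintegral_levelIntensity ha hab] at h1
  have h2 : ∫⁻ s in Set.Ioc (0 : ℝ) 1, ENNReal.ofReal (1 / 2) * ENNReal.ofReal (s ^ (b - a - 1)) ≤
      ∫⁻ s in Set.Ioi (0 : ℝ), ENNReal.ofReal (s ^ (-1 - a)) *
        (1 - expNeg (ENNReal.ofReal s ^ b)) := by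
    refine (setLIntegral_mono' measurableSet_Ioc fun s hs => ?_).trans
      (lintegral_mono_set Set.Ioc_subset_Ioi_self)
    have hs0 : 0 < s := hs.1
    rw [ENNReal.ofReal_rpow_of_pos hs0, one_sub_expNeg_ofReal (by positivity),
      ← ENNReal.ofReal_mul (by positivity), ← ENNReal.ofReal_mul (by positivity)]
    refine ENNReal.ofReal_le_ofReal ?_
    have e : s ^ (b - a - 1) = s ^ (-1 - a) * s ^ b := by
      rw [← Real.rpow_add hs0]; ring_nf
    have hx0 : 0 ≤ s ^ b := by positivity
    have hx1 : s ^ b ≤ 1 := Real.rpow_le_one hs0.le hs.2 (ha.trans hab).le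
    have hx : 1 / 2 * s ^ b ≤ 1 - Real.exp (-s ^ b) := by
      have h3 : Real.exp (-s ^ b) ≤ 1 / (1 + s ^ b) := by
        rw [Real.exp_neg, one_div]
        exact inv_anti₀ (by positivity) (by linarith [Real.add_one_le_exp (s ^ b)])
      have h4 : 1 / (1 + s ^ b) ≤ 1 - 1 / 2 * s ^ b := by
        rw [div_le_iff₀ (by positivity)]; nlinarith
      linarith
    rw [e]
    have := mul_le_mul_of_nonneg_left hx (show 0 ≤ s ^ (-1 - a) by positivity)
    linarith
  rw [lintegral_const_mul' _ _ ENNReal.ofReal_ne_top, lintegral_rpow_Ioc (by linarith),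
    ← ENNReal.ofReal_mul (by norm_num)] at h2
  have h3 := mul_le_mul_right h2 (ENNReal.ofReal (levelConst a b))
  rw [h1, ← ENNReal.ofReal_mul hc.le, ← ENNReal.ofReal_one, ENNReal.ofReal_le_ofReal_iff zero_le_one]
    at h3
  have hba : 0 < b - a := by linarith
  rw [show b - a - 1 + 1 = b - a by ring] at h3
  have : levelConst a b * (1 / 2 * (1 / (b - a))) = levelConst a b / (2 * (b - a)) := by
    field_simp
  rw [this, div_le_one (by positivity)] at h3
  exact h3

/-! ### Exponents of one killing step and their lower bounds. -/

/-- The function `s ↦ min s (s ^ b)`. -/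
noncomputable def minRpow (b : ℝ) (s : ℝ≥0∞) : ℝ≥0∞ := min s (s ^ b)

lemma measurable_minRpow (b : ℝ) : Measurable (minRpow b) :=
  measurable_id.min (measurable_id.pow_const b)

/-- The Lévy exponent of `∑ γ U` for `U` with Lévy exponent `C * min s (s ^ b)`. -/
noncomputable def branchExponent (a b : ℝ) (C : ℝ≥0∞) : ℝ≥0∞ :=
  ∫⁻ s, (1 - expNeg (C * minRpow b (ENNReal.ofReal s))) ∂(levelIntensity a b)

/-- The Lévy exponent of the `a`-stable subordinator at an exponential compound Poisson time. -/
noncomputable def visitExponent (a : ℝ) (τ : ℝ≥0∞) : ℝ≥0∞ :=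
  ∫⁻ s, (1 - expNeg (τ * (1 - (1 + ENNReal.ofReal s)⁻¹))) ∂(levelIntensity a 1)

lemma measurable_branchIntegrand (b : ℝ) (C : ℝ≥0∞) :
    Measurable fun s : ℝ => 1 - expNeg (C * minRpow b (ENNReal.ofReal s)) :=
  measurable_const.sub (measurable_expNeg.comp
    (((measurable_minRpow b).comp ENNReal.measurable_ofReal).const_mul C))

/-- The scale `κ = C` for `C ≥ 1`, and `κ = C ^ (1 / b)` for `C ≤ 1`, satisfies `minRpow b (κ * s) ≤
C * minRpow b s`. Hence the exponent at `C` is at least `κ ^ a` times the exponent at `1`. -/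
lemma branchExponent_lower {a b : ℝ} (ha : 0 < a) (hab : a < b) (hb1 : b ≤ 1) {C : ℝ≥0∞}
    (hC : C ≠ ∞) :
    branchExponent a b 1 * min (C ^ a) (C ^ (a / b)) ≤ branchExponent a b C := by
  have hb : 0 < b := ha.trans hab
  rcases eq_or_ne C 0 with rfl | h0
  · simp [ENNReal.zero_rpow_of_pos ha]
  have key : ∀ κ : ℝ, 0 < κ →
      (∀ s : ℝ≥0∞, minRpow b (ENNReal.ofReal κ * s) ≤ C * minRpow b s) →
      ENNReal.ofReal (κ ^ a) * branchExponent a b 1 ≤ branchExponent a b C := by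
    intro κ hκ h
    unfold branchExponent
    rw [← lintegral_levelIntensity_mul ha hab hκ (measurable_branchIntegrand b 1)]
    refine lintegral_mono fun s => one_sub_expNeg_mono ?_
    rw [one_mul, ENNReal.ofReal_mul hκ.le]
    exact h _
  rcases le_total 1 C with h1 | h1
  · have hk : 0 < C.toReal := ENNReal.toReal_pos h0 hC
    have := key C.toReal hk fun s => ?_
    · rw [← ENNReal.ofReal_rpow_of_pos hk, ENNReal.ofReal_toReal hC] at this
      rw [mul_comm]
      exact (mul_le_mul_left (min_le_left _ _) _).trans this
    · rw [ENNReal.ofReal_toReal hC, minRpow, minRpow]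
      rcases le_total s (s ^ b) with h | h
      · rw [min_eq_left h]; exact min_le_left _ _
      · rw [min_eq_right h, ENNReal.mul_rpow_of_nonneg _ _ hb.le]
        refine (min_le_right _ _).trans (mul_le_mul_left ?_ _)
        nth_rw 2 [← ENNReal.rpow_one C]
        exact ENNReal.rpow_le_rpow_of_exponent_le h1 hb1
  · have hk : 0 < (C ^ (1 / b)).toReal :=
      ENNReal.toReal_pos (by simp [h0, hC]) (ENNReal.rpow_ne_top_of_nonneg (by positivity) hC)
    have hk' : ENNReal.ofReal (C ^ (1 / b)).toReal = C ^ (1 / b) :=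
      ENNReal.ofReal_toReal (ENNReal.rpow_ne_top_of_nonneg (by positivity) hC)
    have := key _ hk fun s => ?_
    · rw [← ENNReal.ofReal_rpow_of_pos hk, hk', ← ENNReal.rpow_mul,
        show 1 / b * a = a / b by ring] at this
      rw [mul_comm]
      exact (mul_le_mul_left (min_le_right _ _) _).trans this
    · rw [hk', minRpow, minRpow]
      rcases le_total s (s ^ b) with h | h
      · rw [min_eq_left h]
        refine (min_le_left _ _).trans (mul_le_mul_left ?_ _)
        nth_rw 2 [← ENNReal.rpow_one C]
        exact ENNReal.rpow_le_rpow_of_exponent_ge h1 ((le_div_iff₀ hb).2 (by linarith))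
      · rw [min_eq_right h, ENNReal.mul_rpow_of_nonneg _ _ hb.le, ← ENNReal.rpow_mul,
          one_div_mul_cancel hb.ne', ENNReal.rpow_one]
        exact min_le_right _ _

/-- Concavity of `1 - exp (-x)`, which vanishes at `0`. -/
lemma mul_one_sub_expNeg_le {τ x : ℝ≥0∞} (hτ : τ ≤ 1) :
    τ * (1 - expNeg x) ≤ 1 - expNeg (τ * x) := by
  rcases eq_or_ne τ 0 with rfl | h0
  · simp
  have hτ' : τ ≠ ∞ := (hτ.trans_lt ENNReal.one_lt_top).ne
  by_cases hx : x = ∞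
  · simp [hx, ENNReal.mul_top h0, hτ]
  lift τ to ℝ≥0 using hτ'
  lift x to ℝ≥0 using hx
  have hτ1 : (τ : ℝ) ≤ 1 := by exact_mod_cast hτ
  rw [← ENNReal.ofReal_coe_nnreal (p := τ), ← ENNReal.ofReal_coe_nnreal (p := x),
    ← ENNReal.ofReal_mul τ.coe_nonneg, one_sub_expNeg_ofReal x.coe_nonneg,
    one_sub_expNeg_ofReal (by positivity), ← ENNReal.ofReal_mul τ.coe_nonneg]
  refine ENNReal.ofReal_le_ofReal ?_
  have := convexOn_exp.2 (Set.mem_univ (-(x : ℝ))) (Set.mem_univ (0 : ℝ)) τ.coe_nonneg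
    (sub_nonneg.2 hτ1) (by ring)
  simp only [smul_eq_mul, mul_zero, add_zero, Real.exp_zero, mul_one] at this
  rw [show (τ : ℝ) * -x = -(τ * x) by ring] at this
  linarith

lemma measurable_visitIntegrand (τ : ℝ≥0∞) :
    Measurable fun s : ℝ => 1 - expNeg (τ * (1 - (1 + ENNReal.ofReal s)⁻¹)) :=
  measurable_const.sub (measurable_expNeg.comp (by fun_prop))

lemma one_sub_inv_eq_ofReal {s : ℝ} (hs : 0 ≤ s) :
    1 - (1 + ENNReal.ofReal s)⁻¹ = ENNReal.ofReal (s / (1 + s)) := by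
  rw [← ENNReal.ofReal_one, ← ENNReal.ofReal_add zero_le_one hs,
    ← ENNReal.ofReal_inv_of_pos (by positivity), ← ENNReal.ofReal_sub _ (by positivity)]
  congr 1; field_simp; ring

/-- For `τ ≤ 1` concavity is enough; for `τ ≥ 1` the inequality `τ * (s / (1 + s)) ≥ τ * s / (1 + τ
* s)` reduces the claim to scaling by `τ`. The lower bound is a multiple of `minRpow a`, so the form
of the bounds assumed for the children recurs for their parent. -/
lemma visitExponent_lower {a : ℝ} (ha : 0 < a) (ha1 : a < 1) {τ : ℝ≥0∞} (hτ : τ ≠ ∞) :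
    visitExponent a 1 * minRpow a τ ≤ visitExponent a τ := by
  rcases le_total τ 1 with h1 | h1
  · calc visitExponent a 1 * minRpow a τ ≤ τ * visitExponent a 1 := by
          rw [mul_comm]; exact mul_le_mul_left (min_le_left _ _) _
      _ ≤ visitExponent a τ := by
          unfold visitExponent
          rw [← lintegral_const_mul' _ _ hτ]
          refine lintegral_mono fun s => ?_
          rw [one_mul]
          exact mul_one_sub_expNeg_le h1
  · have hk1 : 1 ≤ τ.toReal := by
      rw [← ENNReal.toReal_one]; exact ENNReal.toReal_mono hτ h1
    have hk : 0 < τ.toReal := by linarith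
    calc visitExponent a 1 * minRpow a τ ≤ τ ^ a * visitExponent a 1 := by
          rw [mul_comm]; exact mul_le_mul_left (min_le_right _ _) _
      _ ≤ visitExponent a τ := by
          unfold visitExponent
          have := lintegral_levelIntensity_mul ha ha1 hk (measurable_visitIntegrand 1)
          rw [← ENNReal.ofReal_rpow_of_pos hk, ENNReal.ofReal_toReal hτ] at this
          rw [← this]
          refine lintegral_levelIntensity_mono fun s hs => one_sub_expNeg_mono ?_
          rw [one_mul, one_sub_inv_eq_ofReal hs.le, one_sub_inv_eq_ofReal (by positivity)]
          have e : τ * ENNReal.ofReal (s / (1 + s)) = ENNReal.ofReal (τ.toReal * (s / (1 + s))) := by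
            rw [ENNReal.ofReal_mul hk.le, ENNReal.ofReal_toReal hτ]
          rw [e]
          refine ENNReal.ofReal_le_ofReal ?_
          rw [mul_div_assoc]
          refine mul_le_mul_of_nonneg_left ?_ hk.le
          exact div_le_div_of_nonneg_left hs.le (by positivity) (by nlinarith)

lemma lintegral_levelIntensity_pos {a b : ℝ} (ha : 0 < a) (hab : a < b) {f : ℝ → ℝ≥0∞}
    (hf : Measurable f) (hpos : ∀ s, 0 < s → f s ≠ 0) :
    0 < ∫⁻ s, f s ∂(levelIntensity a b) := by
  rw [pos_iff_ne_zero, Ne, lintegral_eq_zero_iff hf]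
  intro h
  have h1 : levelIntensity a b (Set.Ioi 1) = 0 := by
    refine measure_mono_null (fun s hs => ?_) h
    exact hpos s (zero_lt_one.trans hs)
  rw [levelIntensity_Ioi ha hab one_pos, ENNReal.ofReal_eq_zero] at h1
  have := levelConst_pos ha hab
  have h2 : 0 < levelConst a b / a * 1 ^ (-a) := by positivity
  linarith

lemma one_sub_expNeg_ne_zero {x : ℝ≥0∞} (hx : x ≠ 0) : 1 - expNeg x ≠ 0 := by
  rw [Ne, tsub_eq_zero_iff_le, ← expNeg_zero, expNeg_strictAnti.le_iff_ge]
  simpa using hx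

lemma branchExponent_one_pos {a b : ℝ} (ha : 0 < a) (hab : a < b) : 0 < branchExponent a b 1 := by
  refine lintegral_levelIntensity_pos ha hab (measurable_branchIntegrand b 1) fun s hs => ?_
  refine one_sub_expNeg_ne_zero ?_
  have h1 : ENNReal.ofReal s ≠ 0 := by simpa using hs
  have h2 : ENNReal.ofReal s ^ b ≠ 0 := by
    rw [ENNReal.ofReal_rpow_of_pos hs]; simp; positivity
  rw [one_mul, minRpow]
  rcases min_choice (ENNReal.ofReal s) (ENNReal.ofReal s ^ b) with h | h <;> rw [h] <;> assumption

lemma visitExponent_one_pos {a : ℝ} (ha : 0 < a) (ha1 : a < 1) : 0 < visitExponent a 1 := by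
  refine lintegral_levelIntensity_pos ha ha1 (measurable_visitIntegrand 1) fun s hs => ?_
  refine one_sub_expNeg_ne_zero ?_
  rw [one_mul, one_sub_inv_eq_ofReal hs.le]
  simp; positivity

/-- Replacing `s ^ b` by `min s (s ^ b)` changes the integrand only on `(0, 1]`, by at most `s ^ b -
s`. The integral of this loss is `levelConst a b * (1 - b) / ((b - a) * (1 - a))`, and
`levelConst_le` leaves the ratio whose summability is assumed. -/
lemma branchExponent_one_ge {a b : ℝ} (ha : 0 < a) (hab : a < b) (hb1 : b < 1) :
    1 ≤ branchExponent a b 1 + ENNReal.ofReal (2 * ((1 - b) / (1 - a))) := by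
  have hc := levelConst_pos ha hab
  have hb : 0 < b := ha.trans hab
  let g : ℝ → ℝ≥0∞ := (Set.Ioc (0 : ℝ) 1).indicator fun s => ENNReal.ofReal (s ^ b - s)
  have hg : Measurable g := Measurable.indicator (by fun_prop) measurableSet_Ioc
  calc (1 : ℝ≥0∞) = ∫⁻ s, (1 - expNeg (ENNReal.ofReal s ^ b)) ∂(levelIntensity a b) :=
        (lintegral_one_sub_expNeg_rpow ha hab).symm
    _ ≤ ∫⁻ s, ((1 - expNeg (1 * minRpow b (ENNReal.ofReal s))) + g s) ∂(levelIntensity a b) := by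
        refine lintegral_levelIntensity_mono fun s hs => ?_
        rw [one_mul, minRpow, ENNReal.ofReal_rpow_of_pos hs]
        rcases le_or_gt s 1 with h | h
        · have hsb : s ≤ s ^ b := by
            nth_rw 1 [← Real.rpow_one s]
            exact Real.rpow_le_rpow_of_exponent_ge hs h hb1.le
          have hgs : g s = ENNReal.ofReal (s ^ b - s) := by simp [g, hs, h]
          rw [min_eq_left (ENNReal.ofReal_le_ofReal hsb), hgs, one_sub_expNeg_ofReal (by positivity),
            one_sub_expNeg_ofReal hs.le, ← ENNReal.ofReal_add (by simp [hs.le]) (by linarith)]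
          refine ENNReal.ofReal_le_ofReal ?_
          have h3 : Real.exp (-s) * (s ^ b - s) ≤ s ^ b - s :=
            mul_le_of_le_one_left (by linarith) (by simp [hs.le])
          have h4 : Real.exp (-s) * (1 + (s - s ^ b)) ≤ Real.exp (-s ^ b) := by
            rw [show -s ^ b = -s + (s - s ^ b) by ring, Real.exp_add]
            exact mul_le_mul_of_nonneg_left (by linarith [Real.add_one_le_exp (s - s ^ b)])
              (Real.exp_pos _).le
          nlinarith
        · have hsb : s ^ b ≤ s := by
            nth_rw 2 [← Real.rpow_one s]
            exact Real.rpow_le_rpow_of_exponent_le h.le hb1.le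
          rw [min_eq_right (ENNReal.ofReal_le_ofReal hsb)]
          exact le_self_add
    _ = branchExponent a b 1 + ∫⁻ s, g s ∂(levelIntensity a b) := by
        rw [lintegral_add_right _ hg]; rfl
    _ ≤ _ := by
        refine add_le_add_right ?_ _
        rw [lintegral_levelIntensity ha hab]
        have e1 : ∫⁻ s in Set.Ioi (0 : ℝ), ENNReal.ofReal (s ^ (-1 - a)) * g s =
            ∫⁻ s in Set.Ioc (0 : ℝ) 1, ENNReal.ofReal (s ^ (b - a - 1) - s ^ (-a)) := by
          rw [← lintegral_indicator measurableSet_Ioi, ← lintegral_indicator measurableSet_Ioc]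
          refine lintegral_congr fun s => ?_
          by_cases hs : 0 < s
          · by_cases hs1 : s ≤ 1
            · simp only [g, Set.indicator, Set.mem_Ioi, Set.mem_Ioc, hs, hs1, and_self, if_true]
              rw [← ENNReal.ofReal_mul (by positivity), mul_sub, ← Real.rpow_add hs]
              nth_rw 3 [← Real.rpow_one s]
              rw [← Real.rpow_add hs]
              ring_nf
            · simp [g, Set.indicator, hs1]
          · simp [Set.indicator, hs]
        have e2 : ∫⁻ s in Set.Ioc (0 : ℝ) 1, ENNReal.ofReal (s ^ (b - a - 1) - s ^ (-a)) =
            ENNReal.ofReal (1 / (b - a) - 1 / (1 - a)) := by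
          have h1 := intervalIntegral.intervalIntegrable_rpow' (a := 0) (b := 1)
            (r := b - a - 1) (by linarith)
          have h2 := intervalIntegral.intervalIntegrable_rpow' (a := 0) (b := 1)
            (r := -a) (by linarith)
          have h3 := h1.sub h2
          rw [intervalIntegrable_iff_integrableOn_Ioc_of_le zero_le_one] at h3
          rw [← ofReal_integral_eq_lintegral_ofReal h3, ← intervalIntegral.integral_of_le zero_le_one,
            intervalIntegral.integral_sub h1 h2, integral_rpow (.inl (by linarith)),
            integral_rpow (.inl (by linarith))]
          · congr 1
            rw [Real.zero_rpow (by linarith), Real.zero_rpow (by linarith)]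
            simp only [Real.one_rpow]
            ring_nf
          · refine (ae_restrict_iff' measurableSet_Ioc).2 (.of_forall fun s hs => ?_)
            exact sub_nonneg.2 (Real.rpow_le_rpow_of_exponent_ge hs.1 hs.2 (by linarith))
        rw [e1, e2, ← ENNReal.ofReal_mul hc.le]
        refine ENNReal.ofReal_le_ofReal ?_
        have hba : 0 < b - a := by linarith
        have h1a : 0 < 1 - a := by linarith
        have e3 : 1 / (b - a) - 1 / (1 - a) = (1 - b) / ((b - a) * (1 - a)) := by
          field_simp; ring
        have hn : 0 ≤ (1 - b) / ((b - a) * (1 - a)) := div_nonneg (by linarith) (by positivity)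
        rw [e3]
        refine (mul_le_mul_of_nonneg_right (levelConst_le ha hab) hn).trans (le_of_eq ?_)
        field_simp

/-- Replacing `s` by `s / (1 + s)` costs at most `s ^ 2` on `(0, 1]` and at most `1` beyond. Both
losses integrate to multiples of `levelConst a 1`, which is at most `2 * (1 - a)`. -/
lemma visitExponent_one_ge {a : ℝ} (ha : 0 < a) (ha1 : a < 1) :
    1 ≤ visitExponent a 1 + ENNReal.ofReal (2 * (1 - a) * (1 + 1 / a)) := by
  have hc := levelConst_pos ha ha1
  let g : ℝ → ℝ≥0∞ := (Set.Ioc (0 : ℝ) 1).indicator fun s => ENNReal.ofReal (s ^ (2 : ℝ))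
  have hg : Measurable g := Measurable.indicator (by fun_prop) measurableSet_Ioc
  let g' : ℝ → ℝ≥0∞ := (Set.Ioi (1 : ℝ)).indicator fun _ => 1
  have hg' : Measurable g' := Measurable.indicator (by fun_prop) measurableSet_Ioi
  calc (1 : ℝ≥0∞) = ∫⁻ s, (1 - expNeg (ENNReal.ofReal s ^ (1 : ℝ))) ∂(levelIntensity a 1) :=
        (lintegral_one_sub_expNeg_rpow ha ha1).symm
    _ ≤ ∫⁻ s, ((1 - expNeg (1 * (1 - (1 + ENNReal.ofReal s)⁻¹))) + (g s + g' s))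
          ∂(levelIntensity a 1) := by
        refine lintegral_levelIntensity_mono fun s hs => ?_
        rcases le_or_gt s 1 with h | h
        · have hgs : g s = ENNReal.ofReal (s ^ (2 : ℝ)) := by simp [g, hs, h]
          have hgs' : g' s = 0 := by simp [g', h]
          have hp : 0 ≤ s / (1 + s) := by positivity
          rw [ENNReal.rpow_one, hgs, hgs', add_zero, one_mul, one_sub_inv_eq_ofReal hs.le,
            one_sub_expNeg_ofReal hs.le, one_sub_expNeg_ofReal hp,
            ← ENNReal.ofReal_add (by simp [hp]) (by positivity)]
          refine ENNReal.ofReal_le_ofReal ?_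
          rw [Real.rpow_two]
          have e : s - s / (1 + s) = s ^ 2 / (1 + s) := by field_simp; ring
          have h2 : s ^ 2 / (1 + s) ≤ s ^ 2 := div_le_self (by positivity) (by linarith)
          have h3 : Real.exp (-(s / (1 + s))) * (s - s / (1 + s)) ≤ s - s / (1 + s) :=
            mul_le_of_le_one_left (by rw [e]; positivity) (by simp [hp])
          have h4 : Real.exp (-(s / (1 + s))) * (1 + (s / (1 + s) - s)) ≤ Real.exp (-s) := by
            rw [show -s = -(s / (1 + s)) + (s / (1 + s) - s) by ring, Real.exp_add]
            exact mul_le_mul_of_nonneg_left (by linarith [Real.add_one_le_exp (s / (1 + s) - s)])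
              (Real.exp_pos _).le
          nlinarith
        · have hgs' : g' s = 1 := by simp [g', h]
          rw [hgs']
          exact tsub_le_self.trans (le_add_self.trans le_add_self)
    _ = visitExponent a 1 + (∫⁻ s, g s ∂(levelIntensity a 1) +
          ∫⁻ s, g' s ∂(levelIntensity a 1)) := by
        rw [lintegral_add_right _ (show Measurable fun s => g s + g' s from hg.add hg'),
          lintegral_add_right _ hg']; rfl
    _ ≤ _ := by
        refine add_le_add_right ?_ _
        have e1 : ∫⁻ s, g s ∂(levelIntensity a 1) =
            ENNReal.ofReal (levelConst a 1 * (1 / (2 - a))) := by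
          rw [lintegral_levelIntensity ha ha1, ENNReal.ofReal_mul hc.le]
          congr 1
          rw [show (2 : ℝ) - a = (1 - a) + 1 by ring, ← lintegral_rpow_Ioc (by linarith),
            ← lintegral_indicator measurableSet_Ioi, ← lintegral_indicator measurableSet_Ioc]
          refine lintegral_congr fun s => ?_
          by_cases hs : 0 < s
          · by_cases hs1 : s ≤ 1
            · simp only [g, Set.indicator, Set.mem_Ioi, Set.mem_Ioc, hs, hs1, and_self, if_true]
              rw [← ENNReal.ofReal_mul (by positivity), ← Real.rpow_add hs]
              ring_nf
            · simp [g, Set.indicator, hs1]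
          · simp [Set.indicator, hs]
        have e2 : ∫⁻ s, g' s ∂(levelIntensity a 1) = ENNReal.ofReal (levelConst a 1 * (1 / a)) := by
          rw [lintegral_indicator measurableSet_Ioi, lintegral_const, Measure.restrict_apply_univ,
            levelIntensity_Ioi ha ha1 one_pos, Real.one_rpow, one_mul]
          congr 1; ring
        have h2a : 0 < 2 - a := by linarith
        rw [e1, e2, ← ENNReal.ofReal_add (by positivity) (by positivity)]
        refine ENNReal.ofReal_le_ofReal ?_
        have h5 : 1 / (2 - a) ≤ 1 := by rw [div_le_one h2a]; linarith
        have h6 := levelConst_le ha ha1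
        have h7 : 0 < 1 / a := by positivity
        rw [← mul_add]
        calc _ ≤ levelConst a 1 * (1 + 1 / a) := mul_le_mul_of_nonneg_left (by linarith) hc.le
          _ ≤ _ := mul_le_mul_of_nonneg_right h6 (by positivity)

lemma branchExponent_one_le {a b : ℝ} (ha : 0 < a) (hab : a < b) : branchExponent a b 1 ≤ 1 := by
  refine le_of_le_of_eq ?_ (lintegral_one_sub_expNeg_rpow ha hab)
  refine lintegral_mono fun s => one_sub_expNeg_mono ?_
  rw [one_mul]; exact min_le_right _ _

lemma visitExponent_one_le {a : ℝ} (ha : 0 < a) (ha1 : a < 1) : visitExponent a 1 ≤ 1 := by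
  refine le_of_le_of_eq ?_ (lintegral_one_sub_expNeg_rpow ha ha1)
  refine lintegral_levelIntensity_mono fun s hs => one_sub_expNeg_mono ?_
  rw [one_mul, one_sub_inv_eq_ofReal hs.le, ENNReal.rpow_one]
  exact ENNReal.ofReal_le_ofReal (div_le_self hs.le (by linarith))

/-! ### Recursion for the constants along the levels. -/

section Rates

variable {α : ℕ → ℝ}

/-- The summands of `hsum` are the consecutive ratios of `1 - α k`; they tend to `0`, and the ratio
test applies. -/
lemma summable_one_sub (hα_lt : ∀ k, α k < 1)
    (hsum : Summable (fun k => (1 - α (k + 1)) / (1 - α k))) : Summable fun k => 1 - α k := by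
  have h1 : ∀ k, 0 < 1 - α k := fun k => by linarith [hα_lt k]
  refine summable_of_ratio_test_tendsto_lt_one zero_lt_one (.of_forall fun k => (h1 k).ne') ?_
  refine hsum.tendsto_atTop_zero.congr fun k => ?_
  rw [Real.norm_of_nonneg (h1 _).le, Real.norm_of_nonneg (h1 _).le]

/-- The loss in the exponents at each level is summable. -/
lemma exists_rates (hα_pos : 0 < α 0) (hα_mono : StrictMono α) (hα_lt : ∀ k, α k < 1)
    (hsum : Summable (fun k => (1 - α (k + 1)) / (1 - α k))) :
    ∃ r : ℕ → ℝ, (∀ k, 0 ≤ r k) ∧ Summable r ∧ ∀ k, ENNReal.ofReal (Real.exp (-r k)) ≤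
      branchExponent (α k) (α (k + 1)) 1 * visitExponent (α k) 1 := by
  have hpos : ∀ k, 0 < α k := fun k => hα_pos.trans_le (hα_mono.monotone (Nat.zero_le k))
  have h1 : ∀ k, 0 < 1 - α k := fun k => by linarith [hα_lt k]
  have hst : ∀ k, α k < α (k + 1) := fun k => hα_mono (Nat.lt_succ_self k)
  let F : ℕ → ℝ := fun k => (branchExponent (α k) (α (k + 1)) 1).toReal
  let V : ℕ → ℝ := fun k => (visitExponent (α k) 1).toReal
  have hF1 : ∀ k, branchExponent (α k) (α (k + 1)) 1 ≤ 1 := fun k =>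
    branchExponent_one_le (hpos k) (hst k)
  have hV1 : ∀ k, visitExponent (α k) 1 ≤ 1 := fun k => visitExponent_one_le (hpos k) (hα_lt k)
  have hFt : ∀ k, branchExponent (α k) (α (k + 1)) 1 ≠ ∞ := fun k =>
    ((hF1 k).trans_lt ENNReal.one_lt_top).ne
  have hVt : ∀ k, visitExponent (α k) 1 ≠ ∞ := fun k => ((hV1 k).trans_lt ENNReal.one_lt_top).ne
  have hF0 : ∀ k, 0 < F k := fun k =>
    ENNReal.toReal_pos (branchExponent_one_pos (hpos k) (hst k)).ne' (hFt k)
  have hV0 : ∀ k, 0 < V k := fun k =>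
    ENNReal.toReal_pos (visitExponent_one_pos (hpos k) (hα_lt k)).ne' (hVt k)
  have hFle : ∀ k, F k ≤ 1 := fun k => ENNReal.toReal_le_of_le_ofReal zero_le_one (by simpa using hF1 k)
  have hVle : ∀ k, V k ≤ 1 := fun k => ENNReal.toReal_le_of_le_ofReal zero_le_one (by simpa using hV1 k)
  let x : ℕ → ℝ := fun k => 2 * ((1 - α (k + 1)) / (1 - α k))
  let y : ℕ → ℝ := fun k => 2 * (1 - α k) * (1 + 1 / α 0)
  have hx : ∀ k, 1 - x k ≤ F k := fun k => by
    have hx0 : 0 ≤ x k := mul_nonneg zero_le_two (div_nonneg (h1 _).le (h1 _).le)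
    have := branchExponent_one_ge (hpos k) (hst k) (hα_lt (k + 1))
    have := ENNReal.toReal_mono (ENNReal.add_ne_top.2 ⟨hFt k, ENNReal.ofReal_ne_top⟩) this
    rw [ENNReal.toReal_add (hFt k) ENNReal.ofReal_ne_top, ENNReal.toReal_ofReal hx0,
      ENNReal.toReal_one] at this
    linarith
  have hy : ∀ k, 1 - y k ≤ V k := fun k => by
    have hy0 : 0 ≤ 2 * (1 - α k) * (1 + 1 / α k) :=
      mul_nonneg (mul_nonneg zero_le_two (h1 k).le) (by have := hpos k; positivity)
    have := visitExponent_one_ge (hpos k) (hα_lt k)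
    have := ENNReal.toReal_mono (ENNReal.add_ne_top.2 ⟨hVt k, ENNReal.ofReal_ne_top⟩) this
    rw [ENNReal.toReal_add (hVt k) ENNReal.ofReal_ne_top, ENNReal.toReal_ofReal hy0,
      ENNReal.toReal_one] at this
    have h2 : 1 / α k ≤ 1 / α 0 :=
      one_div_le_one_div_of_le hα_pos (hα_mono.monotone (Nat.zero_le k))
    have h3 : 2 * (1 - α k) * (1 + 1 / α k) ≤ y k :=
      mul_le_mul_of_nonneg_left (by linarith) (by linarith [h1 k])
    have h4 : V k = (visitExponent (α k) 1).toReal := rfl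
    linarith
  have hs : Summable fun k => x k + y k :=
    (hsum.mul_left 2).add (((summable_one_sub hα_lt hsum).mul_left 2).mul_right _)
  have hρ : ∀ k, 1 - (x k + y k) ≤ F k * V k := fun k => by
    have h2 : 0 ≤ (1 - F k) * (1 - V k) :=
      mul_nonneg (by linarith [hFle k]) (by linarith [hVle k])
    nlinarith [hx k, hy k]
  have hρ0 : ∀ k, 0 < F k * V k := fun k => mul_pos (hF0 k) (hV0 k)
  have hr0 : ∀ k, 0 ≤ -Real.log (F k * V k) := fun k =>
    neg_nonneg.2 (Real.log_nonpos (hρ0 k).le (mul_le_one₀ (hFle k) (hV0 k).le (hVle k)))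
  refine ⟨fun k => -Real.log (F k * V k), hr0, ?_, fun k => ?_⟩
  -- Once `x k + y k < 1 / 2`, the product `ρ = F k * V k` is at least `1 / 2`, and there `-log ρ ≤
  -- ρ⁻¹ - 1 ≤ 2 * (1 - ρ)`.
  · refine (hs.mul_left 2).of_norm_bounded_eventually_nat ?_
    filter_upwards [hs.tendsto_atTop_zero.eventually (gt_mem_nhds (show (0 : ℝ) < 1 / 2 by norm_num))]
      with k hk
    rw [Real.norm_of_nonneg (hr0 k)]
    have h2 := Real.one_sub_inv_le_log_of_pos (hρ0 k)
    have h3 : 1 / 2 ≤ F k * V k := by linarith [hρ k]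
    have h4 : (F k * V k)⁻¹ - 1 ≤ 2 * (1 - F k * V k) := by
      rw [sub_le_iff_le_add, inv_le_iff_one_le_mul₀ (hρ0 k)]
      have h5 : F k * V k ≤ 1 := mul_le_one₀ (hFle k) (hV0 k).le (hVle k)
      nlinarith
    linarith [hρ k]
  · rw [neg_neg, Real.exp_log (hρ0 k), ENNReal.ofReal_mul (hF0 k).le, ENNReal.ofReal_toReal (hFt k),
      ENNReal.ofReal_toReal (hVt k)]

/-- The recursion for the logarithms of the exponents. -/
noncomputable def growth (α r : ℕ → ℝ) (x : ℝ) : ℕ → ℕ → ℝ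
  | 0, _ => x
  | j + 1, k => min (α (k + 1) * growth α r x j (k + 1)) (growth α r x j (k + 1)) - r k

/-- A step shrinks a nonnegative value by the factor `α (k + 1)`, leaves a negative one unscaled,
and then subtracts `r k`. Because `1 - α k` is summable, the product of the factors stays away from
`0`, so linear growth in `x` survives any number of steps. -/
lemma growth_lower (hα_pos : 0 < α 0) (hα_mono : StrictMono α) (hα_lt : ∀ k, α k < 1)
    (hs : Summable fun k => 1 - α k) {r : ℕ → ℝ} (hr : ∀ k, 0 ≤ r k) (hrs : Summable r) :
    ∃ p R : ℝ, 0 < p ∧ ∀ x, 0 ≤ x → ∀ j k, p * x - R ≤ growth α r x j k := by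
  have hpos : ∀ k, 0 < α k := fun k => hα_pos.trans_le (hα_mono.monotone (Nat.zero_le k))
  -- Chosen so that `exp (-d k) ≤ α k` with `d` summable; products of the `α k` are then bounded
  -- below by exponentials of sums.
  let d : ℕ → ℝ := fun k => (1 - α k) / α 0
  have hd0 : ∀ k, 0 ≤ d k := fun k => div_nonneg (by linarith [hα_lt k]) hα_pos.le
  have hds : Summable d := hs.div_const _
  have hαd : ∀ k, Real.exp (-d k) ≤ α k := fun k => by
    have h1 := Real.one_sub_inv_le_log_of_pos (hpos k)
    rw [← Real.le_log_iff_exp_le (hpos k)]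
    have h2 : (α k)⁻¹ - 1 ≤ d k := by
      have : (α k)⁻¹ - 1 = (1 - α k) / α k := by have := (hpos k).ne'; field_simp
      rw [this]
      exact div_le_div_of_nonneg_left (by linarith [hα_lt k]) hα_pos
        (hα_mono.monotone (Nat.zero_le k))
    linarith
  have key : ∀ x, 0 ≤ x → ∀ j k, Real.exp (-∑ i ∈ Finset.range j, d (k + 1 + i)) * x -
      ∑ i ∈ Finset.range j, r (k + i) ≤ growth α r x j k := by
    intro x hx j
    induction j with
    | zero => intro k; simp [growth]
    | succ j ih =>
      intro k
      have h := ih (k + 1)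
      have e1 : Real.exp (-∑ i ∈ Finset.range (j + 1), d (k + 1 + i)) =
          Real.exp (-d (k + 1)) * Real.exp (-∑ i ∈ Finset.range j, d (k + 1 + 1 + i)) := by
        rw [← Real.exp_add, Finset.sum_range_succ']
        congr 1
        simp only [add_zero, add_assoc, add_comm 1]
        ring_nf
      have e2 : ∑ i ∈ Finset.range (j + 1), r (k + i) =
          ∑ i ∈ Finset.range j, r (k + 1 + i) + r k := by
        rw [Finset.sum_range_succ']
        congr 1
        exact Finset.sum_congr rfl fun i _ => by congr 1; ring
      rw [growth, e1, e2]
      set A := Real.exp (-∑ i ∈ Finset.range j, d (k + 1 + 1 + i)) * x with hA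
      set B := ∑ i ∈ Finset.range j, r (k + 1 + i) with hB
      set L := growth α r x j (k + 1)
      have hA0 : 0 ≤ A := by positivity
      have hB0 : 0 ≤ B := Finset.sum_nonneg fun i _ => hr _
      have hE1 : Real.exp (-d (k + 1)) ≤ 1 := by
        rw [Real.exp_le_one_iff]; linarith [hd0 (k + 1)]
      have hE0 := Real.exp_pos (-d (k + 1))
      have hEA : Real.exp (-d (k + 1)) * A ≤ A := mul_le_of_le_one_left hA0 hE1
      have h2 : Real.exp (-d (k + 1)) * A - B ≤ min (α (k + 1) * L) L := by
        refine le_min ?_ (by linarith)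
        rcases le_total 0 L with hL | hL
        · have h3 : Real.exp (-d (k + 1)) * L ≤ α (k + 1) * L :=
            mul_le_mul_of_nonneg_right (hαd _) hL
          have h4 : Real.exp (-d (k + 1)) * (A - B) ≤ Real.exp (-d (k + 1)) * L :=
            mul_le_mul_of_nonneg_left h hE0.le
          have h5 : Real.exp (-d (k + 1)) * B ≤ B := mul_le_of_le_one_left hB0 hE1
          linarith
        · have : L ≤ α (k + 1) * L := by nlinarith [hα_lt (k + 1)]
          linarith
      rw [mul_assoc]
      linarith
  refine ⟨Real.exp (-∑' i, d i), ∑' i, r i, Real.exp_pos _, fun x hx j k => le_trans ?_ (key x hx j k)⟩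
  have h1 : ∑ i ∈ Finset.range j, d (k + 1 + i) ≤ ∑' i, d i := by
    have hinj : Function.Injective fun i => k + 1 + i := add_right_injective _
    exact ((hds.comp_injective hinj).sum_le_tsum _ fun i _ => hd0 _).trans
      (tsum_comp_le_tsum_of_inj hds hd0 hinj)
  have h2 : ∑ i ∈ Finset.range j, r (k + i) ≤ ∑' i, r i := by
    have hinj : Function.Injective fun i => k + i := add_right_injective _
    exact ((hrs.comp_injective hinj).sum_le_tsum _ fun i _ => hr _).trans
      (tsum_comp_le_tsum_of_inj hrs hr hinj)
  have h3 : Real.exp (-∑' i, d i) * x ≤ Real.exp (-∑ i ∈ Finset.range j, d (k + 1 + i)) * x :=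
    mul_le_mul_of_nonneg_right (Real.exp_le_exp.2 (by linarith)) hx
  linarith

/-- One step of the recursion for the exponents. -/
lemma exponent_step (hα_pos : 0 < α 0) (hα_mono : StrictMono α) (hα_lt : ∀ k, α k < 1)
    {r : ℕ → ℝ} (hr : ∀ k, ENNReal.ofReal (Real.exp (-r k)) ≤
      branchExponent (α k) (α (k + 1)) 1 * visitExponent (α k) 1) (hr0 : ∀ k, 0 ≤ r k)
    (k : ℕ) (L : ℝ) :
    ENNReal.ofReal (Real.exp (α k * (min (α (k + 1) * L) L - r k / α 0))) ≤
      branchExponent (α k) (α (k + 1)) (ENNReal.ofReal (Real.exp (α (k + 1) * L))) *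
        visitExponent (α k) 1 := by
  have hpos : ∀ k, 0 < α k := fun k => hα_pos.trans_le (hα_mono.monotone (Nat.zero_le k))
  have hst : α k < α (k + 1) := hα_mono (Nat.lt_succ_self k)
  have h1 := branchExponent_lower (hpos k) hst (hα_lt (k + 1)).le
    (C := ENNReal.ofReal (Real.exp (α (k + 1) * L))) ENNReal.ofReal_ne_top
  -- For `C = exp (α (k + 1) * L)` the powers `C ^ α k` and `C ^ (α k / α (k + 1))` are `exp (α k *
  -- ·)` at `α (k + 1) * L` and at `L`.
  have h2 : ENNReal.ofReal (Real.exp (α k * min (α (k + 1) * L) L)) ≤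
      min (ENNReal.ofReal (Real.exp (α (k + 1) * L)) ^ α k)
        (ENNReal.ofReal (Real.exp (α (k + 1) * L)) ^ (α k / α (k + 1))) := by
    rw [ENNReal.ofReal_rpow_of_pos (Real.exp_pos _), ENNReal.ofReal_rpow_of_pos (Real.exp_pos _),
      ← Real.exp_mul, ← Real.exp_mul]
    refine le_min (ENNReal.ofReal_le_ofReal (Real.exp_le_exp.2 ?_))
      (ENNReal.ofReal_le_ofReal (Real.exp_le_exp.2 ?_))
    · rw [mul_comm _ (α k)]
      exact mul_le_mul_of_nonneg_left (min_le_left _ _) (hpos k).le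
    · have := (hpos (k + 1)).ne'
      rw [show α (k + 1) * L * (α k / α (k + 1)) = α k * L by field_simp]
      exact mul_le_mul_of_nonneg_left (min_le_right _ _) (hpos k).le
  calc ENNReal.ofReal (Real.exp (α k * (min (α (k + 1) * L) L - r k / α 0)))
      ≤ ENNReal.ofReal (Real.exp (-r k)) *
          ENNReal.ofReal (Real.exp (α k * min (α (k + 1) * L) L)) := by
        rw [← ENNReal.ofReal_mul (Real.exp_pos _).le, ← Real.exp_add]
        refine ENNReal.ofReal_le_ofReal (Real.exp_le_exp.2 ?_)
        -- The division of `r k` by `α 0` compensates the factor `α k` in the exponent, since `α 0 ≤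
        -- α k`.
        have : r k ≤ α k * (r k / α 0) := by
          rw [mul_div_assoc', le_div_iff₀ hα_pos, mul_comm]
          exact mul_le_mul_of_nonneg_right (hα_mono.monotone (Nat.zero_le k)) (hr0 k)
        linarith
    _ ≤ (branchExponent (α k) (α (k + 1)) 1 * visitExponent (α k) 1) *
          min (ENNReal.ofReal (Real.exp (α (k + 1) * L)) ^ α k)
        (ENNReal.ofReal (Real.exp (α (k + 1) * L)) ^ (α k / α (k + 1))) := mul_le_mul' (hr k) h2
    _ = (branchExponent (α k) (α (k + 1)) 1 * min (ENNReal.ofReal (Real.exp (α (k + 1) * L)) ^ α k)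
        (ENNReal.ofReal (Real.exp (α (k + 1) * L)) ^ (α k / α (k + 1)))) *
          visitExponent (α k) 1 := by ring
    _ ≤ _ := mul_le_mul_left h1 _

end Rates

lemma measurable_tsum_of {A ι : Type*} {_ : MeasurableSpace A} [Countable ι] {f : ι → A → ℝ≥0∞}
    (h : ∀ i, Measurable (f i)) : Measurable fun a => ∑' i, f i a := Measurable.tsum h

lemma measurable_limsup_of {A : Type*} {_ : MeasurableSpace A} {f : ℕ → A → ℝ≥0∞}
    (h : ∀ i, Measurable (f i)) : Measurable fun a => limsup (fun n => f n a) atTop :=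
  Measurable.limsup h

/-! ### Sums over the descendants of a node -/

/-- The product of the parameters along the path from `v` to its descendant `l ++ v`. -/
noncomputable def pathProd (g : List ℕ → ℕ → ℝ≥0∞) (v : List ℕ) : List ℕ → ℝ≥0∞
  | [] => 1
  | z :: l => pathProd g v l * g (l ++ v) z

/-- The sum of the `p`-th powers of the path products over the descendants in generation `j`. -/
noncomputable def descSum (g : List ℕ → ℕ → ℝ≥0∞) (p : ℝ) (v : List ℕ) (j : ℕ) : ℝ≥0∞ :=
  ∑' l : List ℕ, if l.length = j then pathProd g v l ^ p else 0

lemma pathProd_append (g : List ℕ → ℕ → ℝ≥0∞) (v : List ℕ) (x : ℕ) (l : List ℕ) :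
    pathProd g v (l ++ [x]) = g v x * pathProd g (x :: v) l := by
  induction l with
  | nil => simp [pathProd]
  | cons z l ih => simp [pathProd, ih, mul_assoc]

lemma pathProd_ne_top {g : List ℕ → ℕ → ℝ≥0∞} (hg : ∀ v x, g v x ≠ ∞) (v l : List ℕ) :
    pathProd g v l ≠ ∞ := by
  induction l with
  | nil => simp [pathProd]
  | cons z l ih => exact ENNReal.mul_ne_top ih (hg _ _)

/-- The list is split at its head, the label in the last generation. -/
lemma tsum_list_length_succ (F : List ℕ → ℝ≥0∞) (j : ℕ) :
    ∑' l : List ℕ, (if l.length = j + 1 then F l else 0) =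
      ∑' l : List ℕ, if l.length = j then ∑' z, F (z :: l) else 0 := by
  have hinj : Function.Injective fun q : List ℕ × ℕ => q.2 :: q.1 := by
    rintro ⟨a, b⟩ ⟨c, d⟩ h
    simp only [List.cons.injEq] at h
    rw [h.1, h.2]
  rw [← hinj.tsum_eq (f := fun l => if l.length = j + 1 then F l else 0), ENNReal.tsum_prod']
  · refine tsum_congr fun l => ?_
    by_cases hl : l.length = j <;> simp [hl]
  · intro l hl
    cases l with
    | nil => simp at hl
    | cons z l => exact ⟨(l, z), rfl⟩

/-- The list is split at its last entry, the label in the first generation below the starting node.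
-/
lemma tsum_list_length_succ' (F : List ℕ → ℝ≥0∞) (j : ℕ) :
    ∑' l : List ℕ, (if l.length = j + 1 then F l else 0) =
      ∑' x, ∑' l : List ℕ, if l.length = j then F (l ++ [x]) else 0 := by
  have hinj : Function.Injective fun q : ℕ × List ℕ => q.2 ++ [q.1] := by
    rintro ⟨a, b⟩ ⟨c, d⟩ h
    have := List.append_inj' h rfl
    simp only [List.cons.injEq, and_true] at this
    rw [this.1, this.2]
  rw [← hinj.tsum_eq (f := fun l => if l.length = j + 1 then F l else 0), ENNReal.tsum_prod']
  · refine tsum_congr fun x => tsum_congr fun l => ?_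
    by_cases hl : l.length = j <;> simp [hl]
  · intro l hl
    have hl' : l ≠ [] := by rintro rfl; simp at hl
    exact ⟨(l.getLast hl', l.dropLast), List.dropLast_append_getLast hl'⟩

lemma descSum_zero (g : List ℕ → ℕ → ℝ≥0∞) (p : ℝ) (v : List ℕ) : descSum g p v 0 = 1 := by
  rw [descSum, tsum_eq_single []]
  · simp [pathProd]
  · intro l hl
    simp [hl]

/-- Decomposition over the children of `v`, which relates the limits at a node to those at its
children. -/
lemma descSum_succ {g : List ℕ → ℕ → ℝ≥0∞} {p : ℝ} (hp : 0 ≤ p) (v : List ℕ) (j : ℕ) :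
    descSum g p v (j + 1) = ∑' x, g v x ^ p * descSum g p (x :: v) j := by
  rw [descSum, tsum_list_length_succ']
  refine tsum_congr fun x => ?_
  rw [descSum, ← ENNReal.tsum_mul_left]
  refine tsum_congr fun l => ?_
  split_ifs
  · rw [pathProd_append, ENNReal.mul_rpow_of_nonneg _ _ hp]
  · simp

/-- Decomposition over the last generation, whose parameters are independent of the earlier ones;
this is the form needed for the martingale property. -/
lemma descSum_succ' {g : List ℕ → ℕ → ℝ≥0∞} {p : ℝ} (hp : 0 ≤ p) (c : ℝ≥0∞) (v : List ℕ) (j : ℕ) :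
    c ^ p * descSum g p v (j + 1) =
      ∑' l : List ℕ, if l.length = j then ∑' z, (c * pathProd g v l * g (l ++ v) z) ^ p else 0 := by
  rw [descSum, tsum_list_length_succ, ← ENNReal.tsum_mul_left]
  refine tsum_congr fun l => ?_
  split_ifs
  · rw [← ENNReal.tsum_mul_left]
    refine tsum_congr fun z => ?_
    rw [pathProd, mul_assoc, ← ENNReal.mul_rpow_of_nonneg _ _ hp]
  · simp

/-- No term exceeds `Z ^ (1 / a)`, so `c i = c i ^ a * c i ^ (1 - a)` is at most a finite constant
times `c i ^ a`. -/
lemma tsum_ne_top_of_tsum_rpow_ne_top {ι : Type*} {c : ι → ℝ≥0∞} {a : ℝ} (ha : 0 < a) (ha1 : a ≤ 1)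
    (h : ∑' i, c i ^ a ≠ ∞) : ∑' i, c i ≠ ∞ := by
  set Z := ∑' i, c i ^ a with hZ
  have h1 : ∀ i, c i ≤ c i ^ a * (Z ^ (1 / a)) ^ (1 - a) := by
    intro i
    have h2 : c i ≤ Z ^ (1 / a) := by
      rw [one_div, ENNReal.le_rpow_inv_iff ha]
      exact ENNReal.le_tsum i
    calc c i = c i ^ a * c i ^ (1 - a) := by
          rw [← ENNReal.rpow_add_of_nonneg _ _ ha.le (by linarith)]; simp
      _ ≤ _ := mul_le_mul_right (ENNReal.rpow_le_rpow h2 (by linarith)) _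
  refine ne_top_of_le_ne_top ?_ (ENNReal.tsum_le_tsum h1)
  rw [ENNReal.tsum_mul_right]
  exact ENNReal.mul_ne_top h (ENNReal.rpow_ne_top_of_nonneg (by linarith)
    (ENNReal.rpow_ne_top_of_nonneg (by positivity) h))

lemma descSum_one_ne_top {g : List ℕ → ℕ → ℝ≥0∞} {p : ℝ} (hp : 0 < p) (hp1 : p ≤ 1) {v : List ℕ}
    {j : ℕ} (h : descSum g p v j ≠ ∞) : descSum g 1 v j ≠ ∞ := by
  have e : ∀ q : ℝ, 0 < q → descSum g q v j =
      ∑' l : List ℕ, (if l.length = j then pathProd g v l else 0) ^ q := fun q hq => by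
    refine tsum_congr fun l => ?_
    split_ifs
    · rfl
    · rw [ENNReal.zero_rpow_of_pos hq]
  rw [e p hp] at h
  have := tsum_ne_top_of_tsum_rpow_ne_top hp hp1 h
  rw [e 1 one_pos]
  simpa using this

lemma measurable_pathProd {Ω : Type*} [MeasurableSpace Ω] {g : List ℕ → ℕ → Ω → ℝ≥0∞}
    {v : List ℕ} (l : List ℕ)
    (hg : ∀ w x, v <:+ w → w.length < v.length + l.length → Measurable (g w x)) :
    Measurable fun ω => pathProd (fun w x => g w x ω) v l := by
  induction l with
  | nil => exact measurable_const
  | cons z l ih =>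
    refine (ih fun w x hw hl => hg w x hw ?_).mul (hg _ _ (List.suffix_append _ _) ?_)
    · simp; omega
    · simp; omega

lemma measurable_descSum {Ω : Type*} [MeasurableSpace Ω] {g : List ℕ → ℕ → Ω → ℝ≥0∞}
    {v : List ℕ} (p : ℝ) (j : ℕ)
    (hg : ∀ w x, v <:+ w → w.length < v.length + j → Measurable (g w x)) :
    Measurable fun ω => descSum (fun w x => g w x ω) p v j := by
  refine Measurable.tsum fun l => ?_
  by_cases hl : l.length = j
  · simp only [hl, if_true]
    exact (measurable_pathProd l fun w x hw h => hg w x hw (hl ▸ h)).pow_const p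
  · simp only [hl, if_false]
    exact measurable_const

lemma measurable_mul_expNeg_descend {A B : Type*} {_ : MeasurableSpace A} {_ : MeasurableSpace B}
    {ψ : A → ℝ≥0∞} {u : A → List ℕ → ℝ≥0∞} {w : B → List ℕ → ℕ → ℝ≥0∞} {v : List ℕ} {j : ℕ} {p : ℝ}
    (hψ : Measurable ψ) (hu : ∀ l : List ℕ, l.length = j → Measurable fun a => u a l)
    (hw : ∀ l : List ℕ, l.length = j → ∀ z, Measurable fun b => w b (l ++ v) z) :
    Measurable fun q : A × B => ψ q.1 * expNeg (∑' l : List ℕ, if l.length = j then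
      ∑' z, (u q.1 l * w q.2 (l ++ v) z) ^ p else 0) := by
  refine (hψ.comp measurable_fst).mul (measurable_expNeg.comp (Measurable.tsum fun l => ?_))
  by_cases hl : l.length = j
  · simp only [hl, if_true]
    exact Measurable.tsum fun z =>
      (((hu l hl).comp measurable_fst).mul ((hw l hl z).comp measurable_snd)).pow_const _
  · simp only [hl, if_false]
    exact measurable_const

/-! ### Independent sources and the martingale of the sums over descendants. -/

namespace KTreeData

variable {Ω : Type*} (D : KTreeData Ω)

/-- The parameters, with values in `[0, ∞]`. -/
noncomputable def weight (ω : Ω) (v : List ℕ) (x : ℕ) : ℝ≥0∞ := ENNReal.ofReal (D.γ v x ω)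

lemma weight_ne_top (ω : Ω) (v : List ℕ) (x : ℕ) : D.weight ω v x ≠ ∞ := ENNReal.ofReal_ne_top

/-- The σ-algebra generated by a set of sources. -/
@[reducible] def sig (S : Set (List ℕ ⊕ (ℕ × ℕ) ⊕ (ℕ × ℕ × ℕ))) : MeasurableSpace Ω :=
  ⨆ i ∈ S, D.source i

lemma source_le_sig {S : Set (List ℕ ⊕ (ℕ × ℕ) ⊕ (ℕ × ℕ × ℕ))}
    {i : List ℕ ⊕ (ℕ × ℕ) ⊕ (ℕ × ℕ × ℕ)} (hi : i ∈ S) : D.source i ≤ D.sig S :=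
  le_biSup D.source hi

lemma sig_mono {S T : Set (List ℕ ⊕ (ℕ × ℕ) ⊕ (ℕ × ℕ × ℕ))} (h : S ⊆ T) : D.sig S ≤ D.sig T :=
  biSup_mono h

lemma measurable_γ_sig {S : Set (List ℕ ⊕ (ℕ × ℕ) ⊕ (ℕ × ℕ × ℕ))} {v : List ℕ} (x : ℕ)
    (h : .inl v ∈ S) : Measurable[D.sig S] (D.γ v x) := by
  refine Measurable.mono ?_ (D.source_le_sig h) le_rfl
  exact (measurable_pi_apply x).comp (comap_measurable (fun ω y => D.γ v y ω))

lemma measurable_σ_sig {S : Set (List ℕ ⊕ (ℕ × ℕ) ⊕ (ℕ × ℕ × ℕ))} {k x : ℕ} (i : ℕ)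
    (h : .inr (.inl (k, x)) ∈ S) : Measurable[D.sig S] (D.σ k x i) := by
  refine Measurable.mono ?_ (D.source_le_sig h) le_rfl
  exact (measurable_pi_apply i).comp (comap_measurable (fun ω y => D.σ k x y ω))

lemma measurable_T_sig {S : Set (List ℕ ⊕ (ℕ × ℕ) ⊕ (ℕ × ℕ × ℕ))} {k x i : ℕ}
    (h : .inr (.inr (k, x, i)) ∈ S) : Measurable[D.sig S] (D.T k x i) := by
  refine Measurable.mono ?_ (D.source_le_sig h) le_rfl
  exact comap_measurable (D.T k x i)

lemma measurable_weight_sig {S : Set (List ℕ ⊕ (ℕ × ℕ) ⊕ (ℕ × ℕ × ℕ))} {v : List ℕ} (x : ℕ)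
    (h : .inl v ∈ S) : Measurable[D.sig S] fun ω => D.weight ω v x :=
  ENNReal.measurable_ofReal.comp (D.measurable_γ_sig x h)

/-- The version of `W` that only depends on the parameters of the descendants. -/
noncomputable def limW (α : ℕ → ℝ) (v : List ℕ) (ω : Ω) : ℝ≥0∞ :=
  limsup (fun j => descSum (D.weight ω) (α (v.length + j)) v j) atTop

lemma measurable_limW (α : ℕ → ℝ) (v : List ℕ) {S : Set (List ℕ ⊕ (ℕ × ℕ) ⊕ (ℕ × ℕ × ℕ))}
    (hS : ∀ w, v <:+ w → .inl w ∈ S) : Measurable[D.sig S] (D.limW α v) := by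
  refine measurable_limsup_of fun j => ?_
  exact @measurable_descSum Ω (D.sig S) (fun w x ω => D.weight ω w x) v _ j
    fun w x hw _ => D.measurable_weight_sig x (hS w hw)

lemma γbar_append {ω : Ω} (hpos : ∀ v y, 0 < D.γ v y ω) (v l : List ℕ) :
    ENNReal.ofReal (D.γbar (l ++ v) ω / D.γbar v ω) = pathProd (D.weight ω) v l := by
  have h0 : ∀ v, 0 < D.γbar v ω := fun v => by
    induction v with
    | nil => simp [γbar]
    | cons y v ih => exact mul_pos ih (hpos v y)
  induction l with
  | nil => simp [pathProd, (h0 v).ne']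
  | cons z l ih =>
    rw [List.cons_append, γbar, pathProd, ← ih, weight, ← ENNReal.ofReal_mul
      (div_nonneg (h0 _).le (h0 _).le)]
    congr 1; ring

/-- `cylinderSum` is indexed by absolute depth and `descSum` by generation below `v`; descendants
correspond to lists `l ++ v`, and positivity allows the common factor `γbar v` to be cancelled. -/
lemma cylinderSum_eq_descSum {ω : Ω} (hpos : ∀ v y, 0 < D.γ v y ω) (α : ℕ → ℝ) (v : List ℕ) (j : ℕ) :
    D.cylinderSum α v (v.length + j) ω = descSum (D.weight ω) (α (v.length + j)) v j := by
  let e : {l : List ℕ // l.length = j} ≃ {y : List ℕ // y.length = v.length + j ∧ v <:+ y} :=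
    { toFun := fun l => ⟨l.1 ++ v, by simp [l.2]; omega, List.suffix_append _ _⟩
      invFun := fun y => ⟨y.1.take j, by rw [List.length_take]; have := y.2.1; omega⟩
      left_inv := fun l => by
        apply Subtype.ext
        simp only
        exact List.take_left' l.2
      right_inv := fun y => by
        apply Subtype.ext
        obtain ⟨y, hy, l, rfl⟩ := y
        have : l.length = j := by simp at hy; omega
        simp only
        rw [List.take_left' this] }
  rw [cylinderSum, ← e.tsum_eq, descSum]
  have : ∀ l : List ℕ, (if l.length = j then pathProd (D.weight ω) v l ^ α (v.length + j) else 0) =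
      ({l : List ℕ | l.length = j}).indicator
        (fun l => pathProd (D.weight ω) v l ^ α (v.length + j)) l := fun l => by
    simp [Set.indicator]
  simp_rw [this]
  rw [← tsum_subtype {l : List ℕ | l.length = j}
    (fun l => pathProd (D.weight ω) v l ^ α (v.length + j))]
  refine tsum_congr fun l => ?_
  rw [← D.γbar_append hpos]
  rfl

namespace IsModel

variable {D} [MeasurableSpace Ω] {P : Measure Ω} {α : ℕ → ℝ}

lemma source_le (hD : D.IsModel α P) (i : List ℕ ⊕ (ℕ × ℕ) ⊕ (ℕ × ℕ × ℕ)) :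
    D.source i ≤ ‹MeasurableSpace Ω› := by
  rcases i with v | ⟨k, x⟩ | ⟨k, x, i⟩
  · exact (measurable_pi_lambda _ fun y => (hD.γ_process v).measurable y).comap_le
  · exact (measurable_pi_lambda _ fun i => (hD.σ_process k x).measurable i).comap_le
  · exact (hD.T_measurable k x i).comap_le

lemma sig_le (hD : D.IsModel α P) (S : Set (List ℕ ⊕ (ℕ × ℕ) ⊕ (ℕ × ℕ × ℕ))) :
    D.sig S ≤ ‹MeasurableSpace Ω› := iSup₂_le fun i _ => hD.source_le i

lemma indep_sig (hD : D.IsModel α P) {S T : Set (List ℕ ⊕ (ℕ × ℕ) ⊕ (ℕ × ℕ × ℕ))}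
    (h : Disjoint S T) : Indep (D.sig S) (D.sig T) P :=
  indep_iSup_of_disjoint hD.source_le hD.indep h

lemma ae_γ_pos (hD : D.IsModel α P) : ∀ᵐ ω ∂P, ∀ v y, 0 < D.γ v y ω := by
  rw [ae_all_iff]
  intro v
  filter_upwards [hD.γ_order v] with ω hω using hω.2

variable [IsProbabilityMeasure P]

/-- The law of `∑ (c γ) ^ α` over the children of one node. -/
lemma lintegral_expNeg_children (hD : D.IsModel α P) (hα_pos : 0 < α 0) (hα_mono : StrictMono α)
    {n : ℕ} {w : List ℕ} (hw : w.length = n) {c : ℝ≥0∞} (hc : c ≠ ∞) :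
    ∫⁻ ω, expNeg (∑' z, (c * D.weight ω w z) ^ α (n + 1)) ∂P = expNeg (c ^ α n) := by
  subst hw
  have hpos : 0 < α w.length := hα_pos.trans_le (hα_mono.monotone (Nat.zero_le _))
  rw [← lintegral_one_sub_expNeg_mul_rpow hpos (hα_mono (Nat.lt_succ_self w.length)) hc]
  exact (hD.γ_process w).lintegral_expNeg (g := fun s => (c * ENNReal.ofReal s) ^ α (w.length + 1))
    (by fun_prop)

omit [IsProbabilityMeasure P] in
lemma measurable_expNeg_descend (hD : D.IsModel α P) (v : List ℕ) (j : ℕ) (a : List ℕ → ℝ≥0∞)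
    (p : ℝ) : Measurable fun ω => expNeg (∑' l : List ℕ, if l.length = j then
      ∑' z, (a l * D.weight ω (l ++ v) z) ^ p else 0) := by
  refine measurable_expNeg.comp (Measurable.tsum fun l => ?_)
  by_cases hl : l.length = j
  · simp only [hl, if_true]
    exact Measurable.tsum fun z => ((ENNReal.measurable_ofReal.comp
      ((hD.γ_process (l ++ v)).measurable z)).const_mul _).pow_const _
  · simp only [hl, if_false]
    exact measurable_const

/-- Distinct nodes `l ++ v` carry independent point processes, and each contributes the factor
computed in `lintegral_expNeg_children`. -/
lemma lintegral_expNeg_descend (hD : D.IsModel α P) (hα_pos : 0 < α 0) (hα_mono : StrictMono α)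
    (v : List ℕ) (j : ℕ) {a : List ℕ → ℝ≥0∞} (ha : ∀ l, a l ≠ ∞) :
    ∫⁻ ω, expNeg (∑' l : List ℕ, if l.length = j then
      ∑' z, (a l * D.weight ω (l ++ v) z) ^ α (v.length + (j + 1)) else 0) ∂P =
    expNeg (∑' l : List ℕ, if l.length = j then a l ^ α (v.length + j) else 0) := by
  refine lintegral_expNeg_tsum hD.source_le hD.indep (fun l : List ℕ => {.inl (l ++ v)}) ?_
    (fun l ω => if l.length = j then
      ∑' z, (a l * D.weight ω (l ++ v) z) ^ α (v.length + (j + 1)) else 0) ?_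
    (fun l => if l.length = j then a l ^ α (v.length + j) else 0) ?_
  · intro l l' hne
    rw [Set.disjoint_singleton]
    intro h
    simp only [Sum.inl.injEq, List.append_cancel_right_eq] at h
    exact hne h
  · intro l
    by_cases hl : l.length = j
    · simp only [hl, if_true]
      have hz : ∀ z, Measurable[D.sig {.inl (l ++ v)}] fun ω' => D.weight ω' (l ++ v) z :=
        fun z => D.measurable_weight_sig z (Set.mem_singleton _)
      exact measurable_tsum_of fun z => ((hz z).const_mul _).pow_const _
    · simp only [hl, if_false]
      exact measurable_const
  · intro l
    split_ifs with hl
    · exact hD.lintegral_expNeg_children hα_pos hα_mono (by simp [hl, add_comm]) (ha l)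
    · simp

/-- The martingale property of the Laplace transforms of the sums over descendants. -/
lemma lintegral_mul_expNeg_descSum (hD : D.IsModel α P) (hα_pos : 0 < α 0) (hα_mono : StrictMono α)
    (v : List ℕ) (j : ℕ) {c : ℝ≥0∞} (hc : c ≠ ∞) {ψ : Ω → ℝ≥0∞}
    (hψ : Measurable[D.sig {i | ∃ w : List ℕ, i = .inl w ∧ w.length < v.length + j}] ψ) :
    ∫⁻ ω, ψ ω * expNeg (c ^ α (v.length + (j + 1)) *
        descSum (D.weight ω) (α (v.length + (j + 1))) v (j + 1)) ∂P =
      ∫⁻ ω, ψ ω * expNeg (c ^ α (v.length + j) *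
        descSum (D.weight ω) (α (v.length + j)) v j) ∂P := by
  have hpos : ∀ k, 0 < α k := fun k => hα_pos.trans_le (hα_mono.monotone (Nat.zero_le k))
  -- `S` determines the path products up to generation `j`; `T` contains the parameters that attach
  -- generation `j + 1`.
  set S : Set (List ℕ ⊕ (ℕ × ℕ) ⊕ (ℕ × ℕ × ℕ)) :=
    {i | ∃ w : List ℕ, i = .inl w ∧ w.length < v.length + j} with hS
  set T : Set (List ℕ ⊕ (ℕ × ℕ) ⊕ (ℕ × ℕ × ℕ)) :=
    {i | ∃ w : List ℕ, i = .inl w ∧ w.length = v.length + j} with hT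
  have hST : Disjoint S T := by
    rw [Set.disjoint_left]
    rintro i ⟨w, rfl, hw⟩ ⟨w', h, hw'⟩
    simp only [Sum.inl.injEq] at h
    subst h; omega
  let G : Ω × Ω → ℝ≥0∞ := fun q => ψ q.1 * expNeg (∑' l : List ℕ, if l.length = j then
    ∑' z, (c * pathProd (D.weight q.1) v l * D.weight q.2 (l ++ v) z) ^ α (v.length + (j + 1)) else 0)
  have hu : ∀ l : List ℕ, l.length = j →
      Measurable[D.sig S] fun ω => c * pathProd (D.weight ω) v l := fun l hl =>
    (@measurable_pathProd Ω (D.sig S) (fun w x ω => D.weight ω w x) v l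
        fun w x _ h => D.measurable_weight_sig x ⟨w, rfl, hl ▸ h⟩).const_mul c
  have hw : ∀ l : List ℕ, l.length = j → ∀ z, Measurable[D.sig T] fun ω => D.weight ω (l ++ v) z :=
    fun l hl z => D.measurable_weight_sig z ⟨l ++ v, rfl, by simp [hl, add_comm]⟩
  have hGm : Measurable[@Prod.instMeasurableSpace Ω Ω (D.sig S) (D.sig T)] G :=
    @measurable_mul_expNeg_descend Ω Ω (D.sig S) (D.sig T) ψ
      (fun ω l => c * pathProd (D.weight ω) v l) D.weight v j (α (v.length + (j + 1))) hψ hu hw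
  have e1 : ∀ ω, ψ ω * expNeg (c ^ α (v.length + (j + 1)) *
        descSum (D.weight ω) (α (v.length + (j + 1))) v (j + 1)) = G (ω, ω) := fun ω => by
    rw [descSum_succ' (hpos _).le]
  simp_rw [e1]
  rw [lintegral_diag_of_indep (hD.sig_le S) (hD.sig_le T) (hD.indep_sig hST) hGm]
  refine lintegral_congr fun ω => ?_
  refine (lintegral_const_mul (ψ ω) (hD.measurable_expNeg_descend v j
    (fun l => c * pathProd (D.weight ω) v l) (α (v.length + (j + 1))))).trans ?_
  congr 1
  rw [hD.lintegral_expNeg_descend hα_pos hα_mono v j (fun l =>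
    ENNReal.mul_ne_top hc (pathProd_ne_top (D.weight_ne_top ω) v l)), descSum,
    ← ENNReal.tsum_mul_left]
  congr 1
  refine tsum_congr fun l => ?_
  split_ifs
  · rw [ENNReal.mul_rpow_of_nonneg _ _ (hpos _).le]
  · simp

end IsModel

end KTreeData

lemma measurable_indicator_one_of {A : Type*} {_ : MeasurableSpace A} {s : Set A}
    (hs : MeasurableSet s) : Measurable (s.indicator (1 : A → ℝ≥0∞)) := measurable_one.indicator hs

lemma lintegral_indicator_one_mul {A : Type*} [MeasurableSpace A] {μ : Measure A} {s : Set A}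
    (hs : MeasurableSet s) (f : A → ℝ≥0∞) :
    ∫⁻ a, s.indicator (1 : A → ℝ≥0∞) a * f a ∂μ = ∫⁻ a in s, f a ∂μ := by
  rw [← lintegral_indicator hs]
  refine lintegral_congr fun a => ?_
  by_cases ha : a ∈ s <;> simp [ha]

lemma one_sub_inv_one_add_le (y : ℝ≥0∞) : 1 - (1 + y)⁻¹ ≤ y := by
  by_cases hy : y = ∞
  · simp [hy]
  rw [tsub_le_iff_left]
  have h0 : (1 + y) ≠ 0 := by simp
  have ht : (1 + y) ≠ ∞ := by simp [hy]
  calc (1 : ℝ≥0∞) = (1 + y)⁻¹ * (1 + y) := (ENNReal.inv_mul_cancel h0 ht).symm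
    _ = (1 + y)⁻¹ + (1 + y)⁻¹ * y := by ring
    _ ≤ (1 + y)⁻¹ + 1 * y := by
        gcongr
        exact ENNReal.inv_le_one.2 le_self_add
    _ = _ := by rw [one_mul]

lemma tendsto_const_rpow {c : ℝ≥0∞} (h0 : c ≠ 0) (hc : c ≠ ∞) {u : ℕ → ℝ}
    (hu : Tendsto u atTop (𝓝 1)) : Tendsto (fun n => c ^ u n) atTop (𝓝 c) := by
  have hk : 0 < c.toReal := ENNReal.toReal_pos h0 hc
  have h1 : Tendsto (fun n => c.toReal ^ u n) atTop (𝓝 (c.toReal ^ (1 : ℝ))) :=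
    (Real.continuous_const_rpow hk.ne').continuousAt.tendsto.comp hu
  have h2 := ENNReal.tendsto_ofReal h1
  rw [Real.rpow_one, ENNReal.ofReal_toReal hc] at h2
  refine h2.congr fun n => ?_
  rw [← ENNReal.ofReal_rpow_of_pos hk, ENNReal.ofReal_toReal hc]

/-! ### Killing rates. -/

/-- The rate at which a node is killed, if its children are killed at the rates `U`. -/
noncomputable def killRate (g : List ℕ → ℕ → ℝ≥0∞) (U : List ℕ → ℝ≥0∞) (v : List ℕ) : ℝ≥0∞ :=
  ∑' x, (1 - (1 + g v x * U (x :: v))⁻¹)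

lemma killRate_le (g : List ℕ → ℕ → ℝ≥0∞) (U : List ℕ → ℝ≥0∞) (v : List ℕ) :
    killRate g U v ≤ ∑' x, g v x * U (x :: v) :=
  ENNReal.tsum_le_tsum fun _ => one_sub_inv_one_add_le _

lemma killRate_mono (g : List ℕ → ℕ → ℝ≥0∞) {U V : List ℕ → ℝ≥0∞} {v : List ℕ}
    (h : ∀ x, U (x :: v) ≤ V (x :: v)) : killRate g U v ≤ killRate g V v := by
  refine ENNReal.tsum_le_tsum fun x => tsub_le_tsub_left (ENNReal.inv_le_inv.2 ?_) _
  gcongr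
  exact h x

lemma measurable_killRate {Ω : Type*} {_ : MeasurableSpace Ω} {g : Ω → List ℕ → ℕ → ℝ≥0∞}
    {U : Ω → List ℕ → ℝ≥0∞} {v : List ℕ} (hg : ∀ x, Measurable fun ω => g ω v x)
    (hU : ∀ x, Measurable fun ω => U ω (x :: v)) :
    Measurable fun ω => killRate (g ω) (U ω) v :=
  measurable_tsum_of fun x =>
    measurable_const.sub (((hg x).mul (hU x)).const_add 1).inv

/-! ### Existence, law and finiteness of the limits W. -/

namespace KTreeData

namespace IsModel

variable {Ω : Type*} {D : KTreeData Ω} [MeasurableSpace Ω] {P : Measure Ω} {α : ℕ → ℝ}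

lemma measurable_weight (hD : D.IsModel α P) (v : List ℕ) (x : ℕ) :
    Measurable fun ω => D.weight ω v x :=
  ENNReal.measurable_ofReal.comp ((hD.γ_process v).measurable x)

lemma measurable_descSum (hD : D.IsModel α P) (p : ℝ) (v : List ℕ) (j : ℕ) :
    Measurable fun ω => descSum (D.weight ω) p v j :=
  _root_.measurable_descSum (g := fun w x ω => D.weight ω w x) p j
    fun w x _ _ => hD.measurable_weight w x

lemma measurable_limW (hD : D.IsModel α P) (v : List ℕ) : Measurable (D.limW α v) :=
  measurable_limsup_of fun _ => hD.measurable_descSum _ _ _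

variable [IsProbabilityMeasure P]

lemma lintegral_expNeg_descSum (hD : D.IsModel α P) (hα_pos : 0 < α 0) (hα_mono : StrictMono α)
    (v : List ℕ) (j : ℕ) {c : ℝ≥0∞} (hc : c ≠ ∞) :
    ∫⁻ ω, expNeg (c ^ α (v.length + j) * descSum (D.weight ω) (α (v.length + j)) v j) ∂P =
      expNeg (c ^ α v.length) := by
  induction j with
  | zero => simp [descSum_zero]
  | succ j ih =>
    have := hD.lintegral_mul_expNeg_descSum hα_pos hα_mono v j hc (ψ := fun _ => 1)
      measurable_const
    simp only [one_mul] at this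
    rw [this, ih]

/-- The exponentials of the negative sums form a bounded martingale for the filtration by
generations. This gives convergence in `[0, ∞]` only; finiteness is a matter of the Laplace
transform of the limit. -/
lemma ae_tendsto_descSum (hD : D.IsModel α P) (hα_pos : 0 < α 0) (hα_mono : StrictMono α) :
    ∀ᵐ ω ∂P, ∀ v, Tendsto (fun j => descSum (D.weight ω) (α (v.length + j)) v j) atTop
      (𝓝 (D.limW α v ω)) := by
  rw [ae_all_iff]
  intro v
  have hmono : Monotone fun j : ℕ => D.sig {i | ∃ w : List ℕ, i = .inl w ∧ w.length < v.length + j} := by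
    intro i j hij
    refine D.sig_mono ?_
    rintro _ ⟨w, rfl, hw⟩
    exact ⟨w, rfl, by omega⟩
  let ℱ : Filtration ℕ ‹MeasurableSpace Ω› :=
    { seq := fun j => D.sig {i | ∃ w : List ℕ, i = .inl w ∧ w.length < v.length + j}
      mono' := hmono
      le' := fun j => hD.sig_le _ }
  refine ae_tendsto_of_expNeg_submartingale ℱ
    (fun j ω => descSum (D.weight ω) (α (v.length + j)) v j) (fun j => ?_) fun j s hs => ?_
  · exact @_root_.measurable_descSum Ω (ℱ j) (fun w x ω => D.weight ω w x) v _ j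
      fun w x _ h => D.measurable_weight_sig x ⟨w, rfl, h⟩
  · have hψ : Measurable[ℱ j] (s.indicator (1 : Ω → ℝ≥0∞)) := measurable_indicator_one_of hs
    have := hD.lintegral_mul_expNeg_descSum hα_pos hα_mono v j ENNReal.one_ne_top hψ
    simp only [ENNReal.one_rpow, one_mul] at this
    rw [lintegral_indicator_one_mul (ℱ.le j s hs), lintegral_indicator_one_mul (ℱ.le j s hs)] at this
    exact this.ge

/-- The Laplace transform of the limits `W`. -/
lemma lintegral_expNeg_limW (hD : D.IsModel α P) (hα_pos : 0 < α 0) (hα_mono : StrictMono α)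
    (hα_lim : Tendsto α atTop (𝓝 1)) (v : List ℕ) {c : ℝ≥0∞} (h0 : c ≠ 0) (hc : c ≠ ∞) :
    ∫⁻ ω, expNeg (c * D.limW α v ω) ∂P = expNeg (c ^ α v.length) := by
  -- The factors `c ^ α (v.length + j)` tend to `c`, while the Laplace transforms on the left do not
  -- depend on `j`.
  have h1 : Tendsto (fun j => ∫⁻ ω, expNeg (c ^ α (v.length + j) *
      descSum (D.weight ω) (α (v.length + j)) v j) ∂P) atTop
      (𝓝 (∫⁻ ω, expNeg (c * D.limW α v ω) ∂P)) := by
    refine tendsto_lintegral_expNeg (fun j => (hD.measurable_descSum _ _ _).const_mul _) ?_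
    filter_upwards [hD.ae_tendsto_descSum hα_pos hα_mono] with ω hω
    have h2 : Tendsto (fun j => α (v.length + j)) atTop (𝓝 1) := by
      have := (tendsto_add_atTop_iff_nat v.length).2 hα_lim
      simpa [add_comm] using this
    have h3 : Tendsto (fun j => c ^ α (v.length + j)) atTop (𝓝 c) := tendsto_const_rpow h0 hc h2
    exact ENNReal.Tendsto.mul h3 (.inl h0) (hω v) (.inr hc)
  refine tendsto_nhds_unique h1 ?_
  simp_rw [hD.lintegral_expNeg_descSum hα_pos hα_mono v _ hc]
  exact tendsto_const_nhds

lemma tendsto_inv_natCast_rpow {a : ℝ} (ha : 0 < a) :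
    Tendsto (fun n : ℕ => expNeg ((((n : ℝ≥0∞) + 1)⁻¹) ^ a)) atTop (𝓝 1) := by
  have h := tendsto_inv_natCast_mul ENNReal.one_ne_top
  simp only [mul_one] at h
  have h2 := (ENNReal.continuous_rpow_const (y := a)).tendsto 0 |>.comp h
  have h3 := (continuous_expNeg.tendsto _).comp h2
  simpa [ENNReal.zero_rpow_of_pos ha, Function.comp_def] using h3

lemma ae_limW_lt_top (hD : D.IsModel α P) (hα_pos : 0 < α 0) (hα_mono : StrictMono α)
    (hα_lim : Tendsto α atTop (𝓝 1)) : ∀ᵐ ω ∂P, ∀ v, D.limW α v ω < ∞ := by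
  rw [ae_all_iff]
  intro v
  have hpos : ∀ k, 0 < α k := fun k => hα_pos.trans_le (hα_mono.monotone (Nat.zero_le k))
  refine ae_lt_top_of_tendsto_lintegral_expNeg (hD.measurable_limW v)
    inv_natCast_add_one_ne_zero ?_
  simp_rw [fun n => hD.lintegral_expNeg_limW hα_pos hα_mono hα_lim v
    (inv_natCast_add_one_ne_zero n) (inv_natCast_add_one_ne_top n)]
  exact tendsto_inv_natCast_rpow (hpos _)

/-- The sum of the powers with exponent below `1` is finite by its Laplace transform, hence so is
the sum of the products themselves. This will keep the clocks finite. -/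
lemma ae_descSum_one_ne_top (hD : D.IsModel α P) (hα_pos : 0 < α 0) (hα_mono : StrictMono α)
    (hα_lt : ∀ k, α k < 1) : ∀ᵐ ω ∂P, ∀ v j, descSum (D.weight ω) 1 v j ≠ ∞ := by
  simp_rw [ae_all_iff]
  intro v j
  have hpos : ∀ k, 0 < α k := fun k => hα_pos.trans_le (hα_mono.monotone (Nat.zero_le k))
  have h : ∀ᵐ ω ∂P, descSum (D.weight ω) (α (v.length + j)) v j < ∞ := by
    refine ae_lt_top_of_tendsto_lintegral_expNeg (hD.measurable_descSum _ v j)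
      (c := fun n => (((n : ℝ≥0∞) + 1)⁻¹) ^ α (v.length + j)) ?_ ?_
    · intro n
      simp [ENNReal.rpow_eq_zero_iff]
    simp_rw [fun n => hD.lintegral_expNeg_descSum hα_pos hα_mono v j (inv_natCast_add_one_ne_top n)]
    exact tendsto_inv_natCast_rpow (hpos _)
  filter_upwards [h] with ω hω
  exact descSum_one_ne_top (hpos _) (hα_lt _).le hω.ne

/-- The values of `W` at the children of a node. -/
lemma ae_tsum_weight_mul_limW_le (hD : D.IsModel α P) (hα_pos : 0 < α 0) (hα_mono : StrictMono α)
    (hα_lim : Tendsto α atTop (𝓝 1)) :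
    ∀ᵐ ω ∂P, ∀ v, ∑' x, D.weight ω v x * D.limW α (x :: v) ω ≤ D.limW α v ω := by
  filter_upwards [hD.ae_tendsto_descSum hα_pos hα_mono, hD.ae_γ_pos,
    hD.ae_limW_lt_top hα_pos hα_mono hα_lim] with ω hω hpos hfin v
  have hα0 : ∀ k, 0 < α k := fun k => hα_pos.trans_le (hα_mono.monotone (Nat.zero_le k))
  -- Only finitely many children can be taken to the limit termwise, as in Fatou's lemma; the
  -- resulting inequality is all that is needed.
  rw [ENNReal.tsum_eq_iSup_sum]
  refine iSup_le fun F => ?_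
  have hs := (tendsto_add_atTop_iff_nat 1).2 (hω v)
  have hx : ∀ x, Tendsto (fun j => D.weight ω v x ^ α (v.length + (j + 1)) *
      descSum (D.weight ω) (α (v.length + (j + 1))) (x :: v) j) atTop
      (𝓝 (D.weight ω v x * D.limW α (x :: v) ω)) := by
    intro x
    have h0 : D.weight ω v x ≠ 0 := by simpa [weight] using hpos v x
    have h1 := hω (x :: v)
    have e : ∀ j, α ((x :: v).length + j) = α (v.length + (j + 1)) := fun j => by
      congr 1; simp; omega
    simp_rw [e] at h1
    have h2 : Tendsto (fun j => α (v.length + (j + 1))) atTop (𝓝 1) := by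
      have := (tendsto_add_atTop_iff_nat (v.length + 1)).2 hα_lim
      refine this.congr fun j => ?_
      congr 1; omega
    have h3 : Tendsto (fun j => D.weight ω v x ^ α (v.length + (j + 1))) atTop
        (𝓝 (D.weight ω v x)) := tendsto_const_rpow h0 (D.weight_ne_top ω v x) h2
    exact ENNReal.Tendsto.mul h3 (.inl h0) h1 (.inr (D.weight_ne_top ω v x))
  refine le_of_tendsto_of_tendsto' (tendsto_finsetSum F fun x _ => hx x) hs fun j => ?_
  rw [descSum_succ (hα0 _).le]
  exact ENNReal.sum_le_tsum F

omit [IsProbabilityMeasure P] in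
lemma ae_W_eq_limW (hD : D.IsModel α P) : ∀ᵐ ω ∂P, ∀ v, D.W α v ω = D.limW α v ω := by
  filter_upwards [hD.ae_γ_pos] with ω hω v
  rw [W, limW, ← limsup_nat_add _ v.length]
  simp_rw [add_comm _ v.length, D.cylinderSum_eq_descSum hω]

lemma ae_tendsto_cylinderSum (hD : D.IsModel α P) (hα_pos : 0 < α 0) (hα_mono : StrictMono α)
    (hα_lim : Tendsto α atTop (𝓝 1)) : ∀ᵐ ω ∂P, ∀ x : List ℕ, D.W α x ω < ∞ ∧
      Tendsto (fun n => D.cylinderSum α x n ω) atTop (𝓝 (D.W α x ω)) := by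
  filter_upwards [hD.ae_W_eq_limW, hD.ae_tendsto_descSum hα_pos hα_mono, hD.ae_γ_pos,
    hD.ae_limW_lt_top hα_pos hα_mono hα_lim] with ω h1 h2 h3 h4 x
  rw [h1]
  refine ⟨h4 x, (tendsto_add_atTop_iff_nat x.length).1 ?_⟩
  simp_rw [add_comm _ x.length, D.cylinderSum_eq_descSum h3]
  exact h2 x

end IsModel

end KTreeData

/-! ### Pure jump functions -/

section Jump

variable {J : Type*} {s a : J → ℝ≥0∞}

/-- The sum of the jumps `a j` at the times `s j ≤ t`. -/
noncomputable def jumpSum (s a : J → ℝ≥0∞) (t : ℝ≥0∞) : ℝ≥0∞ :=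
  ∑' j, if s j ≤ t then a j else 0

/-- The sum of the jumps `a j` at the times `s j < t`. -/
noncomputable def leftJumpSum (s a : J → ℝ≥0∞) (t : ℝ≥0∞) : ℝ≥0∞ :=
  ∑' j, if s j < t then a j else 0

lemma jumpSum_mono : Monotone (jumpSum s a) := fun t t' h => by
  refine ENNReal.tsum_le_tsum fun j => ?_
  by_cases h1 : s j ≤ t
  · simp [h1, h1.trans h]
  · simp [h1]

lemma jumpSum_le_leftJumpSum {t t' : ℝ≥0∞} (h : t < t') : jumpSum s a t ≤ leftJumpSum s a t' := by
  refine ENNReal.tsum_le_tsum fun j => ?_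
  by_cases h1 : s j ≤ t
  · simp [h1, h1.trans_lt h]
  · simp [h1]

/-- There is no time below `0`, so the left limit takes its default value. -/
lemma leftLim_jumpSum_zero : Function.leftLim (jumpSum s a) 0 = jumpSum s a 0 := by
  exact leftLim_eq_of_eq_bot _ (by simp)

lemma leftLim_jumpSum {t : ℝ≥0∞} (ht : t ≠ 0) :
    Function.leftLim (jumpSum s a) t = leftJumpSum s a t := by
  have : (𝓝[<] t).NeBot := nhdsLT_neBot_of_exists_lt ⟨0, pos_iff_ne_zero.2 ht⟩
  rw [jumpSum_mono.leftLim_eq_sSup]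
  refine le_antisymm (sSup_le ?_) ?_
  · rintro _ ⟨r, hr, rfl⟩
    exact jumpSum_le_leftJumpSum hr
  · rw [leftJumpSum, ENNReal.tsum_eq_iSup_sum]
    refine iSup_le fun F => ?_
    classical
    -- The finitely many jump times of `F` below `t` have a supremum `r < t`, and `jumpSum` at `r`
    -- already contains their jumps.
    let r := (F.filter fun j => s j < t).sup s
    have hr : r < t := by
      rw [Finset.sup_lt_iff (pos_iff_ne_zero.2 ht)]
      exact fun j hj => (Finset.mem_filter.1 hj).2
    refine le_trans ?_ (le_sSup ⟨r, hr, rfl⟩)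
    refine le_trans (Finset.sum_le_sum fun j hj => ?_) (ENNReal.sum_le_tsum F)
    by_cases h1 : s j < t
    · have : s j ≤ r := Finset.le_sup (Finset.mem_filter.2 ⟨hj, h1⟩)
      simp [h1, this]
    · simp [h1]

lemma jumpSum_eq_leftJumpSum_add (hs : Function.Injective s) (j : J) :
    jumpSum s a (s j) = leftJumpSum s a (s j) + a j := by
  classical
  have : a j = ∑' i, if i = j then a i else 0 := by rw [tsum_ite_eq]
  rw [this, jumpSum, leftJumpSum, ← ENNReal.tsum_add]
  refine tsum_congr fun i => ?_
  by_cases hij : i = j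
  · simp [hij]
  · have : s i ≠ s j := fun h => hij (hs h)
    by_cases h : s i < s j
    · simp [h, h.le, hij]
    · have h' : ¬ s i ≤ s j := fun h' => h (lt_of_le_of_ne h' this)
      simp [h, h', hij]

lemma jumpSum_eq_add {A B : ℝ≥0∞} (hAB : A ≤ B) :
    jumpSum s a B = jumpSum s a A + ∑' j, if A < s j ∧ s j ≤ B then a j else 0 := by
  rw [jumpSum, jumpSum, ← ENNReal.tsum_add]
  refine tsum_congr fun j => ?_
  by_cases h : s j ≤ A
  · simp [h, h.trans hAB, h.not_gt]
  · have h' := not_le.1 h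
    by_cases h2 : s j ≤ B <;> simp [h, h', h2]

lemma jumpSum_zero (hs : ∀ j, s j ≠ 0) : jumpSum s a 0 = 0 := by
  simp [jumpSum, hs]

/-- The integral of a function that is constant on the intervals that a pure jump function skips. -/
lemma lintegral_Ico_jumpSum [Countable J] (hs : Function.Injective s) {A B : ℝ≥0∞} (hAB : A ≤ B)
    (hB : jumpSum s a B ≠ ∞) {f : ℝ≥0∞ → ℝ≥0∞} {c : J → ℝ≥0∞}
    (hf : ∀ j, ∀ u ∈ Set.Ico (leftJumpSum s a (s j)) (jumpSum s a (s j)), f u = c j) :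
    ∫⁻ u in Set.Ico (jumpSum s a A) (jumpSum s a B), f u ∂leb =
      ∑' j, if A < s j ∧ s j ≤ B then c j * a j else 0 := by
  classical
  let I : J → Set ℝ≥0∞ := fun j => if A < s j ∧ s j ≤ B then
    Set.Ico (leftJumpSum s a (s j)) (jumpSum s a (s j)) else ∅
  have hIm : ∀ j, MeasurableSet (I j) := fun j => by
    simp only [I]; split_ifs
    · exact measurableSet_Ico
    · exact MeasurableSet.empty
  have hId : Pairwise (Function.onFun Disjoint I) := by
    have key : ∀ i j, s i < s j → Disjoint (I i) (I j) := by
      intro i j hij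
      rw [Set.disjoint_left]
      intro u hi hj
      simp only [I] at hi hj
      split_ifs at hi hj
      · exact absurd (hi.2.trans_le ((jumpSum_le_leftJumpSum hij).trans hj.1)) (lt_irrefl _)
      all_goals simp_all
    intro i j hij
    rcases lt_or_gt_of_ne (fun h => hij (hs h)) with h | h
    · exact key i j h
    · exact (key j i h).symm
  have hfin : ∀ j, s j ≤ B → jumpSum s a (s j) ≠ ∞ := fun j hj =>
    ne_top_of_le_ne_top hB (jumpSum_mono hj)
  have hIleb : ∀ j, leb (I j) = if A < s j ∧ s j ≤ B then a j else 0 := fun j => by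
    simp only [I]
    split_ifs with h
    · have h1 := hfin j h.2
      rw [leb_Ico h1, jumpSum_eq_leftJumpSum_add hs]
      refine ENNReal.add_sub_cancel_left ?_
      rw [jumpSum_eq_leftJumpSum_add hs] at h1
      exact (ENNReal.add_ne_top.1 h1).1
    · simp
  have hsub : (⋃ j, I j) ⊆ Set.Ico (jumpSum s a A) (jumpSum s a B) := by
    refine Set.iUnion_subset fun j u hu => ?_
    simp only [I] at hu
    split_ifs at hu with h
    · exact ⟨(jumpSum_le_leftJumpSum h.1).trans hu.1, hu.2.trans_le (jumpSum_mono h.2)⟩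
    · exact absurd hu (Set.notMem_empty _)
  have hA : jumpSum s a A ≠ ∞ := ne_top_of_le_ne_top hB (jumpSum_mono hAB)
  -- A pure jump function has no continuous part: the lengths of the skipped intervals add up to the
  -- length of the image window, so the intervals exhaust it up to a null set.
  have hmeas : leb (⋃ j, I j) = leb (Set.Ico (jumpSum s a A) (jumpSum s a B)) := by
    rw [measure_iUnion hId hIm, leb_Ico hB, jumpSum_eq_add hAB, ENNReal.add_sub_cancel_left hA]
    exact tsum_congr hIleb
  have hae : (⋃ j, I j : Set ℝ≥0∞) =ᵐ[leb] Set.Ico (jumpSum s a A) (jumpSum s a B) := by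
    refine ae_eq_of_subset_of_measure_ge hsub hmeas.ge (MeasurableSet.iUnion hIm).nullMeasurableSet ?_
    rw [leb_Ico hB]
    exact ne_top_of_le_ne_top hB tsub_le_self
  rw [← setLIntegral_congr hae, lintegral_iUnion hIm hId]
  refine tsum_congr fun j => ?_
  have h1 : ∫⁻ u in I j, f u ∂leb = ∫⁻ u in I j, c j ∂leb := by
    refine setLIntegral_congr_fun (hIm j) fun u hu => ?_
    simp only [I] at hu
    split_ifs at hu with h
    · exact hf j u hu
    · exact absurd hu (Set.notMem_empty _)
  rw [h1, setLIntegral_const, hIleb]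
  split_ifs <;> simp

/-- Before `s j` the function stays below its left limit, which is at most `u`; at `s j` it exceeds
`u`. -/
lemma clockInv_jumpSum {j : J} {u : ℝ≥0∞}
    (hu : u ∈ Set.Ico (leftJumpSum s a (s j)) (jumpSum s a (s j))) :
    KTreeData.clockInv (jumpSum s a) u = s j := by
  refine le_antisymm (sInf_le hu.2) (le_sInf fun r hr => ?_)
  by_contra h
  exact absurd (hr.trans_le ((jumpSum_le_leftJumpSum (not_le.1 h)).trans hu.1)) (lt_irrefl _)

lemma eq_of_mem_Ico_jumpSum (hs : Function.Injective s) {i j : J} {u : ℝ≥0∞}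
    (hi : u ∈ Set.Ico (leftJumpSum s a (s i)) (jumpSum s a (s i)))
    (hj : u ∈ Set.Ico (leftJumpSum s a (s j)) (jumpSum s a (s j))) : i = j :=
  hs ((clockInv_jumpSum hi).symm.trans (clockInv_jumpSum hj))

end Jump

/-! ### Paths of the K processes -/

/-- Extension of a function of the nodes to all states by `0`. -/
noncomputable def onStates (U : List ℕ → ℝ≥0∞) (l : List ℕ∞) : ℝ≥0∞ :=
  open Classical in if ⊤ ∈ l then 0 else U (l.map ENat.toNat)

namespace KTreeData

variable {Ω : Type*} (D : KTreeData Ω)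

/-- The marks of level `k + 1` as times in `[0, ∞]`. -/
noncomputable def mark (k : ℕ) (ω : Ω) (j : ℕ × ℕ) : ℝ≥0∞ := ENNReal.ofReal (D.σ k j.1 j.2 ω)

/-- The jumps of a clock. -/
noncomputable def jump (k : ℕ) (f : List ℕ → ℕ → ℝ≥0∞) (X : ℝ≥0∞ → List ℕ∞) (ω : Ω) (j : ℕ × ℕ) :
    ℝ≥0∞ :=
  extendZero f (X (D.mark k ω j)) j.1 * ENNReal.ofReal (D.T k j.1 j.2 ω)

lemma clockAlong_eq (k : ℕ) (f : List ℕ → ℕ → ℝ≥0∞) (X : ℝ≥0∞ → List ℕ∞) (ω : Ω) :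
    D.clockAlong k f X ω = jumpSum (D.mark k ω) (D.jump k f X ω) := by
  ext t
  rw [jumpSum, ENNReal.tsum_prod']
  rfl

lemma clock_eq (k : ℕ) (ω : Ω) :
    D.clock k ω = jumpSum (D.mark k ω) (D.jump k (D.weight ω) (D.X k ω) ω) :=
  D.clockAlong_eq _ _ _ _

lemma clock_mono (k : ℕ) (ω : Ω) : Monotone (D.clock k ω) := D.clock_eq k ω ▸ jumpSum_mono

lemma length_X (k : ℕ) (ω : Ω) (t : ℝ≥0∞) : (D.X k ω t).length = k := by
  induction k generalizing t with
  | zero => rfl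
  | succ k ih => simp [X, ih]

/-- The marks of all levels are positive and distinct. -/
def SimpleMarks (ω : Ω) : Prop := ∀ k, Function.Injective (D.mark k ω) ∧ ∀ j, D.mark k ω j ≠ 0

variable {D}

lemma X_succ_of_mem {ω : Ω} (hω : D.SimpleMarks ω) {k : ℕ} {j : ℕ × ℕ} {u : ℝ≥0∞}
    (hu : u ∈ Set.Ico (leftJumpSum (D.mark k ω) (D.jump k (D.weight ω) (D.X k ω) ω) (D.mark k ω j))
      (jumpSum (D.mark k ω) (D.jump k (D.weight ω) (D.X k ω) ω) (D.mark k ω j))) :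
    D.X (k + 1) ω u = (j.1 : ℕ∞) :: D.X k ω (D.mark k ω j) := by
  have e : D.clockAlong k (fun v y => ENNReal.ofReal (D.γ v y ω)) (D.X k ω) ω =
    jumpSum (D.mark k ω) (D.jump k (D.weight ω) (D.X k ω) ω) := D.clock_eq k ω
  rw [X]
  simp only [e]
  rw [clockInv_jumpSum hu]
  congr 1
  -- The skipped intervals are disjoint, so `j.1` is the only label over which the infimum runs.
  refine le_antisymm (iInf₂_le_of_le j.1 ⟨j.2, ?_⟩ le_rfl) (le_iInf₂ ?_)
  · have h := leftLim_jumpSum (s := D.mark k ω) (a := D.jump k (D.weight ω) (D.X k ω) ω)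
      ((hω k).2 j)
    exact ⟨h.le.trans hu.1, hu.2⟩
  · rintro x ⟨i, h1, h2⟩
    have h := leftLim_jumpSum (s := D.mark k ω) (a := D.jump k (D.weight ω) (D.X k ω) ω)
      ((hω k).2 (x, i))
    have := eq_of_mem_Ico_jumpSum (hω k).1 (i := (x, i)) (j := j) ⟨h.ge.trans h1, h2⟩ hu
    rw [← this]

/-- The occupation times of `X (k + 1)`. -/
lemma lintegral_onStates_X_succ {ω : Ω} (hω : D.SimpleMarks ω) {k : ℕ} {A B : ℝ≥0∞} (hAB : A ≤ B)
    (hB : D.clock k ω B ≠ ∞) (U : List ℕ → ℝ≥0∞) :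
    ∫⁻ u in Set.Ico (D.clock k ω A) (D.clock k ω B), onStates U (D.X (k + 1) ω u) ∂leb =
      ∑' j, if A < D.mark k ω j ∧ D.mark k ω j ≤ B then
        D.jump k (fun v y => D.weight ω v y * U (y :: v)) (D.X k ω) ω j else 0 := by
  rw [clock_eq] at hB ⊢
  rw [lintegral_Ico_jumpSum (hω k).1 hAB hB
    (c := fun j => onStates U ((j.1 : ℕ∞) :: D.X k ω (D.mark k ω j)))
    fun j u hu => by rw [X_succ_of_mem hω hu]]
  refine tsum_congr fun j => ?_
  congr 1
  simp only [jump, extendZero, onStates]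
  by_cases h : ⊤ ∈ D.X k ω (D.mark k ω j)
  · simp [h]
  · have h' : (⊤ : ℕ∞) ∉ (j.1 : ℕ∞) :: D.X k ω (D.mark k ω j) := by
      simp [h, eq_comm]
    simp only [h, h', if_false, List.map_cons, ENat.toNat_natCast]
    ring

/-- The process `X (k + 1)` spends no time in infinite states. -/
lemma leb_top_mem_X_succ {ω : Ω} (hω : D.SimpleMarks ω) {k : ℕ} {B : ℝ≥0∞}
    (hB : D.clock k ω B ≠ ∞) :
    ∫⁻ u in Set.Ico 0 (D.clock k ω B),
      (open Classical in if ⊤ ∈ D.X (k + 1) ω u then 1 else 0) ∂leb = 0 := by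
  classical
  have h0 : D.clock k ω 0 = 0 := by rw [clock_eq, jumpSum_zero (hω k).2]
  rw [clock_eq] at hB
  have key := lintegral_Ico_jumpSum (hω k).1 zero_le hB
    (f := fun u => if ⊤ ∈ D.X (k + 1) ω u then 1 else 0)
    (c := fun j => if ⊤ ∈ (j.1 : ℕ∞) :: D.X k ω (D.mark k ω j) then 1 else 0)
    fun j u hu => by rw [X_succ_of_mem hω hu]
  rw [← clock_eq, h0] at key
  rw [key]
  simp only [ENNReal.tsum_eq_zero]
  intro j
  simp only [jump, extendZero]
  by_cases h : ⊤ ∈ D.X k ω (D.mark k ω j)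
  · simp [h]
  · have h' : (⊤ : ℕ∞) ∉ (j.1 : ℕ∞) :: D.X k ω (D.mark k ω j) := by
      simp [h, eq_comm]
    simp [h']

end KTreeData

/-! ### Measurability -/

instance : MeasurableSpace (List ℕ∞) := ⊤

instance : DiscreteMeasurableSpace (List ℕ∞) := ⟨fun _ => trivial⟩

/-- As `L` takes countably many values, measurability can be checked with its value frozen. -/
lemma measurable_comp_countable {A B : Type*} {_ : MeasurableSpace A} [MeasurableSpace B]
    [Countable B] [DiscreteMeasurableSpace B] {F : A → B → ℝ≥0∞} {L : A → B} (hL : Measurable L)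
    (hF : ∀ b, (∃ a, L a = b) → Measurable fun a => F a b) : Measurable fun a => F a (L a) := by
  intro S hS
  have : (fun a => F a (L a)) ⁻¹' S =
      ⋃ b ∈ Set.range L, L ⁻¹' {b} ∩ (fun a => F a b) ⁻¹' S := by
    ext a
    simp only [Set.mem_preimage, Set.mem_range, Set.iUnion_exists, Set.iUnion_iUnion_eq', Set.mem_iUnion,
      Set.mem_inter_iff, Set.mem_singleton_iff]
    exact ⟨fun h => ⟨a, rfl, h⟩, fun ⟨i, h, h'⟩ => h ▸ h'⟩
  rw [this]
  exact MeasurableSet.biUnion (Set.to_countable _) fun b hb =>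
    (hL (measurableSet_singleton b)).inter (hF b hb hS)

lemma measurable_onStates {A : Type*} {_ : MeasurableSpace A} {U : A → List ℕ → ℝ≥0∞} {k : ℕ}
    {L : A → List ℕ∞} (hL : Measurable L) (hk : ∀ a, (L a).length = k)
    (hU : ∀ v : List ℕ, v.length = k → Measurable fun a => U a v) :
    Measurable fun a => onStates (U a) (L a) := by
  refine measurable_comp_countable hL fun l ⟨a, ha⟩ => ?_
  unfold onStates
  split_ifs
  · exact measurable_const
  · exact hU _ (by rw [List.length_map, ← ha, hk])

lemma measurable_extendZero {A : Type*} {_ : MeasurableSpace A} {f : A → List ℕ → ℕ → ℝ≥0∞} {k : ℕ}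
    {L : A → List ℕ∞} (hL : Measurable L) (hk : ∀ a, (L a).length = k) (x : ℕ)
    (hf : ∀ v : List ℕ, v.length = k → Measurable fun a => f a v x) :
    Measurable fun a => KTreeData.extendZero (f a) (L a) x :=
  measurable_onStates (U := fun a v => f a v x) hL hk hf

/-- By monotonicity, the inverse at `t` is below `c` exactly if the clock exceeds `t` at some
nonnegative rational time below `c`. -/
lemma measurable_clockInv {A : Type*} {_ : MeasurableSpace A} {Ξ : A → ℝ≥0∞ → ℝ≥0∞}
    (hm : ∀ a, Monotone (Ξ a)) (hΞ : Measurable fun p : A × ℝ≥0∞ => Ξ p.1 p.2) :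
    Measurable fun p : A × ℝ≥0∞ => KTreeData.clockInv (Ξ p.1) p.2 := by
  refine measurable_of_Iio fun c => ?_
  have : (fun p : A × ℝ≥0∞ => KTreeData.clockInv (Ξ p.1) p.2) ⁻¹' Set.Iio c =
      ⋃ (q : ℚ) (_ : ((Real.toNNReal q : ℝ≥0) : ℝ≥0∞) < c),
        {p | p.2 < Ξ p.1 ((Real.toNNReal q : ℝ≥0) : ℝ≥0∞)} := by
    ext ⟨a, t⟩
    simp only [KTreeData.clockInv, Set.mem_preimage, Set.mem_Iio, sInf_lt_iff, Set.mem_ofPred_eq,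
      Set.mem_iUnion, exists_prop]
    constructor
    · rintro ⟨r, hr, hrc⟩
      obtain ⟨q, -, h1, h2⟩ := ENNReal.lt_iff_exists_rat_btwn.1 hrc
      exact ⟨q, h2, hr.trans_le (hm a h1.le)⟩
    · rintro ⟨q, h1, h2⟩
      exact ⟨_, h2, h1⟩
  rw [this]
  refine MeasurableSet.iUnion fun q => MeasurableSet.iUnion fun _ => ?_
  exact measurableSet_lt measurable_snd (hΞ.comp (measurable_fst.prodMk measurable_const))

namespace KTreeData

variable {Ω : Type*} [MeasurableSpace Ω] {D : KTreeData Ω} {k : ℕ}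

lemma measurable_mark (hσ : ∀ x i, Measurable (D.σ k x i)) (j : ℕ × ℕ) :
    Measurable fun ω => D.mark k ω j := ENNReal.measurable_ofReal.comp (hσ _ _)

lemma measurable_jump {f : Ω → List ℕ → ℕ → ℝ≥0∞} {X : Ω → ℝ≥0∞ → List ℕ∞}
    (hf : ∀ v : List ℕ, v.length = k → ∀ y, Measurable fun ω => f ω v y)
    (hX : Measurable fun p : Ω × ℝ≥0∞ => X p.1 p.2) (hk : ∀ ω t, (X ω t).length = k)
    (hσ : ∀ x i, Measurable (D.σ k x i)) (hT : ∀ x i, Measurable (D.T k x i)) (j : ℕ × ℕ) :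
    Measurable fun ω => D.jump k (f ω) (X ω) ω j := by
  refine Measurable.mul ?_ (ENNReal.measurable_ofReal.comp (hT _ _))
  exact measurable_extendZero (hX.comp (measurable_id.prodMk (measurable_mark hσ j)))
    (fun a => hk _ _) _ fun v hv => hf v hv _

lemma measurable_jumpSum {f : Ω → List ℕ → ℕ → ℝ≥0∞} {X : Ω → ℝ≥0∞ → List ℕ∞}
    (hf : ∀ v : List ℕ, v.length = k → ∀ y, Measurable fun ω => f ω v y)
    (hX : Measurable fun p : Ω × ℝ≥0∞ => X p.1 p.2) (hk : ∀ ω t, (X ω t).length = k)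
    (hσ : ∀ x i, Measurable (D.σ k x i)) (hT : ∀ x i, Measurable (D.T k x i)) :
    Measurable fun p : Ω × ℝ≥0∞ => jumpSum (D.mark k p.1) (D.jump k (f p.1) (X p.1) p.1) p.2 := by
  refine Measurable.tsum fun j => Measurable.ite (measurableSet_le
    ((measurable_mark hσ j).comp measurable_fst) measurable_snd) ?_ measurable_const
  exact (measurable_jump hf hX hk hσ hT j).comp measurable_fst

/-- Joint measurability of the paths. -/
lemma measurable_X (hγ : ∀ v : List ℕ, v.length < k → ∀ y, Measurable (D.γ v y))
    (hσ : ∀ j < k, ∀ x i, Measurable (D.σ j x i)) (hT : ∀ j < k, ∀ x i, Measurable (D.T j x i)) :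
    Measurable fun p : Ω × ℝ≥0∞ => D.X k p.1 p.2 := by
  induction k with
  | zero => exact measurable_const
  | succ k ih =>
    have hX := ih (fun v hv => hγ v (by omega)) (fun j hj => hσ j (by omega))
      (fun j hj => hT j (by omega))
    have hw : ∀ v : List ℕ, v.length = k → ∀ y, Measurable fun ω => D.weight ω v y :=
      fun v hv y => ENNReal.measurable_ofReal.comp (hγ v (by omega) y)
    have hσk := hσ k (Nat.lt_succ_self k)
    have hTk := hT k (Nat.lt_succ_self k)
    have hΞ := measurable_jumpSum hw hX (fun ω t => D.length_X k ω t) hσk hTk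
    have hinv := measurable_clockInv (fun ω => jumpSum_mono (s := D.mark k ω)
      (a := D.jump k (D.weight ω) (D.X k ω) ω)) hΞ
    have hrest : Measurable fun p : Ω × ℝ≥0∞ =>
        D.X k p.1 (clockInv (jumpSum (D.mark k p.1) (D.jump k (D.weight p.1) (D.X k p.1) p.1)) p.2) :=
      hX.comp (measurable_fst.prodMk hinv)
    have hleft : ∀ j, Measurable fun ω => Function.leftLim
        (jumpSum (D.mark k ω) (D.jump k (D.weight ω) (D.X k ω) ω)) (D.mark k ω j) := by
      intro j
      -- A mark at `0`, where the left limit is a default value, is treated apart; everywhere else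
      -- the left limit is the sum of the earlier jumps.
      have e : (fun ω => Function.leftLim
        (jumpSum (D.mark k ω) (D.jump k (D.weight ω) (D.X k ω) ω)) (D.mark k ω j)) =
        fun ω => if D.mark k ω j = 0 then
          jumpSum (D.mark k ω) (D.jump k (D.weight ω) (D.X k ω) ω) 0 else
          ∑' i, if D.mark k ω i < D.mark k ω j then D.jump k (D.weight ω) (D.X k ω) ω i else 0 := by
        ext ω
        split_ifs with h
        · rw [h, leftLim_jumpSum_zero]
        · rw [leftLim_jumpSum h, leftJumpSum]
      rw [e]
      refine Measurable.ite (measurable_mark hσk j (measurableSet_singleton 0)) ?_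
        (Measurable.tsum fun i => Measurable.ite
          (measurableSet_lt (measurable_mark hσk i) (measurable_mark hσk j)) ?_ measurable_const)
      · exact hΞ.comp (measurable_id.prodMk measurable_const)
      · exact measurable_jump hw hX (fun ω t => D.length_X k ω t) hσk hTk i
    have hlabel : Measurable fun p : Ω × ℝ≥0∞ => (⨅ (x : ℕ) (_ : ∃ i,
        Function.leftLim (jumpSum (D.mark k p.1) (D.jump k (D.weight p.1) (D.X k p.1) p.1))
          (D.mark k p.1 (x, i)) ≤ p.2 ∧
        p.2 < jumpSum (D.mark k p.1) (D.jump k (D.weight p.1) (D.X k p.1) p.1)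
          (D.mark k p.1 (x, i))), (x : ℕ∞)) := by
      have : BorelSpace ℕ∞ := ⟨borel_eq_top_of_countable.symm⟩
      refine Measurable.iInf fun x => ?_
      classical
      simp only [iInf_eq_if]
      refine Measurable.ite ?_ measurable_const measurable_const
      have : {p : Ω × ℝ≥0∞ | ∃ i,
          Function.leftLim (jumpSum (D.mark k p.1) (D.jump k (D.weight p.1) (D.X k p.1) p.1))
            (D.mark k p.1 (x, i)) ≤ p.2 ∧
          p.2 < jumpSum (D.mark k p.1) (D.jump k (D.weight p.1) (D.X k p.1) p.1)
            (D.mark k p.1 (x, i))} = ⋃ i, {p : Ω × ℝ≥0∞ |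
          Function.leftLim (jumpSum (D.mark k p.1) (D.jump k (D.weight p.1) (D.X k p.1) p.1))
            (D.mark k p.1 (x, i)) ≤ p.2} ∩ {p |
          p.2 < jumpSum (D.mark k p.1) (D.jump k (D.weight p.1) (D.X k p.1) p.1)
            (D.mark k p.1 (x, i))} := by
        ext p; simp
      rw [this]
      refine MeasurableSet.iUnion fun i => (measurableSet_le ((hleft (x, i)).comp measurable_fst)
        measurable_snd).inter (measurableSet_lt measurable_snd ?_)
      exact hΞ.comp (measurable_fst.prodMk ((measurable_mark hσk (x, i)).comp measurable_fst))
    have e : (fun p : Ω × ℝ≥0∞ => D.X (k + 1) p.1 p.2) = fun p => (⨅ (x : ℕ) (_ : ∃ i,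
        Function.leftLim (jumpSum (D.mark k p.1) (D.jump k (D.weight p.1) (D.X k p.1) p.1))
          (D.mark k p.1 (x, i)) ≤ p.2 ∧
        p.2 < jumpSum (D.mark k p.1) (D.jump k (D.weight p.1) (D.X k p.1) p.1)
          (D.mark k p.1 (x, i))), (x : ℕ∞)) ::
        D.X k p.1 (clockInv (jumpSum (D.mark k p.1) (D.jump k (D.weight p.1) (D.X k p.1) p.1)) p.2) := by
      ext1 p
      rw [X]
      have e : D.clockAlong k (fun v y => ENNReal.ofReal (D.γ v y p.1)) (D.X k p.1) p.1 =
        jumpSum (D.mark k p.1) (D.jump k (D.weight p.1) (D.X k p.1) p.1) := D.clock_eq k p.1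
      simp only [e]
      rfl
    rw [e]
    refine measurable_to_countable' fun l => ?_
    cases l with
    | nil =>
      convert MeasurableSet.empty
      ext p
      simp
    | cons n l =>
      have hset := (hlabel (measurableSet_singleton n)).inter (hrest (measurableSet_singleton l))
      convert hset using 1
      ext p
      simp

end KTreeData

/-! ### Laplace transforms of marked sums. -/

lemma inv_one_add_le_one (y : ℝ≥0∞) : (1 + y)⁻¹ ≤ 1 := ENNReal.inv_le_one.2 le_self_add

/-- Joint measurability of a marked sum. -/
lemma measurable_mul_expNeg_marks {A B : Type*} {_ : MeasurableSpace A} {_ : MeasurableSpace B}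
    {J : Type*} [Countable J]
    {ψ : A → ℝ≥0∞} {f : A → ℝ≥0∞ → J → ℝ≥0∞} {s t : J → B → ℝ≥0∞} (hψ : Measurable ψ)
    (hf : ∀ j, Measurable fun p : A × ℝ≥0∞ => f p.1 p.2 j) (hs : ∀ j, Measurable (s j))
    (ht : ∀ j, Measurable (t j)) :
    Measurable fun q : A × B => ψ q.1 * expNeg (∑' j, f q.1 (s j q.2) j * t j q.2) := by
  refine (hψ.comp measurable_fst).mul (measurable_expNeg.comp (Measurable.tsum fun j => ?_))
  exact ((hf j).comp (measurable_fst.prodMk ((hs j).comp measurable_snd))).mul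
    ((ht j).comp measurable_snd)

namespace KTreeData.IsModel

variable {Ω : Type*} {D : KTreeData Ω} [MeasurableSpace Ω] {P : Measure Ω} {α : ℕ → ℝ}

lemma measurable_mark (hD : D.IsModel α P) (k : ℕ) (j : ℕ × ℕ) :
    Measurable fun ω => D.mark k ω j :=
  KTreeData.measurable_mark (fun x i => (hD.σ_process k x).measurable i) j

variable [IsProbabilityMeasure P]

/-- `negLog` puts `(1 + c i)⁻¹`, the Laplace transform of a multiple of an exponential variable,
into the form `exp (-·)` that infinite sums of independent terms require. -/
lemma lintegral_expNeg_tsum_mul_T (hD : D.IsModel α P) (m x : ℕ) (c : ℕ → ℝ≥0∞) :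
    ∫⁻ ω, expNeg (∑' i, c i * ENNReal.ofReal (D.T m x i ω)) ∂P =
      expNeg (∑' i, negLog ((1 + c i)⁻¹)) := by
  refine lintegral_expNeg_tsum hD.source_le hD.indep
    (fun i : ℕ => ({.inr (.inr (m, x, i))} : Set (List ℕ ⊕ (ℕ × ℕ) ⊕ (ℕ × ℕ × ℕ)))) ?_
    (fun i ω => c i * ENNReal.ofReal (D.T m x i ω)) (fun i => ?_) _ fun i => ?_
  · intro i j hij
    rw [Set.disjoint_singleton]
    simpa using hij
  · have hT : Measurable[D.sig {.inr (.inr (m, x, i))}] fun ω => ENNReal.ofReal (D.T m x i ω) :=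
      ENNReal.measurable_ofReal.comp (D.measurable_T_sig (Set.mem_singleton _))
    exact hT.const_mul (c i)
  · rw [lintegral_expNeg_of_map_eq_expMeasure (hD.T_measurable m x i) (hD.T_law m x i),
      expNeg_negLog (inv_one_add_le_one _)]

/-- The Laplace transform of the marked sum over the marks with one label. -/
lemma lintegral_expNeg_marks_label (hD : D.IsModel α P) (m x : ℕ) {g : ℝ≥0∞ → ℝ≥0∞}
    (hg : Measurable g) :
    ∫⁻ ω, expNeg (∑' i, g (D.mark m ω (x, i)) * ENNReal.ofReal (D.T m x i ω)) ∂P =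
      expNeg (∫⁻ u, (1 - (1 + g u)⁻¹) ∂leb) := by
  -- The exponential variables are integrated out first with the marks frozen; what remains is a
  -- Laplace functional of the Poisson process of marks.
  let S : Set (List ℕ ⊕ (ℕ × ℕ) ⊕ (ℕ × ℕ × ℕ)) := {.inr (.inl (m, x))}
  let T : Set (List ℕ ⊕ (ℕ × ℕ) ⊕ (ℕ × ℕ × ℕ)) := {j | ∃ i, j = .inr (.inr (m, x, i))}
  have hST : Disjoint S T := by
    rw [Set.disjoint_left]
    rintro i rfl ⟨i, h⟩
    simp at h
  let F : Ω × Ω → ℝ≥0∞ := fun q =>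
    1 * expNeg (∑' i, (fun (a : Ω) (_ : ℝ≥0∞) i => g (D.mark m a (x, i))) q.1 0 i *
      ENNReal.ofReal (D.T m x i q.2))
  have hσ : ∀ i, Measurable[D.sig S] fun ω => D.mark m ω (x, i) := fun i =>
    ENNReal.measurable_ofReal.comp (D.measurable_σ_sig i (Set.mem_singleton _))
  have hT : ∀ i, Measurable[D.sig T] fun ω => ENNReal.ofReal (D.T m x i ω) := fun i =>
    ENNReal.measurable_ofReal.comp (D.measurable_T_sig ⟨i, rfl⟩)
  have hF : Measurable[@Prod.instMeasurableSpace Ω Ω (D.sig S) (D.sig T)] F :=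
    @measurable_mul_expNeg_marks Ω Ω (D.sig S) (D.sig T) ℕ _ (fun _ => 1)
      (fun a _ i => g (D.mark m a (x, i))) (fun _ _ => 0)
      (fun i ω => ENNReal.ofReal (D.T m x i ω)) measurable_const
      (fun i => (hg.comp (hσ i)).comp (@measurable_fst Ω ℝ≥0∞ (D.sig S) _))
      (fun _ => measurable_const) hT
  have e1 : ∀ ω, expNeg (∑' i, g (D.mark m ω (x, i)) * ENNReal.ofReal (D.T m x i ω)) =
      F (ω, ω) := fun ω => by simp [F]
  simp_rw [e1]
  rw [lintegral_diag_of_indep (hD.sig_le S) (hD.sig_le T) (hD.indep_sig hST) hF]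
  have e2 : ∀ ω, ∫⁻ ω', F (ω, ω') ∂P =
      expNeg (∑' i, (fun s => negLog ((1 + g (ENNReal.ofReal s))⁻¹)) (D.σ m x i ω)) := fun ω => by
    simp only [F, one_mul]
    exact hD.lintegral_expNeg_tsum_mul_T m x fun i => g (D.mark m ω (x, i))
  simp_rw [e2]
  have hg' : Measurable fun s : ℝ => negLog ((1 + g (ENNReal.ofReal s))⁻¹) :=
    measurable_negLog.comp ((hg.comp ENNReal.measurable_ofReal).const_add 1).inv
  rw [(hD.σ_process m x).lintegral_expNeg hg', lintegral_leb
    (f := fun u => 1 - (1 + g u)⁻¹) (measurable_const.sub (hg.const_add 1).inv)]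
  simp_rw [expNeg_negLog (inv_one_add_le_one _)]

/-- The Laplace transform of a marked sum over all marks of one level. -/
lemma lintegral_expNeg_marks (hD : D.IsModel α P) (m : ℕ) {g : ℝ≥0∞ → ℕ → ℝ≥0∞}
    (hg : ∀ x, Measurable fun u => g u x) :
    ∫⁻ ω, expNeg (∑' j : ℕ × ℕ, g (D.mark m ω j) j.1 * ENNReal.ofReal (D.T m j.1 j.2 ω)) ∂P =
      expNeg (∑' x, ∫⁻ u, (1 - (1 + g u x)⁻¹) ∂leb) := by
  simp_rw [ENNReal.tsum_prod']
  let S : ℕ → Set (List ℕ ⊕ (ℕ × ℕ) ⊕ (ℕ × ℕ × ℕ)) := fun x =>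
    {j | j = .inr (.inl (m, x)) ∨ ∃ i, j = .inr (.inr (m, x, i))}
  refine lintegral_expNeg_tsum hD.source_le hD.indep S ?_
    (fun x ω => ∑' i, g (D.mark m ω (x, i)) x * ENNReal.ofReal (D.T m x i ω)) ?_ _
    fun x => hD.lintegral_expNeg_marks_label m x (hg x)
  · intro x y hxy
    rw [Set.disjoint_left]
    rintro j (rfl | ⟨i, rfl⟩) (h | ⟨i', h⟩) <;> simp at h <;> exact hxy (by tauto)
  · intro x
    have h1 : ∀ i, Measurable[D.sig (S x)] fun ω => D.mark m ω (x, i) := fun i =>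
      ENNReal.measurable_ofReal.comp (D.measurable_σ_sig i (.inl rfl))
    have h2 : ∀ i, Measurable[D.sig (S x)] fun ω => ENNReal.ofReal (D.T m x i ω) := fun i =>
      ENNReal.measurable_ofReal.comp (D.measurable_T_sig (.inr ⟨i, rfl⟩))
    exact measurable_tsum_of fun i => ((hg x).comp (h1 i)).mul (h2 i)

/-- The conditional Laplace transform of a marked sum whose integrand is independent of the
marks. -/
lemma lintegral_mul_expNeg_marks (hD : D.IsModel α P) (m : ℕ)
    {H : Set (List ℕ ⊕ (ℕ × ℕ) ⊕ (ℕ × ℕ × ℕ))} (h1 : ∀ x, .inr (.inl (m, x)) ∉ H)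
    (h2 : ∀ x i, .inr (.inr (m, x, i)) ∉ H) {ψ : Ω → ℝ≥0∞} (hψ : Measurable[D.sig H] ψ)
    {f : Ω → ℝ≥0∞ → ℕ → ℝ≥0∞}
    (hf : ∀ x, Measurable[@Prod.instMeasurableSpace Ω ℝ≥0∞ (D.sig H) _]
      fun p : Ω × ℝ≥0∞ => f p.1 p.2 x) :
    ∫⁻ ω, ψ ω * expNeg (∑' j : ℕ × ℕ, f ω (D.mark m ω j) j.1 *
        ENNReal.ofReal (D.T m j.1 j.2 ω)) ∂P =
      ∫⁻ ω, ψ ω * expNeg (∑' x, ∫⁻ u, (1 - (1 + f ω u x)⁻¹) ∂leb) ∂P := by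
  let T : Set (List ℕ ⊕ (ℕ × ℕ) ⊕ (ℕ × ℕ × ℕ)) :=
    {j | (∃ x, j = .inr (.inl (m, x))) ∨ ∃ x i, j = .inr (.inr (m, x, i))}
  have hHT : Disjoint H T := by
    rw [Set.disjoint_right]
    rintro j (⟨x, rfl⟩ | ⟨x, i, rfl⟩)
    exacts [h1 x, h2 x i]
  let F : Ω × Ω → ℝ≥0∞ := fun q => ψ q.1 * expNeg (∑' j : ℕ × ℕ, f q.1 (D.mark m q.2 j) j.1 *
        ENNReal.ofReal (D.T m j.1 j.2 q.2))
  have hF : Measurable[@Prod.instMeasurableSpace Ω Ω (D.sig H) (D.sig T)] F :=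
    @measurable_mul_expNeg_marks Ω Ω (D.sig H) (D.sig T) (ℕ × ℕ) _ ψ
      (fun a u j => f a u j.1) (fun j ω => D.mark m ω j)
      (fun j ω => ENNReal.ofReal (D.T m j.1 j.2 ω)) hψ (fun j => hf j.1)
      (fun j => ENNReal.measurable_ofReal.comp (D.measurable_σ_sig j.2 (.inl ⟨_, rfl⟩)))
      (fun j => ENNReal.measurable_ofReal.comp (D.measurable_T_sig (.inr ⟨_, _, rfl⟩)))
  rw [lintegral_diag_of_indep (hD.sig_le H) (hD.sig_le T) (hD.indep_sig hHT) hF (F := F)]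
  refine lintegral_congr fun ω => ?_
  have hg : ∀ x, Measurable fun u => f ω u x := fun x =>
    (hf x).comp (@measurable_prodMk_left Ω ℝ≥0∞ (D.sig H) _ ω)
  have hm : Measurable fun ω' => expNeg (∑' j : ℕ × ℕ, f ω (D.mark m ω' j) j.1 *
        ENNReal.ofReal (D.T m j.1 j.2 ω')) :=
    measurable_expNeg.comp (Measurable.tsum fun j => ((hg _).comp (hD.measurable_mark m j)).mul
      (ENNReal.measurable_ofReal.comp (hD.T_measurable _ _ _)))
  refine (lintegral_const_mul (ψ ω) hm).trans ?_
  rw [hD.lintegral_expNeg_marks m hg]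

/-- The marks of all levels are almost surely positive and distinct. -/
lemma ae_simpleMarks (hD : D.IsModel α P) : ∀ᵐ ω ∂P, D.SimpleMarks ω := by
  have h1 : ∀ᵐ ω ∂P, ∀ k x, StrictMono (fun i => D.σ k x i ω) ∧ ∀ i, 0 < D.σ k x i ω := by
    simp_rw [ae_all_iff]
    exact hD.σ_order
  -- Marks with different labels are independent, and a mark avoids every fixed time; marks with the
  -- same label are ordered.
  have h2 : ∀ᵐ ω ∂P, ∀ k x y i j, x ≠ y → D.σ k x i ω ≠ D.σ k y j ω := by
    simp_rw [ae_all_iff]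
    intro k x y i j hxy
    have hind : IndepFun (D.σ k x i) (D.σ k y j) P := by
      have := hD.indep_sig (S := {.inr (.inl (k, x))}) (T := {.inr (.inl (k, y))}) (by simpa using hxy)
      refine indep_of_indep_of_le_left (indep_of_indep_of_le_right this ?_) ?_
      · exact (D.measurable_σ_sig j (Set.mem_singleton _)).comap_le
      · exact (D.measurable_σ_sig i (Set.mem_singleton _)).comap_le
    have hx := (hD.σ_process k x).measurable i
    have hy := (hD.σ_process k y).measurable j
    have hm : MeasurableSet {p : ℝ × ℝ | p.1 = p.2} := measurableSet_eq_fun measurable_fst measurable_snd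
    have e := lintegral_of_indepFun hx hy hind
      (F := ({p : ℝ × ℝ | p.1 = p.2}).indicator 1) (measurable_one.indicator hm)
    have e2 : ∀ ω, ∫⁻ ω', ({p : ℝ × ℝ | p.1 = p.2}).indicator (1 : ℝ × ℝ → ℝ≥0∞)
        (D.σ k x i ω, D.σ k y j ω') ∂P = 0 := fun ω => by
      refine lintegral_eq_zero_of_ae_eq_zero ?_
      filter_upwards [(hD.σ_process k y).ae_ne_of_null (u := D.σ k x i ω) (by simp) j] with ω' h
      simp [h.symm]
    simp_rw [e2, lintegral_zero] at e
    filter_upwards [(lintegral_eq_zero_iff (f := fun ω => ({p : ℝ × ℝ | p.1 = p.2}).indicator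
      (1 : ℝ × ℝ → ℝ≥0∞) (D.σ k x i ω, D.σ k y j ω))
      ((measurable_one.indicator hm).comp (hx.prodMk hy))).1 e] with ω h h'
    simp [h'] at h
  filter_upwards [h1, h2] with ω h1 h2 k
  refine ⟨fun a b hab => ?_, fun j => ?_⟩
  · have hσ : D.σ k a.1 a.2 ω = D.σ k b.1 b.2 ω :=
      (ENNReal.ofReal_eq_ofReal_iff ((h1 k _).2 _).le ((h1 k _).2 _).le).1 hab
    have hx : a.1 = b.1 := by
      by_contra hne
      exact h2 k _ _ _ _ hne hσ
    refine Prod.ext hx ((h1 k a.1).1.injective ?_)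
    simpa [← hx] using hσ
  · simpa [mark] using (h1 k j.1).2 j.2

end KTreeData.IsModel

lemma measurable_comp_prodMk {A B C : Type*} {_ : MeasurableSpace A} {_ : MeasurableSpace B}
    {_ : MeasurableSpace C} {F : A × B → C} {b : A → B} (hF : Measurable F) (hb : Measurable b) :
    Measurable fun a => F (a, b a) := hF.comp (measurable_id.prodMk hb)

/-! ### Duality between occupation integrals of different levels. -/

/-- The iterates of `killRate`. -/
noncomputable def killIter (g : List ℕ → ℕ → ℝ≥0∞) : ℕ → (List ℕ → ℝ≥0∞) → List ℕ → ℝ≥0∞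
  | 0, U => U
  | m + 1, U => killRate g (killIter g m U)

lemma killIter_killRate (g : List ℕ → ℕ → ℝ≥0∞) (m : ℕ) (U : List ℕ → ℝ≥0∞) :
    killIter g m (killRate g U) = killIter g (m + 1) U := by
  induction m with
  | zero => rfl
  | succ m ih => rw [killIter, ih]; rfl

lemma onStates_mono {U V : List ℕ → ℝ≥0∞} {l : List ℕ∞} {n : ℕ} (hl : l.length = n)
    (h : ∀ v : List ℕ, v.length = n → U v ≤ V v) : onStates U l ≤ onStates V l := by
  unfold onStates
  split_ifs
  · rfl
  · exact h _ (by simpa using hl)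

namespace KTreeData

/-- All parameters, and the marks and exponential variables of the first `m` levels. -/
def past (m : ℕ) : Set (List ℕ ⊕ (ℕ × ℕ) ⊕ (ℕ × ℕ × ℕ))
  | .inl _ => True
  | .inr (.inl (j, _)) => j < m
  | .inr (.inr (j, _, _)) => j < m

/-- The parameters, marks and exponential variables of the first `m` levels. -/
def strictPast (m : ℕ) : Set (List ℕ ⊕ (ℕ × ℕ) ⊕ (ℕ × ℕ × ℕ))
  | .inl v => v.length < m
  | .inr (.inl (j, _)) => j < m
  | .inr (.inr (j, _, _)) => j < m

lemma past_mono {m n : ℕ} (h : m ≤ n) : past m ⊆ past n := by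
  rintro (v | ⟨j, x⟩ | ⟨j, x, i⟩) hi
  · trivial
  · exact lt_of_lt_of_le (show j < m from hi) h
  · exact lt_of_lt_of_le (show j < m from hi) h

variable {Ω : Type*} {D : KTreeData Ω}

lemma clockComp_mono (D : KTreeData Ω) (k m : ℕ) (ω : Ω) : Monotone (D.clockComp k m ω) := by
  induction m with
  | zero => exact monotone_id
  | succ m ih => exact (D.clock_mono (k + m) ω).comp ih

lemma measurable_X_past (D : KTreeData Ω) (m : ℕ) :
    Measurable[@Prod.instMeasurableSpace Ω ℝ≥0∞ (D.sig (past m)) _]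
      fun p : Ω × ℝ≥0∞ => D.X m p.1 p.2 :=
  @measurable_X Ω (D.sig (past m)) D m (fun _ _ y => D.measurable_γ_sig y (by trivial))
    (fun _ hj _ i => D.measurable_σ_sig i hj) (fun _ hj _ _ => D.measurable_T_sig hj)

lemma measurable_X_strictPast (D : KTreeData Ω) (m : ℕ) :
    Measurable[@Prod.instMeasurableSpace Ω ℝ≥0∞ (D.sig (strictPast m)) _]
      fun p : Ω × ℝ≥0∞ => D.X m p.1 p.2 :=
  @measurable_X Ω (D.sig (strictPast m)) D m (fun _ hv y => D.measurable_γ_sig y hv)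
    (fun _ hj _ i => D.measurable_σ_sig i hj) (fun _ hj _ _ => D.measurable_T_sig hj)

lemma measurable_clock_past (D : KTreeData Ω) (m : ℕ) {a : Ω → ℝ≥0∞}
    (ha : Measurable[D.sig (past m)] a) : Measurable[D.sig (past (m + 1))] fun ω => D.clock m ω (a ω) := by
  have hle := D.sig_mono (past_mono (Nat.le_succ m))
  have hX : Measurable[@Prod.instMeasurableSpace Ω ℝ≥0∞ (D.sig (past (m + 1))) _]
      fun p : Ω × ℝ≥0∞ => D.X m p.1 p.2 :=
    @measurable_X Ω (D.sig (past (m + 1))) D m (fun _ _ y => D.measurable_γ_sig y (by trivial))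
      (fun _ hj _ i => D.measurable_σ_sig i (Nat.lt_succ_of_lt hj))
      (fun _ hj _ _ => D.measurable_T_sig (Nat.lt_succ_of_lt hj))
  have h := @measurable_jumpSum Ω (D.sig (past (m + 1))) D m D.weight (D.X m)
    (fun _ _ y => D.measurable_weight_sig y (by trivial)) hX (fun ω t => D.length_X m ω t)
    (fun _ i => D.measurable_σ_sig i (Nat.lt_succ_self m))
    (fun _ _ => D.measurable_T_sig (Nat.lt_succ_self m))
  simp_rw [← D.clock_eq] at h
  exact measurable_comp_prodMk h (ha.mono hle le_rfl)

lemma measurable_clockComp_past (D : KTreeData Ω) (k m : ℕ) {a : Ω → ℝ≥0∞}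
    (ha : Measurable[D.sig (past k)] a) :
    Measurable[D.sig (past (k + m))] fun ω => D.clockComp k m ω (a ω) := by
  induction m with
  | zero => exact ha
  | succ m ih => exact D.measurable_clock_past (k + m) ih

/-- The occupation integral of a function of the states over a random window. -/
noncomputable def occ (D : KTreeData Ω) (k : ℕ) (U : List ℕ → ℝ≥0∞) (ω : Ω) (a b : ℝ≥0∞) : ℝ≥0∞ :=
  ∫⁻ u in Set.Ico a b, onStates U (D.X k ω u) ∂leb

lemma occ_mono {k : ℕ} {U V : List ℕ → ℝ≥0∞} (h : ∀ v : List ℕ, v.length = k → U v ≤ V v) (ω : Ω)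
    (a b : ℝ≥0∞) : D.occ k U ω a b ≤ D.occ k V ω a b :=
  lintegral_mono fun u => onStates_mono (D.length_X k ω u) h

lemma measurable_occ {S : Set (List ℕ ⊕ (ℕ × ℕ) ⊕ (ℕ × ℕ × ℕ))} {k : ℕ} (hS : past k ⊆ S)
    {U : Ω → List ℕ → ℝ≥0∞} (hU : ∀ v : List ℕ, v.length = k → Measurable[D.sig S] fun ω => U ω v)
    {a b : Ω → ℝ≥0∞} (ha : Measurable[D.sig S] a) (hb : Measurable[D.sig S] b) :
    Measurable[D.sig S] fun ω => D.occ k (U ω) ω (a ω) (b ω) := by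
  have h1 : ∀ ω, D.occ k (U ω) ω (a ω) (b ω) =
      ∫⁻ u, (if a ω ≤ u ∧ u < b ω then onStates (U ω) (D.X k ω u) else 0) ∂leb := fun ω => by
    rw [occ, ← lintegral_indicator measurableSet_Ico]
    simp only [Set.indicator, Set.mem_Ico]
  simp_rw [h1]
  have hX : Measurable[@Prod.instMeasurableSpace Ω ℝ≥0∞ (D.sig S) _]
      fun p : Ω × ℝ≥0∞ => D.X k p.1 p.2 :=
    (D.measurable_X_past k).mono (sup_le_sup (MeasurableSpace.comap_mono (D.sig_mono hS)) le_rfl) le_rfl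
  let _ := D.sig S
  refine Measurable.lintegral_prod_right (f := fun ω u =>
    if a ω ≤ u ∧ u < b ω then onStates (U ω) (D.X k ω u) else 0) ?_
  refine Measurable.ite ((measurableSet_le (ha.comp measurable_fst) measurable_snd).inter
    (measurableSet_lt measurable_snd (hb.comp measurable_fst))) ?_ measurable_const
  exact measurable_onStates hX (fun p => D.length_X k p.1 p.2) fun v hv => (hU v hv).comp measurable_fst

lemma measurable_killRate_past {U : Ω → List ℕ → ℝ≥0∞} {m n : ℕ}
    (hU : ∀ v : List ℕ, v.length = n + 1 → Measurable[D.sig (past m)] fun ω => U ω v)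
    (v : List ℕ) (hv : v.length = n) :
    Measurable[D.sig (past m)] fun ω => killRate (D.weight ω) (U ω) v :=
  measurable_killRate (fun x => D.measurable_weight_sig x (by trivial))
    fun x => hU _ (by simp [hv])

namespace IsModel

variable [MeasurableSpace Ω] {P : Measure Ω} [IsProbabilityMeasure P] {α : ℕ → ℝ}

/-- Conditionally on the past, the jumps of one level in a window act as a killing. -/
lemma lintegral_mul_expNeg_jumps (hD : D.IsModel α P) (m : ℕ) {ψ a b : Ω → ℝ≥0∞}
    (hψ : Measurable[D.sig (past m)] ψ) (ha : Measurable[D.sig (past m)] a)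
    (hb : Measurable[D.sig (past m)] b) {U : Ω → List ℕ → ℝ≥0∞}
    (hU : ∀ v : List ℕ, v.length = m + 1 → Measurable[D.sig (past m)] fun ω => U ω v) :
    ∫⁻ ω, ψ ω * expNeg (∑' j, if a ω < D.mark m ω j ∧ D.mark m ω j ≤ b ω then
        D.jump m (fun v y => D.weight ω v y * U ω (y :: v)) (D.X m ω) ω j else 0) ∂P =
      ∫⁻ ω, ψ ω * expNeg (D.occ m (killRate (D.weight ω) (U ω)) ω (a ω) (b ω)) ∂P := by
  let f : Ω → ℝ≥0∞ → ℕ → ℝ≥0∞ := fun ω u x => if a ω < u ∧ u ≤ b ω then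
    extendZero (fun v y => D.weight ω v y * U ω (y :: v)) (D.X m ω u) x else 0
  have hf : ∀ x, Measurable[@Prod.instMeasurableSpace Ω ℝ≥0∞ (D.sig (past m)) _]
      fun p : Ω × ℝ≥0∞ => f p.1 p.2 x := by
    intro x
    have hX := D.measurable_X_past m
    have hw : ∀ v : List ℕ, v.length = m → Measurable[D.sig (past m)]
        fun ω => D.weight ω v x * U ω (x :: v) := fun v hv =>
      (D.measurable_weight_sig x (by trivial)).mul (hU _ (by simp [hv]))
    let _ := D.sig (past m)
    refine Measurable.ite ((measurableSet_lt (ha.comp measurable_fst) measurable_snd).inter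
      (measurableSet_le measurable_snd (hb.comp measurable_fst))) ?_ measurable_const
    exact measurable_extendZero (f := fun (p : Ω × ℝ≥0∞) v y => D.weight p.1 v y * U p.1 (y :: v)) hX
      (fun p => D.length_X m p.1 p.2) x fun v hv => (hw v hv).comp measurable_fst
  -- `past m` contains the parameters of all generations, so `U` may depend on them, in particular
  -- through W; it contains no mark or exponential variable with index `m`.
  have key := hD.lintegral_mul_expNeg_marks m (H := past m) (fun x h => lt_irrefl m h)
    (fun x i h => lt_irrefl m h) hψ hf
  have e1 : ∀ ω j, (if a ω < D.mark m ω j ∧ D.mark m ω j ≤ b ω then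
        D.jump m (fun v y => D.weight ω v y * U ω (y :: v)) (D.X m ω) ω j else 0) =
      f ω (D.mark m ω j) j.1 * ENNReal.ofReal (D.T m j.1 j.2 ω) := fun ω j => by
    simp only [f, jump]
    split_ifs <;> simp
  simp_rw [e1]
  rw [key]
  refine lintegral_congr fun ω => ?_
  congr 2
  have hf' : ∀ x, Measurable fun u => f ω u x := fun x =>
    (hf x).comp (@measurable_prodMk_left Ω ℝ≥0∞ (D.sig (past m)) _ ω)
  -- The jumps are taken over a window open on the left, the occupation integral over one open on
  -- the right; `leb` has no atoms.
  rw [← lintegral_tsum (f := fun x u => 1 - (1 + f ω u x)⁻¹) fun x => (measurable_const.sub ((hf' x).const_add 1).inv).aemeasurable, occ,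
    ← setLIntegral_congr ((Ioo_ae_eq_Ioc (μ := leb)).symm.trans Ioo_ae_eq_Ico), ← lintegral_indicator measurableSet_Ioc]
  refine lintegral_congr fun u => ?_
  by_cases hu : u ∈ Set.Ioc (a ω) (b ω)
  · have hu' : a ω < u ∧ u ≤ b ω := hu
    rw [Set.indicator_of_mem hu]
    simp only [f, hu', and_self, if_true, onStates, extendZero, killRate]
    split_ifs <;> simp
  · have hu' : ¬ (a ω < u ∧ u ≤ b ω) := hu
    rw [Set.indicator_of_notMem hu]
    simp [f, hu']

/-- The occupation integrals of two consecutive levels. -/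
lemma lintegral_mul_expNeg_occ_succ (hD : D.IsModel α P) (m : ℕ) {ψ a b : Ω → ℝ≥0∞}
    (hψ : Measurable[D.sig (past m)] ψ) (ha : Measurable[D.sig (past m)] a)
    (hb : Measurable[D.sig (past m)] b) (hab : ∀ ω, a ω ≤ b ω)
    (hfin : ∀ᵐ ω ∂P, D.clock m ω (b ω) ≠ ∞) {U : Ω → List ℕ → ℝ≥0∞}
    (hU : ∀ v : List ℕ, v.length = m + 1 → Measurable[D.sig (past m)] fun ω => U ω v) :
    ∫⁻ ω, ψ ω * expNeg (D.occ (m + 1) (U ω) ω (D.clock m ω (a ω)) (D.clock m ω (b ω))) ∂P =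
      ∫⁻ ω, ψ ω * expNeg (D.occ m (killRate (D.weight ω) (U ω)) ω (a ω) (b ω)) ∂P := by
  rw [← hD.lintegral_mul_expNeg_jumps m hψ ha hb hU]
  refine lintegral_congr_ae ?_
  filter_upwards [hD.ae_simpleMarks, hfin] with ω hω hfin
  rw [occ, lintegral_onStates_X_succ hω (hab ω) hfin]

/-- The occupation integrals of two arbitrary levels. -/
lemma lintegral_mul_expNeg_occ_comp (hD : D.IsModel α P) (k m : ℕ) {ψ a b : Ω → ℝ≥0∞}
    (hψ : Measurable[D.sig (past k)] ψ) (ha : Measurable[D.sig (past k)] a)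
    (hb : Measurable[D.sig (past k)] b) (hab : ∀ ω, a ω ≤ b ω)
    (hfin : ∀ j ≤ m, ∀ᵐ ω ∂P, D.clockComp k j ω (b ω) ≠ ∞) {U : Ω → List ℕ → ℝ≥0∞}
    (hU : ∀ v : List ℕ, v.length = k + m → Measurable[D.sig (past k)] fun ω => U ω v) :
    ∫⁻ ω, ψ ω * expNeg (D.occ (k + m) (U ω) ω (D.clockComp k m ω (a ω))
        (D.clockComp k m ω (b ω))) ∂P =
      ∫⁻ ω, ψ ω * expNeg (D.occ k (killIter (D.weight ω) m (U ω)) ω (a ω) (b ω)) ∂P := by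
  induction m generalizing U with
  | zero => rfl
  | succ m ih =>
    have hle := D.sig_mono (past_mono (Nat.le_add_right k m))
    -- The deepest level is removed first, which replaces `U` by `killRate U`; the induction
    -- hypothesis handles the remaining levels.
    have h1 := hD.lintegral_mul_expNeg_occ_succ (k + m) (hψ.mono hle le_rfl)
      (D.measurable_clockComp_past k m ha) (D.measurable_clockComp_past k m hb)
      (fun ω => D.clockComp_mono k m ω (hab ω)) (hfin (m + 1) le_rfl) (U := U)
      fun v hv => (hU v hv).mono hle le_rfl
    refine h1.trans ?_
    rw [ih (fun j hj => hfin j (hj.trans (Nat.le_succ m))) (U := fun ω => killRate (D.weight ω) (U ω))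
      (measurable_killRate_past hU)]
    simp_rw [killIter_killRate]

end IsModel

end KTreeData

/-! ### Single-node bounds and the killing step. -/

/-- Jensen's inequality for the function `expNeg`. -/
lemma mul_expNeg_lintegral_le {A : Type*} [MeasurableSpace A] {μ : Measure A} {V : A → ℝ≥0∞}
    (hV : Measurable V) (h : μ Set.univ ≠ ∞) :
    μ Set.univ * expNeg (∫⁻ a, V a ∂μ) ≤ ∫⁻ a, expNeg (μ Set.univ * V a) ∂μ := by
  by_cases hI : ∫⁻ a, V a ∂μ = ∞
  · simp [hI]
  set I := ∫⁻ a, V a ∂μ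
  -- The tangent is taken at `I`, which is the mean of `μ univ * V` under the normalized measure.
  have h1 : ∫⁻ _, expNeg I * (1 + I) ∂μ ≤
      ∫⁻ a, (expNeg (μ Set.univ * V a) + expNeg I * (μ Set.univ * V a)) ∂μ :=
    lintegral_mono fun a => expNeg_tangent hI
  rw [lintegral_const, lintegral_add_left (f := fun a => expNeg (μ Set.univ * V a))
      (measurable_expNeg.comp (hV.const_mul _)),
    lintegral_const_mul _ (hV.const_mul _), lintegral_const_mul _ hV] at h1
  have h2 : expNeg I * (μ Set.univ * I) ≠ ∞ :=
    ENNReal.mul_ne_top (expNeg_ne_top _) (ENNReal.mul_ne_top h hI)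
  refine (ENNReal.add_le_add_iff_right h2).1 (le_trans (le_of_eq ?_) h1)
  ring

lemma one_sub_lintegral_expNeg {A : Type*} [MeasurableSpace A] {μ : Measure A}
    [IsProbabilityMeasure μ] {Y : A → ℝ≥0∞} (hY : Measurable Y) :
    1 - ∫⁻ a, expNeg (Y a) ∂μ = ∫⁻ a, (1 - expNeg (Y a)) ∂μ := by
  rw [lintegral_sub (g := fun a => expNeg (Y a)) (measurable_expNeg.comp hY) _ (.of_forall fun a => expNeg_le_one _)]
  · simp
  · refine ((lintegral_mono fun a => expNeg_le_one (Y a)).trans_lt ?_).ne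
    simp

lemma lintegral_expNeg_le_one {A : Type*} [MeasurableSpace A] {μ : Measure A}
    [IsProbabilityMeasure μ] (Y : A → ℝ≥0∞) : ∫⁻ a, expNeg (Y a) ∂μ ≤ 1 :=
  (lintegral_mono fun a => expNeg_le_one (Y a)).trans (by simp)

lemma negLog_antitone {x y : ℝ≥0∞} (h : x ≤ y) (hy : y ≤ 1) : negLog y ≤ negLog x := by
  rw [← expNeg_strictAnti.le_iff_ge, expNeg_negLog hy, expNeg_negLog (h.trans hy)]
  exact h

instance (a b : ℝ) : SFinite (levelIntensity a b) := by unfold levelIntensity; infer_instance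

/-- Scaling of the exponent of a sum over the children of a node. -/
lemma lintegral_one_sub_expNeg_minRpow {a b : ℝ} (ha : 0 < a) (hab : a < b) (C : ℝ≥0∞) {y : ℝ≥0∞}
    (hy : y ≠ ∞) :
    ∫⁻ s, (1 - expNeg (C * minRpow b (ENNReal.ofReal s * y))) ∂(levelIntensity a b) =
      y ^ a * branchExponent a b C := by
  rcases eq_or_ne y 0 with rfl | h0
  · simp [minRpow, ENNReal.zero_rpow_of_pos ha, ENNReal.zero_rpow_of_pos (ha.trans hab)]
  have hk : 0 < y.toReal := ENNReal.toReal_pos h0 hy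
  have h1 : ∀ s : ℝ, ENNReal.ofReal s * y = ENNReal.ofReal (y.toReal * s) := fun s => by
    rw [ENNReal.ofReal_mul hk.le, ENNReal.ofReal_toReal hy, mul_comm]
  simp_rw [h1]
  rw [lintegral_levelIntensity_mul (f := fun s => 1 - expNeg (C * minRpow b (ENNReal.ofReal s)))
    ha hab hk (measurable_branchIntegrand b C), ← ENNReal.ofReal_rpow_of_pos hk,
    ENNReal.ofReal_toReal hy]
  rfl

/-- Joint measurability of occupation integrals. -/
lemma measurable_expNeg_lintegral_onStates {A B : Type*} {_ : MeasurableSpace A}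
    {_ : MeasurableSpace B} {k : ℕ} {X : A → ℝ≥0∞ → List ℕ∞}
    (hX : Measurable fun p : A × ℝ≥0∞ => X p.1 p.2) (hk : ∀ a t, (X a t).length = k)
    {V : B → List ℕ → ℝ≥0∞} (hV : ∀ v : List ℕ, v.length = k → Measurable fun b => V b v)
    (s t : ℝ≥0∞) :
    Measurable fun q : A × B =>
      expNeg (∫⁻ u in Set.Ico s t, onStates (V q.2) (X q.1 u) ∂leb) := by
  refine measurable_expNeg.comp (Measurable.lintegral_prod_right
    (f := fun (q : A × B) u => onStates (V q.2) (X q.1 u)) ?_)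
  exact measurable_onStates (L := fun p : (A × B) × ℝ≥0∞ => X p.1.1 p.2)
    (U := fun p : (A × B) × ℝ≥0∞ => V p.1.2)
    (hX.comp ((measurable_fst.comp measurable_fst).prodMk measurable_snd)) (fun p => hk _ _)
    fun v hv => (hV v hv).comp (measurable_snd.comp measurable_fst)

namespace KTreeData

/-- The parameters of the nodes of depth at least `k`. -/
def deep (k : ℕ) : Set (List ℕ ⊕ (ℕ × ℕ) ⊕ (ℕ × ℕ × ℕ)) := {i | ∃ w : List ℕ, i = .inl w ∧ k ≤ w.length}

/-- The parameters of the descendants of a node. -/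
def subtree (v : List ℕ) : Set (List ℕ ⊕ (ℕ × ℕ) ⊕ (ℕ × ℕ × ℕ)) := {i | ∃ w, i = .inl w ∧ v <:+ w}

lemma subtree_subset_deep (v : List ℕ) : subtree v ⊆ deep v.length := by
  rintro _ ⟨w, rfl, h⟩
  exact ⟨w, rfl, h.length_le⟩

lemma disjoint_strictPast_deep (k : ℕ) : Disjoint (strictPast k) (deep k) := by
  rw [Set.disjoint_right]
  rintro _ ⟨w, rfl, h⟩ h'
  exact absurd h (not_le.2 h')

namespace IsModel

variable {Ω : Type*} {D : KTreeData Ω} [MeasurableSpace Ω] {P : Measure Ω} [IsProbabilityMeasure P]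
  {α : ℕ → ℝ}

/-- An occupation integral is at least as large, in the sense of Laplace transforms, as if the
process had stayed in one node. -/
lemma lintegral_expNeg_occ_le (hD : D.IsModel α P) (k : ℕ) {V : Ω → List ℕ → ℝ≥0∞}
    (hV : ∀ v : List ℕ, v.length = k → Measurable[D.sig (deep k)] fun ω => V ω v)
    {s t : ℝ≥0∞} (hst : s < t) (ht : t ≠ ∞) {q : ℝ≥0∞}
    (hq : ∀ v : List ℕ, v.length = k → ∫⁻ ω, expNeg ((t - s) * V ω v) ∂P ≤ q)
    (htop : ∀ᵐ ω ∂P, ∀ᵐ u ∂leb, ⊤ ∉ D.X k ω u) :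
    ∫⁻ ω, expNeg (D.occ k (V ω) ω s t) ∂P ≤ q := by
  -- The path of `X k` uses only parameters of nodes of depth less than `k` and is thus independent
  -- of `V`; it can be frozen.
  have hF := @measurable_expNeg_lintegral_onStates Ω Ω (D.sig (strictPast k)) (D.sig (deep k)) k
    (D.X k) (D.measurable_X_strictPast k) (D.length_X k) V hV s t
  have e := lintegral_diag_of_indep (hD.sig_le _) (hD.sig_le _)
    (hD.indep_sig (disjoint_strictPast_deep k)) hF
  simp only at e
  unfold occ
  rw [e]
  have h0 : t - s ≠ 0 := (tsub_pos_of_lt hst).ne'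
  have hts : t - s ≠ ∞ := ne_top_of_le_ne_top ht tsub_le_self
  calc _ ≤ ∫⁻ _, q ∂P := ?_
    _ = q := by simp
  refine lintegral_mono_ae ?_
  filter_upwards [htop] with ω hω
  have hX : Measurable fun u => D.X k ω u :=
    (D.measurable_X_strictPast k).comp (@measurable_prodMk_left Ω ℝ≥0∞ (D.sig (strictPast k)) _ ω)
  have hjoint : Measurable fun p : Ω × ℝ≥0∞ => onStates (V p.1) (D.X k ω p.2) :=
    measurable_onStates (U := fun p : Ω × ℝ≥0∞ => V p.1) (L := fun p : Ω × ℝ≥0∞ => D.X k ω p.2)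
      (hX.comp measurable_snd) (fun p => D.length_X k ω _)
      fun v hv => ((hV v hv).mono (hD.sig_le _) le_rfl).comp measurable_fst
  have hleb : (leb.restrict (Set.Ico s t)) Set.univ = t - s := by
    rw [Measure.restrict_apply_univ, leb_Ico ht]
  rw [← ENNReal.mul_le_mul_iff_right h0 hts, ← lintegral_const_mul' _ _ hts]
  -- Jensen's inequality over the window, followed by Tonelli, leaves a single time, at which the
  -- frozen state is one fixed node.
  calc ∫⁻ ω', (t - s) * expNeg (∫⁻ u in Set.Ico s t, onStates (V ω') (D.X k ω u) ∂leb) ∂P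
      ≤ ∫⁻ ω', ∫⁻ u in Set.Ico s t, expNeg ((t - s) * onStates (V ω') (D.X k ω u)) ∂leb ∂P := by
        refine lintegral_mono fun ω' => ?_
        have := mul_expNeg_lintegral_le (μ := leb.restrict (Set.Ico s t))
          (hjoint.comp (measurable_prodMk_left (x := ω'))) (by rw [hleb]; exact hts)
        rwa [hleb] at this
    _ = ∫⁻ u in Set.Ico s t, ∫⁻ ω', expNeg ((t - s) * onStates (V ω') (D.X k ω u)) ∂P ∂leb :=
        lintegral_lintegral_swap (measurable_expNeg.comp (hjoint.const_mul _)).aemeasurable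
    _ ≤ ∫⁻ u in Set.Ico s t, q ∂leb := by
        refine lintegral_mono_ae (ae_restrict_of_ae ?_)
        filter_upwards [hω] with u hu
        simp only [onStates, hu, if_false]
        exact hq _ (by simp [D.length_X])
    _ = (t - s) * q := by rw [setLIntegral_const, leb_Ico ht, mul_comm]

/-- A random variable with the law of a compound Poisson sum of exponential variables. -/
lemma exists_compound_poisson (hD : D.IsModel α P) {τ : ℝ≥0∞} (hτ : τ ≠ ∞) :
    ∃ G : Ω → ℝ≥0∞, Measurable G ∧ (∀ᵐ ω ∂P, G ω < ∞) ∧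
      ∀ c, ∫⁻ ω, expNeg (c * G ω) ∂P = expNeg (τ * (1 - (1 + c)⁻¹)) := by
  classical
  -- The sum of the exponential variables at the marks before `τ`, for one label of one level; any
  -- level and label would serve.
  let G : Ω → ℝ≥0∞ := fun ω => ∑' i, (if D.mark 0 ω (0, i) < τ then 1 else 0) *
    ENNReal.ofReal (D.T 0 0 i ω)
  have hG : Measurable G := Measurable.tsum fun i => (Measurable.ite
    (measurableSet_lt (hD.measurable_mark 0 (0, i)) measurable_const) measurable_const
      measurable_const).mul (ENNReal.measurable_ofReal.comp (hD.T_measurable _ _ _))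
  have hL : ∀ c, ∫⁻ ω, expNeg (c * G ω) ∂P = expNeg (τ * (1 - (1 + c)⁻¹)) := fun c => by
    have h := hD.lintegral_expNeg_marks_label 0 0 (g := fun u => if u < τ then c else 0)
      (Measurable.ite measurableSet_Iio measurable_const measurable_const)
    have e1 : ∀ ω, c * G ω = ∑' i, (if D.mark 0 ω (0, i) < τ then c else 0) *
        ENNReal.ofReal (D.T 0 0 i ω) := fun ω => by
      rw [← ENNReal.tsum_mul_left]
      refine tsum_congr fun i => ?_
      split_ifs <;> simp
    simp_rw [e1]
    rw [h]
    congr 1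
    have e2 : ∀ u, 1 - (1 + if u < τ then c else 0)⁻¹ =
        (Set.Ico 0 τ).indicator (fun _ => 1 - (1 + c)⁻¹) u := fun u => by
      by_cases hu : u < τ <;> simp [hu]
    simp_rw [e2]
    rw [lintegral_indicator measurableSet_Ico, setLIntegral_const, leb_Ico hτ, tsub_zero, mul_comm]
  refine ⟨G, hG, ?_, hL⟩
  refine ae_lt_top_of_tendsto_lintegral_expNeg hG inv_natCast_add_one_ne_zero ?_
  simp_rw [hL]
  have h1 : Tendsto (fun n : ℕ => ((n : ℝ≥0∞) + 1)⁻¹) atTop (𝓝 0) := by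
    simpa using tendsto_inv_natCast_mul ENNReal.one_ne_top
  have h2 : Tendsto (fun n : ℕ => τ * (((n : ℝ≥0∞) + 1)⁻¹)) atTop (𝓝 0) := by
    simpa using ENNReal.Tendsto.const_mul h1 (.inr hτ)
  have h3 := (continuous_expNeg.tendsto _).comp h2
  rw [expNeg_zero] at h3
  refine tendsto_of_tendsto_of_tendsto_of_le_of_le h3 tendsto_const_nhds (fun n => ?_)
    fun n => expNeg_le_one _
  exact expNeg_antitone (mul_le_mul_right (one_sub_inv_one_add_le _) τ)

/-- The moments of the compound Poisson sums. -/
lemma lintegral_rpow_compound_poisson {a : ℝ} (ha : 0 < a) (ha1 : a < 1) {τ : ℝ≥0∞}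
    {G : Ω → ℝ≥0∞} (hG : Measurable G) (hfin : ∀ᵐ ω ∂P, G ω < ∞)
    (hL : ∀ c, ∫⁻ ω, expNeg (c * G ω) ∂P = expNeg (τ * (1 - (1 + c)⁻¹))) :
    ∫⁻ ω, G ω ^ a ∂P = visitExponent a τ := by
  -- The power `G ^ a` is a mixture of `1 - exp (-s G)`, so after Tonelli its mean only involves the
  -- known Laplace transform of `G`.
  have h1 : ∫⁻ ω, G ω ^ a ∂P =
      ∫⁻ ω, ∫⁻ s, (1 - expNeg (ENNReal.ofReal s * G ω)) ∂(levelIntensity a 1) ∂P := by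
    refine lintegral_congr_ae ?_
    filter_upwards [hfin] with ω hω
    rw [← lintegral_one_sub_expNeg_mul_rpow ha ha1 hω.ne]
    simp_rw [ENNReal.rpow_one, mul_comm]
  rw [h1, lintegral_lintegral_swap, visitExponent]
  · refine lintegral_congr fun s => ?_
    rw [← hL, one_sub_lintegral_expNeg (hG.const_mul _)]
  · refine (measurable_const.sub (measurable_expNeg.comp ?_)).aemeasurable
    exact (ENNReal.measurable_ofReal.comp measurable_snd).mul (hG.comp measurable_fst)

end IsModel

end KTreeData

lemma measurable_expNeg_killSum {A B : Type*} {_ : MeasurableSpace A} {_ : MeasurableSpace B}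
    {g : ℕ → A → ℝ≥0∞} {U : ℕ → B → ℝ≥0∞} (hg : ∀ x, Measurable (g x)) (hU : ∀ x, Measurable (U x))
    (τ : ℝ≥0∞) : Measurable fun q : A × B =>
      expNeg (τ * ∑' x, (1 - (1 + g x q.1 * U x q.2)⁻¹)) := by
  refine measurable_expNeg.comp ((Measurable.tsum fun x => ?_).const_mul τ)
  exact measurable_const.sub
    ((((hg x).comp measurable_fst).mul ((hU x).comp measurable_snd)).const_add 1).inv

namespace KTreeData

lemma subtree_mono {v w : List ℕ} (h : v <:+ w) : subtree w ⊆ subtree v := by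
  rintro _ ⟨u, rfl, hu⟩
  exact ⟨u, rfl, h.trans hu⟩

lemma disjoint_subtree_cons {v : List ℕ} {x y : ℕ} (h : x ≠ y) :
    Disjoint (subtree (x :: v)) (subtree (y :: v)) := by
  rw [Set.disjoint_right]
  rintro _ ⟨w, rfl, h1⟩ ⟨w', h2, h3⟩
  simp only [Sum.inl.injEq] at h2
  subst h2
  have := (List.suffix_of_suffix_length_le h3 h1 (by simp)).eq_of_length (by simp)
  exact h (List.cons.inj this).1

variable {Ω : Type*} {D : KTreeData Ω}

lemma measurable_killIter_subtree {U : Ω → List ℕ → ℝ≥0∞}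
    (hU : ∀ v, Measurable[D.sig (subtree v)] fun ω => U ω v) (m : ℕ) (v : List ℕ) :
    Measurable[D.sig (subtree v)] fun ω => killIter (D.weight ω) m (U ω) v := by
  induction m generalizing v with
  | zero => exact hU v
  | succ m ih =>
    exact measurable_killRate (fun x => D.measurable_weight_sig x ⟨v, rfl, List.suffix_refl v⟩)
      fun x => (ih (x :: v)).mono (D.sig_mono (subtree_mono (List.suffix_cons x v))) le_rfl

namespace IsModel

variable [MeasurableSpace Ω] {P : Measure Ω} [IsProbabilityMeasure P] {α : ℕ → ℝ}

/-- Bound for the Laplace transform of the killing rate of a node, given a bound for the children. -/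
lemma lintegral_expNeg_killRate_le (hD : D.IsModel α P) (hα_pos : 0 < α 0) (hα_mono : StrictMono α)
    (hα_lt : ∀ k, α k < 1) {v : List ℕ} {n : ℕ} (hn : v.length = n) {U : Ω → List ℕ → ℝ≥0∞}
    (hU : ∀ x, Measurable[D.sig (subtree (x :: v))] fun ω => U ω (x :: v)) {C : ℝ≥0∞}
    (hC : ∀ x y, y ≠ ∞ → ∫⁻ ω, expNeg (y * U ω (x :: v)) ∂P ≤ expNeg (C * minRpow (α (n + 1)) y))
    {τ : ℝ≥0∞} (hτ : τ ≠ ∞) :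
    ∫⁻ ω, expNeg (τ * killRate (D.weight ω) (U ω) v) ∂P ≤
      expNeg (branchExponent (α n) (α (n + 1)) C * visitExponent (α n) τ) := by
  subst hn
  set n := v.length
  have ha : 0 < α n := hα_pos.trans_le (hα_mono.monotone (Nat.zero_le _))
  have hab : α n < α (n + 1) := hα_mono (Nat.lt_succ_self n)
  obtain ⟨G, hG, hGfin, hGL⟩ := hD.exists_compound_poisson hτ
  -- `h s` is the bound for the contribution of a child with parameter `s`.
  let h : ℝ → ℝ≥0∞ := fun s => ∫⁻ ω, expNeg (C * minRpow (α (n + 1)) (ENNReal.ofReal s * G ω)) ∂P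
  have hjoint : Measurable fun p : ℝ × Ω => C * minRpow (α (n + 1)) (ENNReal.ofReal p.1 * G p.2) :=
    ((measurable_minRpow _).comp ((ENNReal.measurable_ofReal.comp measurable_fst).mul
      (hG.comp measurable_snd))).const_mul C
  have hhm : Measurable h := Measurable.lintegral_prod_right (measurable_expNeg.comp hjoint)
  have hh1 : ∀ s, h s ≤ 1 := fun s => lintegral_expNeg_le_one _
  have hUm : ∀ x, Measurable fun ω => U ω (x :: v) := fun x => (hU x).mono (hD.sig_le _) le_rfl
  -- The auxiliary variable `G` linearizes the killing: the integrand is the Laplace transform of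
  -- `G` at `s * U`, and after exchanging the integrals the hypothesis on `U` applies with `y = s *
  -- G`.
  have hx : ∀ x s, ∫⁻ ω, expNeg (τ * (1 - (1 + ENNReal.ofReal s * U ω (x :: v))⁻¹)) ∂P ≤ h s := by
    intro x s
    calc _ = ∫⁻ ω, ∫⁻ ω', expNeg (ENNReal.ofReal s * U ω (x :: v) * G ω') ∂P ∂P := by
          refine lintegral_congr fun ω => ?_
          rw [hGL]
      _ = ∫⁻ ω', ∫⁻ ω, expNeg (ENNReal.ofReal s * U ω (x :: v) * G ω') ∂P ∂P := by
          refine lintegral_lintegral_swap (measurable_expNeg.comp ?_).aemeasurable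
          exact (((hUm x).comp measurable_fst).const_mul _).mul (hG.comp measurable_snd)
      _ ≤ h s := by
          refine lintegral_mono_ae ?_
          filter_upwards [hGfin] with ω' hω'
          have := hC x (ENNReal.ofReal s * G ω') (ENNReal.mul_ne_top ENNReal.ofReal_ne_top hω'.ne)
          refine le_trans (le_of_eq (lintegral_congr fun ω => ?_)) this
          congr 1; ring
  let S : Set (List ℕ ⊕ (ℕ × ℕ) ⊕ (ℕ × ℕ × ℕ)) := {.inl v}
  let T : Set (List ℕ ⊕ (ℕ × ℕ) ⊕ (ℕ × ℕ × ℕ)) := ⋃ x, subtree (x :: v)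
  have hST : Disjoint S T := by
    rw [Set.disjoint_left]
    rintro _ rfl hi
    obtain ⟨x, w, hw, hs⟩ := Set.mem_iUnion.1 hi
    simp only [Sum.inl.injEq] at hw
    subst hw
    have := hs.length_le
    simp at this
  have hF := @measurable_expNeg_killSum Ω Ω (D.sig S) (D.sig T) (fun x ω => D.weight ω v x)
    (fun x ω => U ω (x :: v)) (fun x => D.measurable_weight_sig x (Set.mem_singleton _))
    (fun x => (hU x).mono (D.sig_mono (Set.subset_iUnion (fun x => subtree (x :: v)) x)) le_rfl) τ
  have e := lintegral_diag_of_indep (hD.sig_le S) (hD.sig_le T) (hD.indep_sig hST) hF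
  simp only at e
  unfold killRate
  rw [e]
  calc _ ≤ ∫⁻ ω, expNeg (∑' x, (fun s => negLog (h s)) (D.γ v x ω)) ∂P := by
        refine lintegral_mono fun ω => ?_
        simp_rw [← ENNReal.tsum_mul_left]
        rw [lintegral_expNeg_tsum hD.source_le hD.indep (fun x => subtree (x :: v))
          (fun x y hxy => disjoint_subtree_cons hxy)
          (fun x ω' => τ * (1 - (1 + D.weight ω v x * U ω' (x :: v))⁻¹)) ?_
          (fun x => negLog (∫⁻ ω', expNeg (τ * (1 - (1 + D.weight ω v x * U ω' (x :: v))⁻¹)) ∂P)) ?_]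
        · refine expNeg_antitone (ENNReal.tsum_le_tsum fun x => ?_)
          exact negLog_antitone (hx x _) (hh1 _)
        · intro x
          exact (measurable_const.sub (((hU x).const_mul _).const_add 1).inv).const_mul τ
        · intro x
          rw [expNeg_negLog (lintegral_expNeg_le_one _)]
    _ = expNeg (∫⁻ s, (1 - h s) ∂(levelIntensity (α n) (α (n + 1)))) := by
        rw [(hD.γ_process v).lintegral_expNeg (g := fun s => negLog (h s))
          (measurable_negLog.comp hhm)]
        simp_rw [expNeg_negLog (hh1 _)]
        rfl
    _ = expNeg (branchExponent (α n) (α (n + 1)) C * visitExponent (α n) τ) := by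
        congr 1
        -- By scaling, the integral over `s` equals `G ^ α n` times an exponent that does not depend
        -- on `G`; the mean of `G ^ α n` is `visitExponent`.
        calc _ = ∫⁻ s, ∫⁻ ω, (1 - expNeg (C * minRpow (α (n + 1)) (ENNReal.ofReal s * G ω))) ∂P
              ∂(levelIntensity (α n) (α (n + 1))) := by
              refine lintegral_congr fun s => ?_
              exact one_sub_lintegral_expNeg (hjoint.comp measurable_prodMk_left)
          _ = ∫⁻ ω, ∫⁻ s, (1 - expNeg (C * minRpow (α (n + 1)) (ENNReal.ofReal s * G ω)))
              ∂(levelIntensity (α n) (α (n + 1))) ∂P :=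
              lintegral_lintegral_swap
                (measurable_const.sub (measurable_expNeg.comp hjoint)).aemeasurable
          _ = ∫⁻ ω, G ω ^ α n * branchExponent (α n) (α (n + 1)) C ∂P := by
              refine lintegral_congr_ae ?_
              filter_upwards [hGfin] with ω hω
              exact lintegral_one_sub_expNeg_minRpow ha hab C hω.ne
          _ = _ := by
              rw [lintegral_mul_const _ (hG.pow_const _),
                lintegral_rpow_compound_poisson ha (hα_lt n) hG hGfin hGL, mul_comm]

/-- Uniform bounds for the iterated killing rates. -/
lemma lintegral_expNeg_killIter_le (hD : D.IsModel α P) (hα_pos : 0 < α 0) (hα_mono : StrictMono α)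
    (hα_lt : ∀ k, α k < 1) (hα_lim : Tendsto α atTop (𝓝 1)) {r : ℕ → ℝ}
    (hr : ∀ k, ENNReal.ofReal (Real.exp (-r k)) ≤
      branchExponent (α k) (α (k + 1)) 1 * visitExponent (α k) 1) (hr0 : ∀ k, 0 ≤ r k)
    (x : ℝ) (m : ℕ) (v : List ℕ) {y : ℝ≥0∞} (hy : y ≠ ∞) :
    ∫⁻ ω, expNeg (y * killIter (D.weight ω) m
        (fun w => ENNReal.ofReal (Real.exp x) * D.limW α w ω) v) ∂P ≤
      expNeg (ENNReal.ofReal (Real.exp (α v.length *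
        growth α (fun k => r k / α 0) x m v.length)) * minRpow (α v.length) y) := by
  have hpos : ∀ k, 0 < α k := fun k => hα_pos.trans_le (hα_mono.monotone (Nat.zero_le k))
  induction m generalizing v y with
  | zero =>
    rcases eq_or_ne y 0 with rfl | h0
    · simp [minRpow]
    have hx : ENNReal.ofReal (Real.exp x) ≠ 0 := by simp [Real.exp_pos]
    -- Without killing steps the exponent is `(y * exp x) ^ α v.length`, and `y ^ α` dominates `min
    -- y (y ^ α)`.
    have h1 := hD.lintegral_expNeg_limW hα_pos hα_mono hα_lim v
      (c := y * ENNReal.ofReal (Real.exp x)) (mul_ne_zero h0 hx)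
      (ENNReal.mul_ne_top hy ENNReal.ofReal_ne_top)
    simp only [killIter, growth, ← mul_assoc]
    rw [h1]
    refine expNeg_antitone ?_
    rw [ENNReal.mul_rpow_of_nonneg _ _ (hpos _).le, ENNReal.ofReal_rpow_of_pos (Real.exp_pos x),
      ← Real.exp_mul, mul_comm (α v.length), mul_comm (y ^ _)]
    exact mul_le_mul_right (min_le_right _ _) _
  | succ m ih =>
    set n := v.length with hn
    have hm := measurable_killIter_subtree (D := D)
      (U := fun ω w => ENNReal.ofReal (Real.exp x) * D.limW α w ω)
      (fun v => (D.measurable_limW α v (S := subtree v) fun w hw => ⟨w, rfl, hw⟩).const_mul _) m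
    refine (hD.lintegral_expNeg_killRate_le hα_pos hα_mono hα_lt (n := n) hn.symm (fun z => hm (z :: v))
      (C := ENNReal.ofReal (Real.exp (α (n + 1) * growth α (fun k => r k / α 0) x m (n + 1))))
      (fun z y hy => ?_) hy).trans (expNeg_antitone ?_)
    · exact ih (z :: v) hy
    · have h1 := exponent_step hα_pos hα_mono hα_lt hr hr0 n
        (growth α (fun k => r k / α 0) x m (n + 1))
      have h2 := visitExponent_lower (hpos n) (hα_lt n) hy
      refine (mul_le_mul_left h1 _).trans ?_
      rw [mul_assoc]
      exact mul_le_mul_right h2 _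

end IsModel

end KTreeData

/-! ### Finiteness and divergence of the clocks. -/

lemma killIter_const_le (g : List ℕ → ℕ → ℝ≥0∞) (c : ℝ≥0∞) (m : ℕ) (v : List ℕ) :
    killIter g m (fun _ => c) v ≤ c * descSum g 1 v m := by
  induction m generalizing v with
  | zero => simp [killIter, descSum_zero]
  | succ m ih =>
    rw [descSum_succ zero_le_one, ← ENNReal.tsum_mul_left]
    refine (killRate_le g _ v).trans (ENNReal.tsum_le_tsum fun x => ?_)
    rw [ENNReal.rpow_one, mul_left_comm]
    exact mul_le_mul_right (ih (x :: v)) _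

lemma tendsto_minRpow_top {a : ℝ} (ha : 0 < a) {u : ℕ → ℝ≥0∞} (hu : Tendsto u atTop (𝓝 ∞)) :
    Tendsto (fun n => minRpow a (u n)) atTop (𝓝 ∞) := by
  have h := ((ENNReal.continuous_rpow_const (y := a)).tendsto ∞).comp hu
  rw [ENNReal.top_rpow_of_pos ha] at h
  simpa [minRpow] using hu.min h

lemma tendsto_expNeg_mul_zero {c : ℝ≥0∞} (hc : c ≠ 0) {u : ℕ → ℝ≥0∞} (hu : Tendsto u atTop (𝓝 ∞)) :
    Tendsto (fun n => expNeg (c * u n)) atTop (𝓝 0) := by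
  have h := ENNReal.Tendsto.const_mul (a := c) hu (.inl ENNReal.top_ne_zero)
  rw [ENNReal.mul_top hc] at h
  simpa [Function.comp_def] using (continuous_expNeg.tendsto _).comp h

lemma ae_eq_top_of_lintegral_expNeg_le {A : Type*} [MeasurableSpace A] {μ : Measure A}
    {Y : A → ℝ≥0∞} (hY : Measurable Y) {q : ℕ → ℝ≥0∞} (hq : Tendsto q atTop (𝓝 0))
    (h : ∀ n, ∫⁻ a, expNeg (Y a) ∂μ ≤ q n) : ∀ᵐ a ∂μ, Y a = ∞ := by
  have h0 : ∫⁻ a, expNeg (Y a) ∂μ = 0 := le_antisymm (ge_of_tendsto' hq h) zero_le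
  filter_upwards [(lintegral_eq_zero_iff (f := fun a => expNeg (Y a))
    (measurable_expNeg.comp hY)).1 h0] with a ha
  exact expNeg_eq_zero.1 ha

namespace KTreeData

variable {Ω : Type*} {D : KTreeData Ω}

lemma measurable_X_right (D : KTreeData Ω) (k : ℕ) (ω : Ω) : Measurable fun u => D.X k ω u :=
  (D.measurable_X_strictPast k).comp
    (@measurable_prodMk_left Ω ℝ≥0∞ (D.sig (strictPast k)) _ ω)

lemma SimpleMarks.clock_zero {ω : Ω} (hω : D.SimpleMarks ω) (k : ℕ) : D.clock k ω 0 = 0 := by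
  rw [clock_eq, jumpSum_zero (hω k).2]

lemma SimpleMarks.clockComp_zero {ω : Ω} (hω : D.SimpleMarks ω) (k m : ℕ) :
    D.clockComp k m ω 0 = 0 := by
  induction m with
  | zero => rfl
  | succ m ih => simp [clockComp, ih, hω.clock_zero]

/-- The clocks of level `k + 1` are finite at finite times, and tend to infinity. -/
def ProperClock (D : KTreeData Ω) (k : ℕ) (ω : Ω) : Prop :=
  (∀ t, t ≠ ∞ → D.clock k ω t ≠ ∞) ∧ ∀ M, M ≠ ∞ → ∃ n : ℕ, M ≤ D.clock k ω n

lemma clockComp_ne_top {ω : Ω} {k m : ℕ} (h : ∀ j, k ≤ j → j < k + m → D.ProperClock j ω)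
    {t : ℝ≥0∞} (ht : t ≠ ∞) : D.clockComp k m ω t ≠ ∞ := by
  induction m with
  | zero => exact ht
  | succ m ih =>
    exact (h (k + m) (by omega) (by omega)).1 _ (ih fun j h1 h2 => h j h1 (by omega))

lemma exists_le_clockComp {ω : Ω} {k m : ℕ} (h : ∀ j, k ≤ j → j < k + m → D.ProperClock j ω)
    {M : ℝ≥0∞} (hM : M ≠ ∞) : ∃ n : ℕ, M ≤ D.clockComp k m ω n := by
  induction m generalizing M with
  | zero =>
    obtain ⟨n, hn⟩ := ENNReal.exists_nat_gt hM
    exact ⟨n, hn.le⟩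
  | succ m ih =>
    obtain ⟨n, hn⟩ := (h (k + m) (by omega) (by omega)).2 M hM
    obtain ⟨r, hr⟩ := ih (fun j h1 h2 => h j h1 (by omega)) (ENNReal.natCast_ne_top n)
    exact ⟨r, hn.trans (D.clock_mono _ ω hr)⟩

lemma occ_zero (U : List ℕ → ℝ≥0∞) (ω : Ω) {t : ℝ≥0∞} (ht : t ≠ ∞) :
    D.occ 0 U ω 0 t = t * U [] := by
  simp only [occ, X, onStates, List.not_mem_nil, if_false, List.map_nil]
  rw [setLIntegral_const, leb_Ico ht, tsub_zero, mul_comm]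

namespace IsModel

variable [MeasurableSpace Ω] {P : Measure Ω} [IsProbabilityMeasure P] {α : ℕ → ℝ}

/-- The clock is a sum of jumps with constant weight `c`. Working with jumps instead of occupation
times avoids assuming that the clock is finite. -/
lemma lintegral_expNeg_mul_clock (hD : D.IsModel α P) (k : ℕ) {b : Ω → ℝ≥0∞}
    (hb : Measurable[D.sig (past k)] b) (c : ℝ≥0∞) :
    ∫⁻ ω, expNeg (c * D.clock k ω (b ω)) ∂P =
      ∫⁻ ω, expNeg (D.occ k (killRate (D.weight ω) fun _ => c) ω 0 (b ω)) ∂P := by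
  have h := hD.lintegral_mul_expNeg_jumps k (ψ := fun _ => 1) (a := fun _ => 0) measurable_const
    measurable_const hb (U := fun _ _ => c) fun v _ => measurable_const
  simp only [one_mul] at h
  rw [← h]
  refine lintegral_congr_ae ?_
  filter_upwards [hD.ae_simpleMarks] with ω hω
  rw [clock_eq, jumpSum_eq_add (zero_le (a := b ω)), jumpSum_zero (hω k).2, zero_add,
    ← ENNReal.tsum_mul_left]
  congr 1
  refine tsum_congr fun j => ?_
  simp only [jump, extendZero]
  split_ifs <;> ring

/-- Duality down to the root bounds the Laplace transform from below by that of `r` times a sum of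
path products: each killing step is at most linear, and these sums are finite. Properness of the
earlier clocks is what permits the duality. -/
lemma ae_clockComp_zero_ne_top (hD : D.IsModel α P) (hα_pos : 0 < α 0) (hα_mono : StrictMono α)
    (hα_lt : ∀ k, α k < 1) (k : ℕ) (h : ∀ᵐ ω ∂P, ∀ j < k, D.ProperClock j ω) (r : ℕ) :
    ∀ᵐ ω ∂P, D.clock k ω (D.clockComp 0 k ω r) ≠ ∞ := by
  have hr : Measurable[D.sig (past 0)] fun _ : Ω => (r : ℝ≥0∞) := measurable_const
  have hB := D.measurable_clockComp_past 0 k hr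
  rw [zero_add] at hB
  have hm : Measurable fun ω => D.clock k ω (D.clockComp 0 k ω r) :=
    (D.measurable_clock_past k hB).mono (hD.sig_le _) le_rfl
  have hfin : ∀ᵐ ω ∂P, (r : ℝ≥0∞) * descSum (D.weight ω) 1 [] (k + 1) < ∞ := by
    filter_upwards [hD.ae_descSum_one_ne_top hα_pos hα_mono hα_lt] with ω hω
    exact ENNReal.mul_lt_top (ENNReal.natCast_lt_top r) (hω _ _).lt_top
  refine (ae_lt_top_of_lintegral_expNeg_le hm ((hD.measurable_descSum _ _ _).const_mul _) hfin
    fun c _ _ => ?_).mono fun ω hω => hω.ne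
  rw [hD.lintegral_expNeg_mul_clock k hB c]
  have key := hD.lintegral_mul_expNeg_occ_comp 0 k (ψ := fun _ => 1) (a := fun _ => 0)
    (b := fun _ => (r : ℝ≥0∞)) measurable_const measurable_const measurable_const
    (fun _ => zero_le) (fun j hj => by
      filter_upwards [h] with ω hω
      exact clockComp_ne_top (fun i _ hi => hω i (by omega)) (ENNReal.natCast_ne_top r))
    (U := fun ω => killRate (D.weight ω) fun _ => c)
    (measurable_killRate_past (U := fun _ _ => c) fun _ _ => measurable_const)
  simp only [one_mul, zero_add, killIter_killRate] at key
  calc _ ≤ ∫⁻ ω, expNeg (D.occ 0 (killIter (D.weight ω) (k + 1) fun _ => c) ω 0 r) ∂P := by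
        refine lintegral_mono fun ω => expNeg_antitone ?_
        rw [occ_zero _ _ (ENNReal.natCast_ne_top r), mul_left_comm]
        exact mul_le_mul_right (killIter_const_le _ _ _ _) _
    _ = _ := by
        rw [← key]
        refine lintegral_congr_ae ?_
        filter_upwards [hD.ae_simpleMarks] with ω hω
        rw [hω.clockComp_zero]

lemma ae_top_notMem_X_succ (hD : D.IsModel α P) (k : ℕ) (h : ∀ᵐ ω ∂P, D.ProperClock k ω) :
    ∀ᵐ ω ∂P, ∀ᵐ u ∂leb, ⊤ ∉ D.X (k + 1) ω u := by
  classical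
  filter_upwards [h, hD.ae_simpleMarks] with ω hω hs
  let f : ℝ≥0∞ → ℝ≥0∞ := fun u => if ⊤ ∈ D.X (k + 1) ω u then 1 else 0
  have hm : Measurable f :=
    (Measurable.of_discrete (f := fun l : List ℕ∞ => if ⊤ ∈ l then (1 : ℝ≥0∞) else 0)).comp
      (D.measurable_X_right (k + 1) ω)
  have h1 : ∀ n : ℕ, ∀ᵐ u ∂leb, u ∈ Set.Ico 0 (D.clock k ω n) → ⊤ ∉ D.X (k + 1) ω u := fun n => by
    have h0 : ∫⁻ u in Set.Ico 0 (D.clock k ω n), f u ∂leb = 0 :=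
      leb_top_mem_X_succ hs (hω.1 n (ENNReal.natCast_ne_top n))
    have h2 := (ae_restrict_iff' measurableSet_Ico).1 ((lintegral_eq_zero_iff hm).1 h0)
    filter_upwards [h2] with u hu hmem htop
    have := hu hmem
    simp [f, htop] at this
  have h2 : ∀ᵐ u ∂leb, u ≠ ∞ := by simp [ae_iff]
  filter_upwards [ae_all_iff.2 h1, h2] with u hu htop
  obtain ⟨n, hn⟩ := hω.2 (u + 1) (ENNReal.add_ne_top.2 ⟨htop, ENNReal.one_ne_top⟩)
  exact hu n ⟨zero_le, (ENNReal.lt_add_right htop one_ne_zero).trans_le hn⟩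

/-- By Jensen's inequality and the one-step bound with `U = 1` and `C = 1`, the Laplace transform of
the clock at time `n` is at most `exp (-c * min n (n ^ α k))`, which tends to `0`. -/
lemma ae_exists_le_clock (hD : D.IsModel α P) (hα_pos : 0 < α 0) (hα_mono : StrictMono α)
    (hα_lt : ∀ k, α k < 1) (k : ℕ) (h : ∀ᵐ ω ∂P, ∀ᵐ u ∂leb, ⊤ ∉ D.X k ω u) :
    ∀ᵐ ω ∂P, ∀ M, M ≠ ∞ → ∃ n : ℕ, M ≤ D.clock k ω n := by
  have ha : 0 < α k := hα_pos.trans_le (hα_mono.monotone (Nat.zero_le _))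
  have hm : ∀ n : ℕ, Measurable fun ω => D.clock k ω n := fun n =>
    (D.measurable_clock_past k (a := fun _ => (n : ℝ≥0∞)) measurable_const).mono (hD.sig_le _) le_rfl
  set c := branchExponent (α k) (α (k + 1)) 1 * visitExponent (α k) 1
  have hc : c ≠ 0 := mul_ne_zero (branchExponent_one_pos ha (hα_mono (Nat.lt_succ_self k))).ne'
    (visitExponent_one_pos ha (hα_lt k)).ne'
  have hq : Tendsto (fun n : ℕ => expNeg (c * minRpow (α k) ((n + 1 : ℕ) : ℝ≥0∞))) atTop (𝓝 0) :=
    tendsto_expNeg_mul_zero hc (tendsto_minRpow_top ha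
      (ENNReal.tendsto_nat_nhds_top.comp (tendsto_add_atTop_nat 1)))
  have hle : ∀ n : ℕ, ∫⁻ ω, expNeg (⨆ n : ℕ, D.clock k ω n) ∂P ≤
      expNeg (c * minRpow (α k) ((n + 1 : ℕ) : ℝ≥0∞)) := fun n => by
    calc _ ≤ ∫⁻ ω, expNeg (1 * D.clock k ω ((n + 1 : ℕ) : ℝ≥0∞)) ∂P := by
          refine lintegral_mono fun ω => expNeg_antitone ?_
          rw [one_mul]
          exact le_iSup (fun n : ℕ => D.clock k ω n) (n + 1)
      _ = ∫⁻ ω, expNeg (D.occ k (killRate (D.weight ω) fun _ => 1) ω 0 ((n + 1 : ℕ) : ℝ≥0∞)) ∂P :=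
          hD.lintegral_expNeg_mul_clock k measurable_const 1
      _ ≤ _ := by
          refine hD.lintegral_expNeg_occ_le k (V := fun ω => killRate (D.weight ω) fun _ => 1)
            (fun v hv => ?_) (by simp) (ENNReal.natCast_ne_top _) (fun v hv => ?_) h
          · exact measurable_killRate (U := fun _ _ => 1)
              (fun x => D.measurable_weight_sig x ⟨v, rfl, hv.ge⟩) fun _ => measurable_const
          · rw [tsub_zero]
            refine (hD.lintegral_expNeg_killRate_le hα_pos hα_mono hα_lt hv (U := fun _ _ => 1)
              (fun x => measurable_const) (C := 1) (fun x y _ => ?_)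
              (ENNReal.natCast_ne_top _)).trans (expNeg_antitone ?_)
            · simp only [mul_one, one_mul, lintegral_const, measure_univ]
              exact expNeg_antitone (min_le_left _ _)
            · rw [mul_assoc]
              exact mul_le_mul_right
                (visitExponent_lower ha (hα_lt k) (ENNReal.natCast_ne_top _)) _
  filter_upwards [ae_eq_top_of_lintegral_expNeg_le (Measurable.iSup hm) hq hle] with ω hω M hM
  obtain ⟨n, hn⟩ := lt_iSup_iff.1 (hω ▸ hM.lt_top)
  exact ⟨n, hn.le⟩

/-- Almost surely the clocks are proper and the processes spend no time in infinite states. -/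
lemma ae_proper (hD : D.IsModel α P) (hα_pos : 0 < α 0) (hα_mono : StrictMono α)
    (hα_lt : ∀ k, α k < 1) (k : ℕ) :
    (∀ᵐ ω ∂P, ∀ j < k, D.ProperClock j ω) ∧ ∀ᵐ ω ∂P, ∀ᵐ u ∂leb, ⊤ ∉ D.X k ω u := by
  induction k with
  | zero => exact ⟨by simp, by simp [X]⟩
  | succ k ih =>
    obtain ⟨h1, h2⟩ := ih
    have h3 : ∀ᵐ ω ∂P, D.ProperClock k ω := by
      filter_upwards [h1, ae_all_iff.2 (hD.ae_clockComp_zero_ne_top hα_pos hα_mono hα_lt k h1),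
        hD.ae_exists_le_clock hα_pos hα_mono hα_lt k h2] with ω g1 g2 g3
      refine ⟨fun t ht => ?_, g3⟩
      -- The earlier clocks are unbounded, so `t` lies below the image of some integer, where
      -- finiteness is known.
      obtain ⟨n, hn⟩ := exists_le_clockComp (D := D) (ω := ω) (k := 0) (m := k)
        (fun j _ hj => g1 j (by omega)) ht
      exact ne_top_of_le_ne_top (g2 n) (D.clock_mono k ω hn)
    refine ⟨?_, hD.ae_top_notMem_X_succ k h3⟩
    filter_upwards [h1, h3] with ω g1 g3 j hj
    rcases Nat.lt_succ_iff_lt_or_eq.1 hj with h | rfl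
    exacts [g1 j h, g3]

end IsModel

end KTreeData

/-! ### Increments of the adjusted compositions and their limits. -/

lemma onStates_const_mul (c : ℝ≥0∞) (U : List ℕ → ℝ≥0∞) (l : List ℕ∞) :
    onStates (fun v => c * U v) l = c * onStates U l := by
  unfold onStates
  split_ifs <;> simp

/-- Superharmonicity for the linear operator suffices, since `killRate` lies below it; the lemma is
applied to multiples of `limW`. -/
lemma killIter_le {g : List ℕ → ℕ → ℝ≥0∞} {U : List ℕ → ℝ≥0∞}
    (h : ∀ v, ∑' x, g v x * U (x :: v) ≤ U v) (m : ℕ) (v : List ℕ) : killIter g m U v ≤ U v := by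
  induction m generalizing v with
  | zero => rfl
  | succ m ih =>
    exact (killRate_mono g fun x => ih (x :: v)).trans ((killRate_le g U v).trans (h v))

namespace KTreeData

variable {Ω : Type*} {D : KTreeData Ω}

lemma mul_occ {c : ℝ≥0∞} (hc : c ≠ ∞) (k : ℕ) (U : List ℕ → ℝ≥0∞) (ω : Ω) (a b : ℝ≥0∞) :
    c * D.occ k U ω a b = D.occ k (fun v => c * U v) ω a b := by
  rw [occ, ← lintegral_const_mul' _ _ hc]
  simp_rw [← onStates_const_mul]
  rfl

lemma occ_add_occ (k : ℕ) (U : List ℕ → ℝ≥0∞) (ω : Ω) {a b c : ℝ≥0∞} (hab : a ≤ b) (hbc : b ≤ c) :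
    D.occ k U ω a b + D.occ k U ω b c = D.occ k U ω a c := by
  rw [occ, occ, occ, ← Set.Ico_union_Ico_eq_Ico hab hbc, lintegral_union measurableSet_Ico]
  rw [Set.disjoint_left]
  exact fun u h1 h2 => absurd h2.1 (not_le.2 h1.2)

/-- The increments of the adjusted compositions of `m` clocks over the interval from `s` to `t`. -/
noncomputable def window (D : KTreeData Ω) (α : ℕ → ℝ) (k m : ℕ) (ω : Ω) (s t : ℝ≥0∞) : ℝ≥0∞ :=
  D.occ (k + m) (fun v => D.limW α v ω) ω (D.clockComp k m ω s) (D.clockComp k m ω t)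

/-- The limits of the increments. -/
noncomputable def windowLim (D : KTreeData Ω) (α : ℕ → ℝ) (k : ℕ) (ω : Ω) (s t : ℝ≥0∞) : ℝ≥0∞ :=
  limsup (fun m => D.window α k m ω s t) atTop

lemma measurable_limW_past (D : KTreeData Ω) (α : ℕ → ℝ) (m : ℕ) (v : List ℕ) :
    Measurable[D.sig (past m)] (D.limW α v) := D.measurable_limW α v fun _ _ => by trivial

lemma measurable_window_past (D : KTreeData Ω) (α : ℕ → ℝ) (k m : ℕ) (s t : ℝ≥0∞) :
    Measurable[D.sig (past (k + m))] fun ω => D.window α k m ω s t :=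
  measurable_occ (U := fun ω v => D.limW α v ω) subset_rfl
    (fun v _ => D.measurable_limW_past α _ v)
    (D.measurable_clockComp_past k m (a := fun _ => s) measurable_const)
    (D.measurable_clockComp_past k m (a := fun _ => t) measurable_const)

lemma window_add (α : ℕ → ℝ) (k m : ℕ) (ω : Ω) {s t u : ℝ≥0∞} (h1 : s ≤ t) (h2 : t ≤ u) :
    D.window α k m ω s t + D.window α k m ω t u = D.window α k m ω s u :=
  occ_add_occ _ _ _ (D.clockComp_mono k m ω h1) (D.clockComp_mono k m ω h2)

lemma windowLim_mono (α : ℕ → ℝ) (k : ℕ) (ω : Ω) : Monotone (D.windowLim α k ω 0) := fun s t h =>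
  limsup_le_limsup (.of_forall fun m => by
    have := D.clockComp_mono k m ω h
    exact lintegral_mono_set (Set.Ico_subset_Ico_right this))

namespace IsModel

variable [MeasurableSpace Ω] {P : Measure Ω} {α : ℕ → ℝ}

lemma measurable_window (hD : D.IsModel α P) (k m : ℕ) (s t : ℝ≥0∞) :
    Measurable fun ω => D.window α k m ω s t :=
  (D.measurable_window_past α k m s t).mono (hD.sig_le _) le_rfl

lemma measurable_windowLim (hD : D.IsModel α P) (k : ℕ) (s t : ℝ≥0∞) :
    Measurable fun ω => D.windowLim α k ω s t :=
  measurable_limsup_of fun m => hD.measurable_window k m s t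

lemma measurable_occ_limW (hD : D.IsModel α P) (k : ℕ) (s t : ℝ≥0∞) :
    Measurable fun ω => D.occ k (fun v => D.limW α v ω) ω s t :=
  hD.measurable_window k 0 s t

variable [IsProbabilityMeasure P]

lemma ae_properClock (hD : D.IsModel α P) (hα_pos : 0 < α 0) (hα_mono : StrictMono α)
    (hα_lt : ∀ k, α k < 1) : ∀ᵐ ω ∂P, ∀ k, D.ProperClock k ω := by
  rw [ae_all_iff]
  intro k
  filter_upwards [(hD.ae_proper hα_pos hα_mono hα_lt (k + 1)).1] with ω hω
  exact hω k (Nat.lt_succ_self k)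

/-- Duality replaces W one level deeper by `killRate W ≤ W`, so the negative exponentials of the
windows form a bounded submartingale. -/
lemma ae_tendsto_window (hD : D.IsModel α P) (hα_pos : 0 < α 0) (hα_mono : StrictMono α)
    (hα_lt : ∀ k, α k < 1) (hα_lim : Tendsto α atTop (𝓝 1)) (k : ℕ) {s t : ℝ≥0∞} (hst : s ≤ t)
    (ht : t ≠ ∞) :
    ∀ᵐ ω ∂P, Tendsto (fun m => D.window α k m ω s t) atTop (𝓝 (D.windowLim α k ω s t)) := by
  let ℱ : Filtration ℕ ‹MeasurableSpace Ω› :=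
    { seq := fun m => D.sig (past (k + m))
      mono' := fun i j hij => D.sig_mono (past_mono (by omega))
      le' := fun m => hD.sig_le _ }
  refine ae_tendsto_of_expNeg_submartingale ℱ (fun m ω => D.window α k m ω s t)
    (fun m => D.measurable_window_past α k m s t) fun m E hE => ?_
  rw [← lintegral_indicator_one_mul (ℱ.le m E hE), ← lintegral_indicator_one_mul (ℱ.le m E hE)]
  have hψ : Measurable[D.sig (past (k + m))] (E.indicator (1 : Ω → ℝ≥0∞)) :=
    measurable_indicator_one_of hE
  have key := hD.lintegral_mul_expNeg_occ_succ (k + m) hψ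
    (D.measurable_clockComp_past k m (a := fun _ => s) measurable_const)
    (D.measurable_clockComp_past k m (a := fun _ => t) measurable_const)
    (fun ω => D.clockComp_mono k m ω hst) (by
      filter_upwards [hD.ae_properClock hα_pos hα_mono hα_lt] with ω hω
      exact clockComp_ne_top (m := m + 1) (fun j _ _ => hω j) ht)
    (U := fun ω v => D.limW α v ω) fun v _ => D.measurable_limW_past α _ v
  refine le_trans ?_ key.ge
  refine lintegral_mono_ae ?_
  filter_upwards [hD.ae_tsum_weight_mul_limW_le hα_pos hα_mono hα_lim] with ω hω
  exact mul_le_mul_right (expNeg_antitone (occ_mono (fun v _ => (killRate_le _ _ _).trans (hω v))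
    ω _ _)) _

lemma ae_windowLim_add (hD : D.IsModel α P) (hα_pos : 0 < α 0) (hα_mono : StrictMono α)
    (hα_lt : ∀ k, α k < 1) (hα_lim : Tendsto α atTop (𝓝 1)) (k : ℕ) {s t u : ℝ≥0∞} (h1 : s ≤ t)
    (h2 : t ≤ u) (hu : u ≠ ∞) :
    ∀ᵐ ω ∂P, D.windowLim α k ω s t + D.windowLim α k ω t u = D.windowLim α k ω s u := by
  filter_upwards [hD.ae_tendsto_window hα_pos hα_mono hα_lt hα_lim k h1 (ne_top_of_le_ne_top hu h2),
    hD.ae_tendsto_window hα_pos hα_mono hα_lt hα_lim k h2 hu,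
    hD.ae_tendsto_window hα_pos hα_mono hα_lt hα_lim k (h1.trans h2) hu] with ω g1 g2 g3
  refine tendsto_nhds_unique ((g1.add g2).congr fun m => ?_) g3
  exact window_add α k m ω h1 h2

lemma lintegral_expNeg_mul_window (hD : D.IsModel α P) (hα_pos : 0 < α 0) (hα_mono : StrictMono α)
    (hα_lt : ∀ k, α k < 1) (k m : ℕ) {s t : ℝ≥0∞} (hst : s ≤ t)
    (ht : t ≠ ∞) {c : ℝ≥0∞} (hc : c ≠ ∞) :
    ∫⁻ ω, expNeg (c * D.window α k m ω s t) ∂P =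
      ∫⁻ ω, expNeg (D.occ k (killIter (D.weight ω) m fun v => c * D.limW α v ω) ω s t) ∂P := by
  have key := hD.lintegral_mul_expNeg_occ_comp k m (ψ := fun _ => 1) (a := fun _ => s)
    (b := fun _ => t) measurable_const measurable_const measurable_const (fun _ => hst)
    (fun j _ => by
      filter_upwards [hD.ae_properClock hα_pos hα_mono hα_lt] with ω hω
      exact clockComp_ne_top (fun j _ _ => hω j) ht)
    (U := fun ω v => c * D.limW α v ω) fun v _ => (D.measurable_limW_past α _ v).const_mul c
  simp only [one_mul] at key
  simp_rw [window, mul_occ hc]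
  exact key

/-- All levels are removed by duality, and iterated killing only decreases W. This controls the
increments from above, uniformly in `m`. -/
lemma lintegral_expNeg_occ_le_window (hD : D.IsModel α P) (hα_pos : 0 < α 0) (hα_mono : StrictMono α)
    (hα_lt : ∀ k, α k < 1) (hα_lim : Tendsto α atTop (𝓝 1)) (k m : ℕ) {s t : ℝ≥0∞} (hst : s ≤ t)
    (ht : t ≠ ∞) {c : ℝ≥0∞} (hc : c ≠ ∞) :
    ∫⁻ ω, expNeg (c * D.occ k (fun v => D.limW α v ω) ω s t) ∂P ≤
      ∫⁻ ω, expNeg (c * D.window α k m ω s t) ∂P := by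
  rw [hD.lintegral_expNeg_mul_window hα_pos hα_mono hα_lt k m hst ht hc]
  refine lintegral_mono_ae ?_
  filter_upwards [hD.ae_tsum_weight_mul_limW_le hα_pos hα_mono hα_lim] with ω hω
  rw [mul_occ hc]
  refine expNeg_antitone (occ_mono (fun v _ => killIter_le (fun v => ?_) m v) ω s t)
  simp_rw [mul_left_comm _ c, ENNReal.tsum_mul_left]
  exact mul_le_mul_right (hω v) c

lemma tendsto_lintegral_expNeg_window (hD : D.IsModel α P) (hα_pos : 0 < α 0)
    (hα_mono : StrictMono α) (hα_lt : ∀ k, α k < 1) (hα_lim : Tendsto α atTop (𝓝 1)) (k : ℕ)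
    {s t : ℝ≥0∞} (hst : s ≤ t) (ht : t ≠ ∞) {c : ℝ≥0∞} (hc : c ≠ ∞) :
    Tendsto (fun m => ∫⁻ ω, expNeg (c * D.window α k m ω s t) ∂P) atTop
      (𝓝 (∫⁻ ω, expNeg (c * D.windowLim α k ω s t) ∂P)) := by
  refine tendsto_lintegral_expNeg (fun m => (hD.measurable_window k m s t).const_mul c) ?_
  filter_upwards [hD.ae_tendsto_window hα_pos hα_mono hα_lt hα_lim k hst ht] with ω hω
  exact ENNReal.Tendsto.const_mul hω (.inr hc)

lemma lintegral_expNeg_occ_le_windowLim (hD : D.IsModel α P) (hα_pos : 0 < α 0)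
    (hα_mono : StrictMono α) (hα_lt : ∀ k, α k < 1) (hα_lim : Tendsto α atTop (𝓝 1)) (k : ℕ)
    {s t : ℝ≥0∞} (hst : s ≤ t) (ht : t ≠ ∞) {c : ℝ≥0∞} (hc : c ≠ ∞) :
    ∫⁻ ω, expNeg (c * D.occ k (fun v => D.limW α v ω) ω s t) ∂P ≤
      ∫⁻ ω, expNeg (c * D.windowLim α k ω s t) ∂P :=
  ge_of_tendsto' (hD.tendsto_lintegral_expNeg_window hα_pos hα_mono hα_lt hα_lim k hst ht hc)
    fun m => hD.lintegral_expNeg_occ_le_window hα_pos hα_mono hα_lt hα_lim k m hst ht hc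

/-- At the root the occupation integral over `[0, r)` is `r` times W, which is finite; the images of
these windows under the first `k` clocks cover every `[0, t)`. -/
lemma ae_occ_limW_lt_top (hD : D.IsModel α P) (hα_pos : 0 < α 0)
    (hα_mono : StrictMono α) (hα_lt : ∀ k, α k < 1) (hα_lim : Tendsto α atTop (𝓝 1)) (k : ℕ) :
    ∀ᵐ ω ∂P, ∀ t, t ≠ ∞ → D.occ k (fun v => D.limW α v ω) ω 0 t < ∞ := by
  have h1 : ∀ r : ℕ, ∀ᵐ ω ∂P, D.window α 0 k ω 0 r < ∞ := fun r => by
    refine ae_lt_top_of_lintegral_expNeg_le (hD.measurable_window 0 k 0 r)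
      (hD.measurable_occ_limW 0 0 r) ?_ fun c _ hc =>
      hD.lintegral_expNeg_occ_le_window hα_pos hα_mono hα_lt hα_lim 0 k zero_le
        (ENNReal.natCast_ne_top r) hc
    filter_upwards [hD.ae_limW_lt_top hα_pos hα_mono hα_lim] with ω hω
    rw [occ_zero _ _ (ENNReal.natCast_ne_top r)]
    exact ENNReal.mul_lt_top (ENNReal.natCast_lt_top r) (hω _)
  filter_upwards [ae_all_iff.2 h1, hD.ae_properClock hα_pos hα_mono hα_lt, hD.ae_simpleMarks]
    with ω hω hp hs t ht
  obtain ⟨n, hn⟩ := exists_le_clockComp (D := D) (ω := ω) (k := 0) (m := k) (fun j _ _ => hp j) ht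
  refine lt_of_le_of_lt ?_ (hω n)
  rw [window, hs.clockComp_zero, zero_add]
  exact lintegral_mono_set (Set.Ico_subset_Ico_right hn)

lemma ae_windowLim_lt_top (hD : D.IsModel α P) (hα_pos : 0 < α 0)
    (hα_mono : StrictMono α) (hα_lt : ∀ k, α k < 1) (hα_lim : Tendsto α atTop (𝓝 1)) (k : ℕ)
    {t : ℝ≥0∞} (ht : t ≠ ∞) : ∀ᵐ ω ∂P, D.windowLim α k ω 0 t < ∞ := by
  refine ae_lt_top_of_lintegral_expNeg_le (hD.measurable_windowLim k 0 t)
    (hD.measurable_occ_limW k 0 t) ?_ fun c _ hc =>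
      hD.lintegral_expNeg_occ_le_windowLim hα_pos hα_mono hα_lt hα_lim k zero_le ht hc
  filter_upwards [hD.ae_occ_limW_lt_top hα_pos hα_mono hα_lt hα_lim k] with ω hω using hω t ht

/-- The limits of the increments tend to zero over intervals that shrink to a point. -/
lemma ae_iInf_windowLim (hD : D.IsModel α P) (hα_pos : 0 < α 0)
    (hα_mono : StrictMono α) (hα_lt : ∀ k, α k < 1) (hα_lim : Tendsto α atTop (𝓝 1)) (k : ℕ)
    {t : ℝ≥0∞} (ht : t ≠ ∞) :
    ∀ᵐ ω ∂P, ⨅ j : ℕ, D.windowLim α k ω t (t + ((j : ℝ≥0∞) + 1)⁻¹) = 0 := by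
  have htj : ∀ j : ℕ, t + ((j : ℝ≥0∞) + 1)⁻¹ ≠ ∞ := fun j =>
    ENNReal.add_ne_top.2 ⟨ht, inv_natCast_add_one_ne_top j⟩
  have hm : Measurable fun ω => ⨅ j : ℕ, D.windowLim α k ω t (t + ((j : ℝ≥0∞) + 1)⁻¹) :=
    Measurable.iInf fun j => hD.measurable_windowLim k _ _
  have h1 : Tendsto (fun j : ℕ => ((j : ℝ≥0∞) + 1)⁻¹) atTop (𝓝 0) := by
    simpa using tendsto_inv_natCast_mul ENNReal.one_ne_top
  have hT : Tendsto (fun j : ℕ => ∫⁻ ω, expNeg (D.occ k (fun v => D.limW α v ω) ω t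
      (t + ((j : ℝ≥0∞) + 1)⁻¹)) ∂P) atTop (𝓝 (∫⁻ _, expNeg 0 ∂P)) := by
    refine tendsto_lintegral_expNeg (fun j => hD.measurable_occ_limW k _ _) ?_
    filter_upwards [hD.ae_occ_limW_lt_top hα_pos hα_mono hα_lt hα_lim k] with ω hω
    have hfin := (hω (t + 1) (ENNReal.add_ne_top.2 ⟨ht, ENNReal.one_ne_top⟩)).ne
    -- All the windows lie in `[0, t + 1)`, over which the integral is finite, so absolute
    -- continuity of the integral applies.
    have e : ∀ j : ℕ, D.occ k (fun v => D.limW α v ω) ω t (t + ((j : ℝ≥0∞) + 1)⁻¹) =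
        ∫⁻ u in Set.Ico t (t + ((j : ℝ≥0∞) + 1)⁻¹), onStates (fun v => D.limW α v ω) (D.X k ω u)
          ∂(leb.restrict (Set.Ico 0 (t + 1))) := fun j => by
      rw [occ, Measure.restrict_restrict measurableSet_Ico, Set.inter_eq_left.2]
      refine Set.Ico_subset_Ico zero_le (add_le_add_right ?_ t)
      exact ENNReal.inv_le_one.2 le_add_self
    simp_rw [e]
    refine tendsto_setLIntegral_zero hfin ?_
    refine tendsto_of_tendsto_of_tendsto_of_le_of_le tendsto_const_nhds h1 (fun _ => zero_le) fun j => ?_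
    refine (Measure.restrict_apply_le _ _).trans ?_
    rw [leb_Ico (htj j), ENNReal.add_sub_cancel_left ht]
  -- The Laplace transform of the infimum dominates quantities that tend to `1`, so the infimum must
  -- vanish.
  have hge : 1 ≤ ∫⁻ ω, expNeg (⨅ j : ℕ, D.windowLim α k ω t (t + ((j : ℝ≥0∞) + 1)⁻¹)) ∂P := by
    rw [expNeg_zero, lintegral_one, measure_univ] at hT
    refine le_of_tendsto' hT fun j => ?_
    have := hD.lintegral_expNeg_occ_le_windowLim hα_pos hα_mono hα_lt hα_lim k
      (s := t) (t := t + ((j : ℝ≥0∞) + 1)⁻¹) le_self_add (htj j) ENNReal.one_ne_top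
    simp only [one_mul] at this
    exact this.trans (lintegral_mono fun ω => expNeg_antitone (iInf_le _ j))
  have h0 : ∫⁻ ω, (1 - expNeg (⨅ j : ℕ, D.windowLim α k ω t (t + ((j : ℝ≥0∞) + 1)⁻¹))) ∂P = 0 := by
    rw [← one_sub_lintegral_expNeg hm, tsub_eq_zero_iff_le]
    exact hge
  filter_upwards [(lintegral_eq_zero_iff (f := fun ω => 1 - expNeg (⨅ j : ℕ,
    D.windowLim α k ω t (t + ((j : ℝ≥0∞) + 1)⁻¹)))
    (measurable_const.sub (measurable_expNeg.comp hm))).1 h0] with ω hω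
  by_contra hne
  exact one_sub_expNeg_ne_zero hne hω

/-- The jumps of the adjusted clock are weighted by W at the children, so their sum is an occupation
integral of W one level deeper. With the adjusted clock counted, `m + 1` clocks are composed. -/
lemma ae_adjustedClockComp_eq (hD : D.IsModel α P) (hα_pos : 0 < α 0) (hα_mono : StrictMono α)
    (hα_lt : ∀ k, α k < 1) (k : ℕ) :
    ∀ᵐ ω ∂P, ∀ m t, t ≠ ∞ → D.adjustedClockComp α k m ω t = D.window α k (m + 1) ω 0 t := by
  filter_upwards [hD.ae_W_eq_limW, hD.ae_simpleMarks, hD.ae_properClock hα_pos hα_mono hα_lt]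
    with ω hW hs hp m t ht
  have hB : D.clock (k + m) ω (D.clockComp k m ω t) ≠ ∞ :=
    clockComp_ne_top (m := m + 1) (fun j _ _ => hp j) ht
  have h := lintegral_onStates_X_succ hs (zero_le (a := D.clockComp k m ω t)) hB
    (fun v => D.limW α v ω)
  rw [adjustedClockComp, Function.comp_apply, adjustedClock, clockAlong_eq,
    jumpSum_eq_add (zero_le (a := D.clockComp k m ω t)), jumpSum_zero (hs (k + m)).2, zero_add]
  rw [hs.clock_zero] at h
  rw [window, hs.clockComp_zero]
  refine Eq.trans ?_ h.symm
  simp_rw [hW, mul_comm (D.limW α _ ω)]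
  rfl

end IsModel

end KTreeData

/-! ### Right-continuous regularization -/

/-- The right-continuous regularization of a nondecreasing function, computed from its values at
rational times. -/
noncomputable def rightReg (L : ℝ≥0∞ → ℝ≥0∞) (t : ℝ≥0) : ℝ≥0∞ :=
  ⨅ (q : ℚ) (_ : t < Real.toNNReal q), L (Real.toNNReal q : ℝ≥0)

lemma rightReg_mono (L : ℝ≥0∞ → ℝ≥0∞) : Monotone (rightReg L) := fun _ _ h =>
  le_iInf₂ fun q hq => iInf₂_le q (h.trans_lt hq)

lemma exists_lt_toNNReal_ratCast (t : ℝ≥0) : ∃ q : ℚ, t < Real.toNNReal q := by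
  obtain ⟨q, -, hq, -⟩ := (NNReal.lt_iff_exists_rat_btwn t (t + 1)).1 (lt_add_one t)
  exact ⟨q, hq⟩

section RightReg

variable {L : ℝ≥0∞ → ℝ≥0∞}

lemma rightReg_ne_top (hfin : ∀ q : ℚ, L (Real.toNNReal q : ℝ≥0) ≠ ∞) (t : ℝ≥0) :
    rightReg L t ≠ ∞ := by
  obtain ⟨q, hq⟩ := exists_lt_toNNReal_ratCast t
  exact ne_top_of_le_ne_top (hfin q) (iInf₂_le q hq)

lemma toNNReal_rightReg_mono (hfin : ∀ q : ℚ, L (Real.toNNReal q : ℝ≥0) ≠ ∞) :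
    Monotone fun t => (rightReg L t).toNNReal := fun _ t h =>
  ENNReal.toNNReal_mono (rightReg_ne_top hfin t) (rightReg_mono L h)

lemma continuousWithinAt_rightReg (hfin : ∀ q : ℚ, L (Real.toNNReal q : ℝ≥0) ≠ ∞) (t : ℝ≥0) :
    ContinuousWithinAt (fun t => (rightReg L t).toNNReal) (Set.Ici t) t := by
  refine tendsto_order.2 ⟨fun c hc => ?_, fun c hc => ?_⟩
  · filter_upwards [self_mem_nhdsWithin] with s hs
    exact hc.trans_le (toNNReal_rightReg_mono hfin hs)
  · have h1 : rightReg L t < c := by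
      rwa [← ENNReal.coe_toNNReal (rightReg_ne_top hfin t), ENNReal.coe_lt_coe]
    obtain ⟨q, hq⟩ := iInf_lt_iff.1 h1
    obtain ⟨hqt, hq⟩ := iInf_lt_iff.1 hq
    filter_upwards [mem_nhdsWithin_of_mem_nhds (Iio_mem_nhds hqt)] with s hs
    rw [← ENNReal.coe_lt_coe, ENNReal.coe_toNNReal (rightReg_ne_top hfin s)]
    exact lt_of_le_of_lt (iInf₂_le q hs) hq

/-- A rational time fits between `t` and `t + 1 / (j + 1)`, so continuity along this sequence
suffices. -/
lemma rightReg_eq (hL : Monotone L) (t : ℝ≥0)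
    (h : ⨅ j : ℕ, L (t + ((j : ℝ≥0∞) + 1)⁻¹) = L t) : rightReg L t = L t := by
  refine le_antisymm ?_ (le_iInf₂ fun q hq => hL (by exact_mod_cast hq.le))
  rw [← h]
  refine le_iInf fun j => ?_
  have hlt : (t : ℝ≥0∞) < t + ((j : ℝ≥0∞) + 1)⁻¹ :=
    ENNReal.lt_add_right ENNReal.coe_ne_top (inv_natCast_add_one_ne_zero j)
  obtain ⟨q, -, h1, h2⟩ := ENNReal.lt_iff_exists_rat_btwn.1 hlt
  exact (iInf₂_le q (by exact_mod_cast h1)).trans (hL h2.le)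

end RightReg

lemma dense_range_toNNReal_ratCast : Dense (Set.range fun q : ℚ => Real.toNNReal q) := by
  refine dense_of_exists_between fun a b hab => ?_
  obtain ⟨q, -, h1, h2⟩ := (NNReal.lt_iff_exists_rat_btwn a b).1 hab
  exact ⟨_, ⟨q, rfl⟩, h1, h2⟩

/-! ### Existence and non-triviality of the limiting clocks. -/

namespace KTreeData.IsModel

variable {Ω : Type*} {D : KTreeData Ω} [MeasurableSpace Ω] {P : Measure Ω} [IsProbabilityMeasure P]
  {α : ℕ → ℝ}

/-- Limiting increments are additive and vanish over windows shrinking to `t`. The exceptional null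
set depends on `t`. -/
lemma ae_rightReg_windowLim (hD : D.IsModel α P) (hα_pos : 0 < α 0) (hα_mono : StrictMono α)
    (hα_lt : ∀ k, α k < 1) (hα_lim : Tendsto α atTop (𝓝 1)) (k : ℕ) (t : ℝ≥0) :
    ∀ᵐ ω ∂P, rightReg (D.windowLim α k ω 0) t = D.windowLim α k ω 0 t := by
  have h1 : ∀ j : ℕ, ∀ᵐ ω ∂P, D.windowLim α k ω 0 t +
      D.windowLim α k ω t (t + ((j : ℝ≥0∞) + 1)⁻¹) =
      D.windowLim α k ω 0 (t + ((j : ℝ≥0∞) + 1)⁻¹) := fun j =>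
    hD.ae_windowLim_add hα_pos hα_mono hα_lt hα_lim k zero_le le_self_add
      (ENNReal.add_ne_top.2 ⟨ENNReal.coe_ne_top, inv_natCast_add_one_ne_top j⟩)
  filter_upwards [ae_all_iff.2 h1,
    hD.ae_iInf_windowLim hα_pos hα_mono hα_lt hα_lim k (ENNReal.coe_ne_top (r := t))] with ω g1 g2
  refine rightReg_eq (windowLim_mono α k ω) t ?_
  simp_rw [← g1, ← ENNReal.add_iInf, g2, add_zero]

lemma ae_tendsto_adjustedClockComp (hD : D.IsModel α P) (hα_pos : 0 < α 0) (hα_mono : StrictMono α)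
    (hα_lt : ∀ k, α k < 1) (hα_lim : Tendsto α atTop (𝓝 1)) (k : ℕ) (t : ℝ≥0) :
    ∀ᵐ ω ∂P, Tendsto (fun m => D.adjustedClockComp α k m ω t) atTop
      (𝓝 (D.windowLim α k ω 0 t)) := by
  filter_upwards [hD.ae_adjustedClockComp_eq hα_pos hα_mono hα_lt k,
    hD.ae_tendsto_window hα_pos hα_mono hα_lt hα_lim k zero_le (ENNReal.coe_ne_top (r := t))]
    with ω h1 h2
  exact ((tendsto_add_atTop_iff_nat 1).2 h2).congr fun m => (h1 m t ENNReal.coe_ne_top).symm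

/-- A limiting clock exists. -/
lemma exists_isLimitClock (hD : D.IsModel α P) (hα_pos : 0 < α 0) (hα_mono : StrictMono α)
    (hα_lt : ∀ k, α k < 1) (hα_lim : Tendsto α atTop (𝓝 1)) (k : ℕ) :
    ∃ θ : ℝ≥0 → Ω → ℝ≥0, D.IsLimitClock α P k θ := by
  have hfin : ∀ᵐ ω ∂P, ∀ q : ℚ, D.windowLim α k ω 0 (Real.toNNReal q : ℝ≥0) ≠ ∞ :=
    ae_all_iff.2 fun q => (hD.ae_windowLim_lt_top hα_pos hα_mono hα_lt hα_lim k
      ENNReal.coe_ne_top).mono fun ω h => h.ne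
  refine ⟨fun t ω => (rightReg (D.windowLim α k ω 0) t).toNNReal, ⟨fun t => ?_, ?_,
    Set.range fun q : ℚ => Real.toNNReal q, Set.countable_range _, dense_range_toNNReal_ratCast,
    fun t _ => ?_⟩⟩
  · exact (Measurable.iInf fun q => Measurable.iInf fun _ =>
      hD.measurable_windowLim k _ _).ennreal_toNNReal
  · filter_upwards [hfin] with ω hω
    exact ⟨toNNReal_rightReg_mono hω, continuousWithinAt_rightReg hω⟩
  · filter_upwards [hfin, hD.ae_rightReg_windowLim hα_pos hα_mono hα_lt hα_lim k t,
      hD.ae_tendsto_adjustedClockComp hα_pos hα_mono hα_lt hα_lim k t] with ω h1 h2 h3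
    rw [ENNReal.coe_toNNReal (rightReg_ne_top h1 t), h2]
    exact h3

/-- Uniform lower bounds for the increments of the limiting clocks. -/
lemma exists_lintegral_expNeg_windowLim_le (hD : D.IsModel α P) (hα_pos : 0 < α 0)
    (hα_mono : StrictMono α) (hα_lt : ∀ k, α k < 1) (hα_lim : Tendsto α atTop (𝓝 1))
    (hsum : Summable (fun k => (1 - α (k + 1)) / (1 - α k))) :
    ∃ p R : ℝ, 0 < p ∧ ∀ (k n : ℕ) (s t : ℝ≥0), s < t →
      ∫⁻ ω, expNeg (ENNReal.ofReal (Real.exp n) * D.windowLim α k ω s t) ∂P ≤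
        expNeg (ENNReal.ofReal (Real.exp (α k * (p * n - R))) * minRpow (α k) (t - s : ℝ≥0)) := by
  obtain ⟨r, hr0, hrs, hr⟩ := exists_rates hα_pos hα_mono hα_lt hsum
  obtain ⟨p, R, hp, hg⟩ := growth_lower hα_pos hα_mono hα_lt (summable_one_sub hα_lt hsum)
    (r := fun k => r k / α 0) (fun k => div_nonneg (hr0 k) hα_pos.le) (hrs.div_const _)
  refine ⟨p, R, hp, fun k n s t hst => ?_⟩
  have hst' : (s : ℝ≥0∞) < t := by exact_mod_cast hst
  refine le_of_tendsto' (hD.tendsto_lintegral_expNeg_window hα_pos hα_mono hα_lt hα_lim k hst'.le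
    ENNReal.coe_ne_top ENNReal.ofReal_ne_top) fun m => ?_
  rw [hD.lintegral_expNeg_mul_window hα_pos hα_mono hα_lt k m hst'.le ENNReal.coe_ne_top
    ENNReal.ofReal_ne_top]
  refine hD.lintegral_expNeg_occ_le k
    (V := fun ω => killIter (D.weight ω) m fun v => ENNReal.ofReal (Real.exp n) * D.limW α v ω)
    (fun v hv => ?_) hst' ENNReal.coe_ne_top (fun v hv => ?_)
    (hD.ae_proper hα_pos hα_mono hα_lt k).2
  · refine (measurable_killIter_subtree (D := D)
      (U := fun ω v => ENNReal.ofReal (Real.exp n) * D.limW α v ω)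
      (fun v => (D.measurable_limW α v (S := subtree v) fun w hw => ⟨w, rfl, hw⟩).const_mul _)
      m v).mono (D.sig_mono ?_) le_rfl
    exact hv ▸ subtree_subset_deep v
  · rw [← ENNReal.coe_sub]
    refine (hD.lintegral_expNeg_killIter_le hα_pos hα_mono hα_lt hα_lim hr hr0 n m v
      ENNReal.coe_ne_top).trans (expNeg_antitone ?_)
    rw [hv]
    refine mul_le_mul_left (ENNReal.ofReal_le_ofReal (Real.exp_le_exp.2 ?_)) _
    exact mul_le_mul_of_nonneg_left (hg n (Nat.cast_nonneg n) m k)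
      (hα_pos.trans_le (hα_mono.monotone (Nat.zero_le k))).le

/-- The limiting clocks are strictly increasing and tend to infinity. -/
lemma ae_strictMono_of_isLimitClock (hD : D.IsModel α P) (hα_pos : 0 < α 0)
    (hα_mono : StrictMono α) (hα_lt : ∀ k, α k < 1) (hα_lim : Tendsto α atTop (𝓝 1))
    (hsum : Summable (fun k => (1 - α (k + 1)) / (1 - α k))) {k : ℕ} {θ : ℝ≥0 → Ω → ℝ≥0}
    (hθ : D.IsLimitClock α P k θ) :
    ∀ᵐ ω ∂P, StrictMono (fun t => θ t ω) ∧ Tendsto (fun t => θ t ω) atTop atTop := by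
  obtain ⟨p, R, hp, hbound⟩ :=
    hD.exists_lintegral_expNeg_windowLim_le hα_pos hα_mono hα_lt hα_lim hsum
  obtain ⟨S, hSc, hSd, hS⟩ := hθ.limit
  have hak : 0 < α k := hα_pos.trans_le (hα_mono.monotone (Nat.zero_le k))
  -- A limiting clock is identified with `windowLim` only on its own countable dense set.
  have hS' : ∀ᵐ ω ∂P, ∀ t ∈ S, (θ t ω : ℝ≥0∞) = D.windowLim α k ω 0 t := by
    rw [ae_ball_iff hSc]
    intro t ht
    filter_upwards [hS t ht, hD.ae_tendsto_adjustedClockComp hα_pos hα_mono hα_lt hα_lim k t]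
      with ω h1 h2 using tendsto_nhds_unique h1 h2
  have hpos : ∀ᵐ ω ∂P, ∀ s ∈ S, ∀ t ∈ S, s < t → θ s ω < θ t ω := by
    rw [ae_ball_iff hSc]
    intro s hs
    rw [ae_ball_iff hSc]
    intro t ht
    by_cases hst : s < t
    swap
    · exact .of_forall fun ω h => absurd h hst
    have hst' : (s : ℝ≥0∞) ≤ t := by exact_mod_cast hst.le
    have hm0 : minRpow (α k) (t - s : ℝ≥0) ≠ 0 := by
      have h0 : ((t - s : ℝ≥0) : ℝ≥0∞) ≠ 0 := by exact_mod_cast (tsub_pos_of_lt hst).ne'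
      rw [minRpow]
      rcases min_choice ((t - s : ℝ≥0) : ℝ≥0∞) (((t - s : ℝ≥0) : ℝ≥0∞) ^ α k) with h | h <;> rw [h]
      · exact h0
      · rwa [Ne, ENNReal.rpow_eq_zero_iff_of_pos hak]
    have hq : Tendsto (fun n : ℕ => expNeg (minRpow (α k) (t - s : ℝ≥0) *
        ENNReal.ofReal (Real.exp (α k * (p * n - R))))) atTop (𝓝 0) := by
      refine tendsto_expNeg_mul_zero hm0 (ENNReal.tendsto_ofReal_atTop.comp
        (Real.tendsto_exp_atTop.comp ?_))
      exact (tendsto_atTop_add_const_right _ _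
        (tendsto_natCast_atTop_atTop.const_mul_atTop hp)).const_mul_atTop hak
    -- The factor `∞` dominates every `exp n`. The bounds tend to `0`, so `∞ * windowLim = ∞` almost
    -- surely, which excludes the value `0`.
    have htop := ae_eq_top_of_lintegral_expNeg_le (μ := P) (Y := fun ω => ∞ * D.windowLim α k ω s t)
      ((hD.measurable_windowLim k s t).const_mul ∞) hq fun n => by
        rw [mul_comm (minRpow _ _)]
        refine le_trans (lintegral_mono fun ω => expNeg_antitone ?_) (hbound k n s t hst)
        exact mul_le_mul_left le_top _
    filter_upwards [htop, hS', hD.ae_windowLim_add hα_pos hα_mono hα_lt hα_lim k zero_le hst'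
      ENNReal.coe_ne_top] with ω h1 h2 h3 _
    have h4 : D.windowLim α k ω s t ≠ 0 := fun h => by simp [h] at h1
    rw [← h2 s hs, ← h2 t ht] at h3
    rw [← ENNReal.coe_lt_coe, ← h3]
    exact ENNReal.lt_add_right ENNReal.coe_ne_top h4
  have hex : ∀ n : ℕ, ∃ t ∈ S, (n : ℝ≥0) + 1 < t := fun n => by
    obtain ⟨t, ht, h1, -⟩ := hSd.exists_between (lt_add_one ((n : ℝ≥0) + 1))
    exact ⟨t, ht, h1⟩
  choose τ hτS hτ using hex
  -- Here the factor is fixed at `exp 0` and the length of the window tends to infinity along times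
  -- of `S`.
  have hinf : ∀ᵐ ω ∂P, ⨆ n, D.windowLim α k ω 0 (τ n) = ∞ := by
    have hτ' : Tendsto (fun n => (τ n : ℝ≥0∞)) atTop (𝓝 ∞) := by
      refine tendsto_of_tendsto_of_tendsto_of_le_of_le ENNReal.tendsto_nat_nhds_top
        tendsto_const_nhds (fun n => ?_) fun n => le_top
      have : (n : ℝ≥0) ≤ τ n := (le_add_of_nonneg_right zero_le_one).trans (hτ n).le
      exact (ENNReal.coe_natCast n).symm.trans_le (ENNReal.coe_le_coe.2 this)
    refine ae_eq_top_of_lintegral_expNeg_le (Measurable.iSup fun n => hD.measurable_windowLim k 0 _)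
      (tendsto_expNeg_mul_zero (c := ENNReal.ofReal (Real.exp (α k * (p * (0 : ℕ) - R))))
        (by simp [Real.exp_pos]) (tendsto_minRpow_top hak hτ')) fun n => ?_
    have h := hbound k 0 0 (τ n) (lt_of_le_of_lt zero_le (hτ n))
    rw [tsub_zero] at h
    refine le_trans (lintegral_mono fun ω => expNeg_antitone ?_) h
    simp only [Nat.cast_zero, Real.exp_zero, ENNReal.ofReal_one, one_mul, ENNReal.coe_zero]
    exact le_iSup (fun n => D.windowLim α k ω 0 (τ n)) n
  filter_upwards [hθ.paths, hpos, hinf, hS'] with ω h1 h2 h3 h4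
  refine ⟨fun s t hst => ?_, tendsto_atTop_atTop_of_monotone h1.1 fun M => ?_⟩
  -- Two points of `S` between `s` and `t` carry the strict inequality over to all times.
  · obtain ⟨s', hs', h5, h6⟩ := hSd.exists_between hst
    obtain ⟨t', ht', h7, h8⟩ := hSd.exists_between h6
    exact (h1.1 h5.le).trans_lt ((h2 s' hs' t' ht' h7).trans_le (h1.1 h8.le))
  · obtain ⟨n, hn⟩ := lt_iSup_iff.1 (h3 ▸ ENNReal.coe_lt_top (r := M))
    rw [← h4 _ (hτS n), ENNReal.coe_lt_coe] at hn
    exact ⟨τ n, hn.le⟩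

end KTreeData.IsModel

theorem mainTheorem3 {Ω : Type*} [MeasurableSpace Ω] (P : Measure Ω) [IsProbabilityMeasure P]
    (α : ℕ → ℝ) (hα_pos : 0 < α 0) (hα_mono : StrictMono α) (hα_lt : ∀ k, α k < 1)
    (hα_lim : Tendsto α atTop (𝓝 1))
    (D : KTreeData Ω) (hD : D.IsModel α P)
    (hsum : Summable (fun k => (1 - α (k + 1)) / (1 - α k))) :
    (∀ᵐ ω ∂P, ∀ x : List ℕ, D.W α x ω < ∞ ∧
      Tendsto (fun n => D.cylinderSum α x n ω) atTop (𝓝 (D.W α x ω))) ∧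
    ∀ k : ℕ,
      (∃ θ : ℝ≥0 → Ω → ℝ≥0, D.IsLimitClock α P k θ) ∧
      ∀ θ : ℝ≥0 → Ω → ℝ≥0, D.IsLimitClock α P k θ →
        ∀ᵐ ω ∂P, StrictMono (fun t => θ t ω) ∧ Tendsto (fun t => θ t ω) atTop atTop :=
  ⟨hD.ae_tendsto_cylinderSum hα_pos hα_mono hα_lim, fun k =>
    ⟨hD.exists_isLimitClock hα_pos hα_mono hα_lt hα_lim k, fun _ hθ =>
      hD.ae_strictMono_of_isLimitClock hα_pos hα_mono hα_lt hα_lim hsum hθ⟩⟩
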